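/- Let $M$ be a von Neumann algebra of operators on a Hilbert space $H_0$, let $E$ be a $W^*$-correspondence over $M$ with left action $\varphi$ (a self-dual right Hilbert $M$-module with a normal $*$-homomorphism $\varphi$ of $M$ into the adjointable operators $\mathcal L(E)$), and let $\sigma$ be a normal unital representation of $M$ on a Hilbert space $H$. Let $\mathcal F(E)=\bigoplus_{n\ge 0}E^{\otimes n}$ be the full Fock space, $\varphi_\infty$ the left action of $M$ on it, $T_\xi$ ($\xi\in E$) the creation operators, and $H^\infty(E)$ the ultraweakly closed algebra generated by all $\varphi_\infty(a)$ and $T_\xi$. Let $\iota_H:H\to\mathcal F(E)\otimes_\sigma H$ be the embedding as the zeroth summand and $P_H=\iota_H^*$. Let $E^\sigma$ be the set of bounded $\eta:H\to E\otimes_\sigma H$ with $\eta\,\sigma(a)=(\varphi(a)\otimes I_H)\eta$ for all $a\in M$. With $\langle\eta,\zeta\rangle=\eta^*\zeta$, $\eta\cdot c=\eta c$ and $c\cdot\eta=(I_E\otimes c)\eta$ it is a correspondence over the von Neumann algebra $\sigma(M)'$, whose identity representation on $H$ is denoted by $\iota$. Let $U:\mathcal F(E^\sigma)\otimes_\iota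 H\to\mathcal F(E)\otimes_\sigma H$ be the isometry that is the identity on $H$ and satisfies $U(\eta_1\otimes\cdots\otimes\eta_n\otimes h)=(I_{E^{\otimes(n-1)}}\otimes\eta_1)\cdots(I_E\otimes\eta_{n-1})\eta_n h$ (it is unitary when $\sigma$ is faithful), and for $Y\in H^\infty(E^\sigma)$ put $\rho(Y)=U(Y\otimes I_H)U^*$. Let $\eta\in\mathbb D(E^\sigma)$, that is, $\eta\in E^\sigma$ and $\|\eta\|<1$. Put $\Delta_*(\eta)=(I_H-\eta^*\eta)^{1/2}\in\sigma(M)'$, $\eta^{(0)}=I_H$, $\eta^{(n+1)}=(I_{E^{\otimes n}}\otimes\eta)\eta^{(n)}$, $C(\eta)=[\eta^{(0)},\eta^{(1)},\eta^{(2)},\dots]^T:H\to\mathcal F(E)\otimes_\sigma H$ and $K(\eta)=(I_{\mathcal F(E)}\otimes\Delta_*(\eta))C(\eta)$. Let $\widehat{\eta^*}(\xi)h=\eta^*(\xi\otimes h)$ for $\xi\in E$, $h\in H$. Then the following hold. 1. There is exactly one ultraweakly continuous algebra homomorphism $X\mapsto X\otimes I_H$ from $H^\infty(E)$ to $B(\mathcal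 F(E)\otimes_\sigma H)$ that sends $\varphi_\infty(a)$ to $\varphi_\infty(a)\otimes I_H$ and $T_\xi$ to $T_\xi\otimes I_H$; and exactly one ultraweakly continuous algebra homomorphism $X\mapsto\widehat X(\eta^*)$ from $H^\infty(E)$ to $B(H)$ that sends $\varphi_\infty(a)$ to $\sigma(a)$ and $T_\xi$ to $\widehat{\eta^*}(\xi)$. 2. $I-T_\eta$ is invertible with inverse in $H^\infty(E^\sigma)$, and, identifying $\Delta_*(\eta)$ with the operator by which it acts from the left on $\mathcal F(E^\sigma)$, $$K(\eta)=\rho\big(\Delta_*(\eta)(I-T_\eta)^{-1}\big)\iota_H .$$ 3. For every $X\in H^\infty(E)$, $$\begin{aligned}\widehat X(\eta^*)&=K(\eta)^*(X\otimes I_H)K(\eta)\\&=P_H\,\rho\big(\Delta_*(\eta)(I-T_\eta)^{-1}\big)^*(X\otimes I_H)\,\rho\big(\Delta_*(\eta)(I-T_\eta)^{-1}\big)\iota_H\\&=P_H\big\{\rho\big((I-T_\eta)^{-1}\big)^*\big(I_{\mathcal F(E)}\otimes\Delta_*(\eta)^2\big)\rho\big((I-T_\eta)^{-1}\big)\big\}(X\otimes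 I_H)\iota_H .\end{aligned}$$ -/

import Mathlib

universe u
open scoped TensorProduct InnerProductSpace Topology
noncomputable section
namespace PoissonKernel

section VNBase
variable {H₀ : Type u} [NormedAddCommGroup H₀] [InnerProductSpace ℂ H₀] [CompleteSpace H₀]

instance (M : VonNeumannAlgebra H₀) : IsClosed (M.toStarSubalgebra : Set (H₀ →L[ℂ] H₀)) := by
  have h : (M.toStarSubalgebra : Set (H₀ →L[ℂ] H₀)) =
      Set.centralizer (Set.centralizer (M : Set (H₀ →L[ℂ] H₀))) :=
    M.centralizer_centralizer.symm
  rw [h]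
  exact Set.isClosed_centralizer _

/-- The underlying C*-algebra of the von Neumann algebra `M ⊆ B(H₀)`, as a type. -/
def VNA (M : VonNeumannAlgebra H₀) : Type u := M.toStarSubalgebra

instance (M : VonNeumannAlgebra H₀) : CStarAlgebra M.toStarSubalgebra :=
  StarSubalgebra.cstarAlgebra M.toStarSubalgebra

instance (M : VonNeumannAlgebra H₀) : CStarAlgebra (VNA M) :=
  inferInstanceAs (CStarAlgebra M.toStarSubalgebra)

/-- An element of `M` from an operator that lies in `M`. -/
def VNA.mk {M : VonNeumannAlgebra H₀} (T : H₀ →L[ℂ] H₀) (hT : T ∈ M.toStarSubalgebra) : VNA M :=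
  ⟨T, hT⟩

/-- The inclusion of `M` into `B(H₀)`. -/
def VNA.val (M : VonNeumannAlgebra H₀) : VNA M →⋆ₐ[ℂ] (H₀ →L[ℂ] H₀) where
  toFun a := Subtype.val a
  map_one' := rfl
  map_mul' _ _ := rfl
  map_zero' := rfl
  map_add' _ _ := rfl
  commutes' _ := rfl
  map_star' _ := rfl

theorem VNA.val_mk {M : VonNeumannAlgebra H₀} (T : H₀ →L[ℂ] H₀) (hT : T ∈ M.toStarSubalgebra) :
    VNA.val M (VNA.mk T hT) = T := rfl

theorem VNA.val_mem {M : VonNeumannAlgebra H₀} (a : VNA M) :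
    VNA.val M a ∈ M.toStarSubalgebra := Subtype.property a

theorem VNA.ext {M : VonNeumannAlgebra H₀} {a b : VNA M} (h : VNA.val M a = VNA.val M b) :
    a = b := Subtype.ext h

end VNBase

/-- A C*-correspondence over `A`: a normed space `E` with a right action `rmul` of `A`, an
`A`-valued inner product `inn` (conjugate linear in the first variable) that induces the norm, and
a left action `lact = φ` of `A` by adjointable operators. The remaining module laws follow from the
listed ones because the inner product is definite. The left action need not be unital.
Completeness is not asked for here, it is a consequence of self-duality. -/
class Correspondence (A : Type u) [CStarAlgebra A] (E : Type u) [NormedAddCommGroup E]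
    [NormedSpace ℂ E] where
  inn : E → E → A
  rmul : E → A → E
  lact : A →ₙₐ[ℂ] Module.End ℂ E
  inn_add : ∀ x y z, inn x (y + z) = inn x y + inn x z
  inn_smul : ∀ (c : ℂ) x y, inn x (c • y) = c • inn x y
  inn_rmul : ∀ x y a, inn x (rmul y a) = inn x y * a
  star_inn : ∀ x y, star (inn x y) = inn y x
  inn_self_pos : ∀ x, ∃ b, inn x x = star b * b
  norm_sq : ∀ x, ‖x‖ ^ 2 = ‖inn x x‖
  inn_lact : ∀ a x y, inn (lact a x) y = inn x (lact (star a) y)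

/-- A `*`-representation of `A` on a Hilbert space, bundled with the Hilbert space. -/
structure Rep (A : Type u) [CStarAlgebra A] where
  carrier : Type u
  [normed : NormedAddCommGroup carrier]
  [ips : InnerProductSpace ℂ carrier]
  [complete : CompleteSpace carrier]
  rep : A →⋆ₙₐ[ℂ] (carrier →L[ℂ] carrier)

attribute [instance] Rep.normed Rep.ips Rep.complete

section Tensors
variable {A : Type u} [CStarAlgebra A]

theorem exists_negPart {B : Type u} [NonUnitalCStarAlgebra B] (G : B) (hsa : IsSelfAdjoint G) :
    ∃ N S : B, star N = N ∧ N = star S * S ∧ N * G * N = - (N * N * N) ∧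
      (N = 0 → ∃ T, G = star T * T) := by
  let _ := CStarAlgebra.spectralOrder B
  have _ := CStarAlgebra.spectralOrderedRing B
  have hNn : 0 ≤ G⁻ := CFC.negPart_nonneg G
  obtain ⟨S, hS⟩ := CStarAlgebra.nonneg_iff_eq_star_mul_self.mp hNn
  refine ⟨G⁻, S, IsSelfAdjoint.of_nonneg hNn, hS, ?_, fun h0 => ?_⟩
  · conv_lhs => enter [1, 2]; rw [← CFC.posPart_sub_negPart G hsa]
    rw [mul_sub, CFC.negPart_mul_posPart, zero_sub, neg_mul]
  · have hGn : 0 ≤ G := by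
      rw [← CFC.posPart_sub_negPart G hsa, h0, sub_zero]
      exact CFC.posPart_nonneg G
    exact CStarAlgebra.nonneg_iff_eq_star_mul_self.mp hGn

/-- A matrix over a C*-algebra with all quadratic values positive is a Gram matrix. -/
theorem exists_gram {n : ℕ} (G : CStarMatrix (Fin n) (Fin n) A)
    (hG : ∀ i j, star (G i j) = G j i)
    (hpos : ∀ a : Fin n → A, ∃ b, ∑ i, ∑ j, star (a i) * G i j * a j = star b * b) :
    ∃ S : CStarMatrix (Fin n) (Fin n) A, ∀ i j, G i j = ∑ k, star (S k i) * S k j := by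
  let _ := CStarAlgebra.spectralOrder A
  have _ := CStarAlgebra.spectralOrderedRing A
  have hsa : IsSelfAdjoint G := by
    ext i j
    simp [CStarMatrix.star_eq_conjTranspose, CStarMatrix.conjTranspose_apply, hG]
  obtain ⟨N, S, hNs, hS, h1, hT⟩ := exists_negPart G hsa
  have hneg : N = 0 := by
    have h2 : N * N * N = star (S * N) * (S * N) := by
      rw [star_mul, hNs, mul_assoc, mul_assoc, ← mul_assoc (star S), ← hS]
    have h3 : S * N = 0 := by
      ext i k
      obtain ⟨b, hb⟩ := hpos (fun j => N j k)
      have e1 : (N * G * N) k k = star b * b := by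
        rw [← hb, CStarMatrix.mul_apply]
        rw [Finset.sum_comm]
        refine Finset.sum_congr rfl fun j _ => ?_
        rw [CStarMatrix.mul_apply, Finset.sum_mul]
        refine Finset.sum_congr rfl fun l _ => ?_
        rw [← CStarMatrix.star_apply, hNs]
      have e2 : (star (S * N) * (S * N)) k k = ∑ i, star ((S * N) i k) * (S * N) i k := by
        rw [CStarMatrix.mul_apply]
        rfl
      have e3 : ∑ i, star ((S * N) i k) * (S * N) i k = 0 := by
        apply le_antisymm
        · have : ∑ i, star ((S * N) i k) * (S * N) i k = - (star b * b) := by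
            rw [← e1, h1, h2, ← e2]; simp
          rw [this]
          simpa using star_mul_self_nonneg b
        · exact Finset.sum_nonneg fun i _ => star_mul_self_nonneg _
      have := (Finset.sum_eq_zero_iff_of_nonneg
        (fun i _ => star_mul_self_nonneg ((S * N) i k))).mp e3 i (Finset.mem_univ i)
      simpa using this
    have h4 : N * N = 0 := by
      have : N * N = star S * (S * N) := by rw [← mul_assoc, ← hS]
      rw [this, h3, mul_zero]
    have : star N * N = 0 := by rw [hNs, h4]
    simpa using this
  obtain ⟨S, hS⟩ := hT hneg
  refine ⟨S, fun i j => ?_⟩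
  conv_lhs => rw [hS]
  rw [CStarMatrix.mul_apply]
  rfl
section Balanced

variable {E : Type u} [NormedAddCommGroup E] [NormedSpace ℂ E] [Correspondence A E]

namespace Correspondence

theorem add_inn (x y z : E) : inn (A := A) (x + y) z = inn x z + inn y z := by
  rw [← star_inn, inn_add, star_add, star_inn, star_inn]

theorem smul_inn (c : ℂ) (x y : E) : inn (A := A) (c • x) y = star c • inn x y := by
  rw [← star_inn, inn_smul, star_smul, star_inn]

theorem rmul_inn (x y : E) (a : A) : inn (rmul x a) y = star a * inn x y := by
  rw [← star_inn, inn_rmul, star_mul, star_inn]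

theorem inn_zero (x : E) : inn (A := A) x 0 = 0 := by
  have := inn_smul (A := A) 0 x 0
  simpa using this

theorem zero_inn (x : E) : inn (A := A) 0 x = 0 := by
  have := smul_inn (A := A) 0 0 x
  simpa using this

theorem inn_sum {ι : Type*} (s : Finset ι) (x : E) (f : ι → E) :
    inn (A := A) x (∑ i ∈ s, f i) = ∑ i ∈ s, inn x (f i) :=
  map_sum (AddMonoidHom.mk' (fun y => inn (A := A) x y) (fun y z => inn_add x y z)) f s

theorem sum_inn {ι : Type*} (s : Finset ι) (x : E) (f : ι → E) :
    inn (A := A) (∑ i ∈ s, f i) x = ∑ i ∈ s, inn (f i) x :=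
  map_sum (AddMonoidHom.mk' (fun y => inn (A := A) y x) (fun y z => add_inn y z x)) f s

end Correspondence
open Correspondence

/-- The algebraic tensor product `E ⊗ K`, carrying the semi-inner product
`⟨x ⊗ h, y ⊗ k⟩ = ⟨h, ⟨x, y⟩ k⟩`. -/
def PreTensor (E : Type u) [NormedAddCommGroup E] [NormedSpace ℂ E] [Correspondence A E]
    (K : Rep A) : Type u := E ⊗[ℂ] K.carrier

variable (E) in
instance (K : Rep A) : AddCommGroup (PreTensor E K) :=
  inferInstanceAs (AddCommGroup (E ⊗[ℂ] K.carrier))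

variable (E) in
instance (K : Rep A) : Module ℂ (PreTensor E K) :=
  inferInstanceAs (Module ℂ (E ⊗[ℂ] K.carrier))

/-- The elementary tensor in the algebraic tensor product. -/
def PreTensor.tmul (K : Rep A) (x : E) (k : K.carrier) : PreTensor E K := x ⊗ₜ[ℂ] k

variable (E) in
/-- The sesquilinear form `⟨x ⊗ h, y ⊗ k⟩ = ⟨h, ⟨x, y⟩ k⟩`. -/
def PreTensor.form (K : Rep A) : PreTensor E K →ₗ⋆[ℂ] PreTensor E K →ₗ[ℂ] ℂ :=
  TensorProduct.lift <| LinearMap.mk₂'ₛₗ (starRingEnd ℂ) (starRingEnd ℂ)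
    (fun (x : E) (h : K.carrier) => TensorProduct.lift <| LinearMap.mk₂ ℂ
      (fun (y : E) (k : K.carrier) => inner ℂ h (K.rep (inn x y) k))
      (fun y y' k => by simp [inn_add])
      (fun c y k => by simp [inn_smul])
      (fun y k k' => by simp)
      (fun c y k => by simp))
    (fun x x' h => TensorProduct.ext' fun y k => by
      change inner ℂ h (K.rep (inn (x + x') y) k) =
        inner ℂ h (K.rep (inn x y) k) + inner ℂ h (K.rep (inn x' y) k)
      simp [add_inn])
    (fun c x h => TensorProduct.ext' fun y k => by
      change inner ℂ h (K.rep (inn (c • x) y) k) = star c * inner ℂ h (K.rep (inn x y) k)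
      simp [smul_inn])
    (fun x h h' => TensorProduct.ext' fun y k => by
      change inner ℂ (h + h') (K.rep (inn x y) k) =
        inner ℂ h (K.rep (inn x y) k) + inner ℂ h' (K.rep (inn x y) k)
      simp)
    (fun c x h => TensorProduct.ext' fun y k => by
      change inner ℂ (c • h) (K.rep (inn x y) k) = star c * inner ℂ h (K.rep (inn x y) k)
      simp [mul_comm])

theorem PreTensor.form_tmul (K : Rep A) (x y : E) (h k : K.carrier) :
    form E K (tmul K x h) (tmul K y k) = inner ℂ h (K.rep (inn x y) k) := rfl

@[elab_as_elim]
theorem PreTensor.induction {K : Rep A} {p : PreTensor E K → Prop} (v : PreTensor E K)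
    (h0 : p 0) (ht : ∀ x k, p (tmul K x k)) (ha : ∀ v w, p v → p w → p (v + w)) : p v :=
  TensorProduct.induction_on v h0 ht ha

theorem PreTensor.ext_lin {K : Rep A} {F : Type*} [AddCommMonoid F] [Module ℂ F]
    {f g : PreTensor E K →ₗ[ℂ] F} (h : ∀ x k, f (tmul K x k) = g (tmul K x k)) : f = g :=
  TensorProduct.ext' h

theorem PreTensor.form_symm (K : Rep A) (v w : PreTensor E K) :
    starRingEnd ℂ (form E K w v) = form E K v w := by
  induction v using PreTensor.induction with
  | h0 => simp
  | ha v v' h h' => simp [h, h']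
  | ht x k =>
    induction w using PreTensor.induction with
    | h0 => simp
    | ha w w' h h' => simp [h, h']
    | ht y l =>
      rw [form_tmul, form_tmul, inner_conj_symm, ← ContinuousLinearMap.adjoint_inner_right,
        ← ContinuousLinearMap.star_eq_adjoint, ← map_star, star_inn]

theorem PreTensor.form_nonneg (K : Rep A) (v : PreTensor E K) : 0 ≤ (form E K v v).re := by
  obtain ⟨n, x, k, rfl⟩ : ∃ (n : ℕ) (x : Fin n → E) (k : Fin n → K.carrier),
      v = ∑ i, tmul K (x i) (k i) := by
    induction v using PreTensor.induction with
    | h0 => exact ⟨0, Fin.elim0, Fin.elim0, by simp⟩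
    | ht x k => exact ⟨1, fun _ => x, fun _ => k, by simp⟩
    | ha v w hv hw =>
      obtain ⟨n, x, k, rfl⟩ := hv
      obtain ⟨m, y, l, rfl⟩ := hw
      exact ⟨n + m, Fin.append x y, Fin.append k l, by simp [Fin.sum_univ_add]⟩
  obtain ⟨S, hS⟩ := exists_gram (A := A) (CStarMatrix.ofMatrix fun i j => inn (x i) (x j))
    (fun i j => star_inn _ _) (fun a => by
      obtain ⟨b, hb⟩ := inn_self_pos (A := A) (∑ i, rmul (x i) (a i))
      refine ⟨b, ?_⟩
      rw [← hb, sum_inn]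
      refine Finset.sum_congr rfl fun i _ => ?_
      rw [inn_sum]
      refine Finset.sum_congr rfl fun j _ => ?_
      rw [inn_rmul, rmul_inn]; rfl)
  have hS' : ∀ i j, inn (x i) (x j) = ∑ k, star (S k i) * S k j := hS
  have : form E K (∑ i, tmul K (x i) (k i)) (∑ i, tmul K (x i) (k i)) =
      ∑ l, inner ℂ (∑ i, K.rep (S l i) (k i)) (∑ i, K.rep (S l i) (k i)) := by
    simp only [map_sum, LinearMap.sum_apply, form_tmul, hS', sum_inner, inner_sum, map_mul,
      map_star, sum_apply, mul_apply_eq_comp,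
      ContinuousLinearMap.star_eq_adjoint, ContinuousLinearMap.adjoint_inner_right]
    rw [Finset.sum_comm]
    conv_rhs => rw [Finset.sum_comm]
    rw [Finset.sum_comm]
    refine Finset.sum_congr rfl fun i _ => ?_
    rw [Finset.sum_comm]
  rw [this, Complex.re_sum]
  exact Finset.sum_nonneg fun l _ => inner_self_nonneg (𝕜 := ℂ)

variable (E) in
instance PreTensor.core (K : Rep A) : PreInnerProductSpace.Core ℂ (PreTensor E K) where
  inner v w := form E K v w
  conj_inner_symm v w := form_symm K v w
  re_inner_nonneg v := form_nonneg K v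
  add_left v w z := by simp
  smul_left v w c := by simp

variable (E) in
instance (K : Rep A) : SeminormedAddCommGroup (PreTensor E K) :=
  InnerProductSpace.Core.toSeminormedAddCommGroup (𝕜 := ℂ)

variable (E) in
instance (K : Rep A) : InnerProductSpace ℂ (PreTensor E K) :=
  InnerProductSpace.ofCore (PreTensor.core E K)

theorem PreTensor.inner_def (K : Rep A) (v w : PreTensor E K) :
    inner ℂ v w = form E K v w := rfl

variable (E) in
/-- The Hilbert space `E ⊗ K`, balanced over the representation of `A` on `K`: the Hausdorff
completion of the algebraic tensor product in its semi-inner product. -/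
abbrev tensorSpace (K : Rep A) : Type u := UniformSpace.Completion (PreTensor E K)

/-- The bounded operators that intertwine two representations. -/
def Rep.Hom (K L : Rep A) : Submodule ℂ (K.carrier →L[ℂ] L.carrier) where
  carrier := {T | ∀ a, T ∘L K.rep a = L.rep a ∘L T}
  add_mem' {S T} hS hT a := by
    rw [ContinuousLinearMap.add_comp, ContinuousLinearMap.comp_add, hS a, hT a]
  zero_mem' a := by simp
  smul_mem' c T hT a := by
    rw [ContinuousLinearMap.smul_comp, ContinuousLinearMap.comp_smul, hT a]

namespace Tensor

/-- The canonical map of the algebraic tensor product into its completion. -/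
def toTensor (K : Rep A) : PreTensor E K →L[ℂ] tensorSpace E K :=
  UniformSpace.Completion.toComplL (𝕜 := ℂ) (E := PreTensor E K)

/-- The elementary tensor `x ⊗ k`. -/
def tmul (K : Rep A) (x : E) (k : K.carrier) : tensorSpace E K :=
  toTensor K (PreTensor.tmul K x k)

theorem denseRange_toTensor (K : Rep A) : DenseRange (toTensor (E := E) K) :=
  UniformSpace.Completion.denseRange_coe

theorem inner_toTensor (K : Rep A) (v w : PreTensor E K) :
    inner ℂ (toTensor K v) (toTensor K w) = PreTensor.form E K v w :=
  UniformSpace.Completion.inner_coe v w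

theorem norm_toTensor (K : Rep A) (v : PreTensor E K) : ‖toTensor K v‖ = ‖v‖ :=
  UniformSpace.Completion.norm_coe v

theorem norm_sq_pre (K : Rep A) (v : PreTensor E K) :
    ‖v‖ ^ 2 = (PreTensor.form E K v v).re := by
  rw [← PreTensor.inner_def]
  exact norm_sq_eq_re_inner (𝕜 := ℂ) v

theorem inner_tmul (K : Rep A) (x y : E) (h k : K.carrier) :
    inner ℂ (tmul K x h) (tmul K y k) = inner ℂ h (K.rep (inn x y) k) :=
  inner_toTensor K _ _

/-- The bounded operator on `E ⊗ K` extending a bounded linear map on algebraic tensors. -/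
def lift {K : Rep A} {F : Type*} [NormedAddCommGroup F] [NormedSpace ℂ F] [CompleteSpace F]
    (f : PreTensor E K →ₗ[ℂ] F) (C : ℝ) (hf : ∀ v, ‖f v‖ ≤ C * ‖v‖) :
    tensorSpace E K →L[ℂ] F :=
  (f.mkContinuous C hf).fromCompletion

section lift
variable {K : Rep A} {F : Type*} [NormedAddCommGroup F] [NormedSpace ℂ F] [CompleteSpace F]

theorem lift_toTensor (f : PreTensor E K →ₗ[ℂ] F) (C : ℝ) (hf : ∀ v, ‖f v‖ ≤ C * ‖v‖)
    (v : PreTensor E K) : lift f C hf (toTensor K v) = f v :=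
  ContinuousLinearMap.fromCompletion_apply_coe (f.mkContinuous C hf) v

theorem lift_tmul (f : PreTensor E K →ₗ[ℂ] F) (C : ℝ) (hf : ∀ v, ‖f v‖ ≤ C * ‖v‖)
    (x : E) (k : K.carrier) : lift f C hf (tmul K x k) = f (PreTensor.tmul K x k) :=
  lift_toTensor f C hf _

theorem norm_lift_apply_le (f : PreTensor E K →ₗ[ℂ] F) (C : ℝ) (hf : ∀ v, ‖f v‖ ≤ C * ‖v‖)
    (v : tensorSpace E K) : ‖lift f C hf v‖ ≤ C * ‖v‖ := by
  induction v using (denseRange_toTensor K).induction_on with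
  | hp => exact isClosed_le (lift f C hf).continuous.norm (continuous_const.mul continuous_norm)
  | ih v => rw [lift_toTensor, norm_toTensor]; exact hf v

theorem ext_clm {S T : tensorSpace E K →L[ℂ] F} (h : ∀ x k, S (tmul K x k) = T (tmul K x k)) :
    S = T := by
  have : (S ∘L toTensor K).toLinearMap = (T ∘L toTensor K).toLinearMap :=
    PreTensor.ext_lin h
  ext v
  induction v using (denseRange_toTensor K).induction_on with
  | hp => exact isClosed_eq S.continuous T.continuous
  | ih v => exact LinearMap.congr_fun this v

end lift

theorem ext_inner {K : Rep A} {v w : tensorSpace E K}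
    (h : ∀ x k, inner ℂ v (tmul K x k) = inner ℂ w (tmul K x k)) : v = w := by
  have : innerSL ℂ v = innerSL ℂ w := ext_clm (by simpa using h)
  refine ext_inner_right ℂ fun z => ?_
  simpa using DFunLike.congr_fun this z

theorem eq_adjoint {E' : Type u} [NormedAddCommGroup E'] [NormedSpace ℂ E'] [Correspondence A E']
    {K L : Rep A} (S : tensorSpace E K →L[ℂ] tensorSpace E' L)
    (T : tensorSpace E' L →L[ℂ] tensorSpace E K)
    (h : ∀ x k y l, inner ℂ (S (tmul K x k)) (tmul L y l) =
      inner ℂ (tmul K x k) (T (tmul L y l))) : S = ContinuousLinearMap.adjoint T := by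
  refine ext_clm fun x k => ext_inner fun y l => ?_
  rw [h, ContinuousLinearMap.adjoint_inner_left]

/-- `T ⊗ I` on the algebraic tensor product. -/
def preLeft (K : Rep A) (T : Module.End ℂ E) : PreTensor E K →ₗ[ℂ] PreTensor E K :=
  TensorProduct.map T LinearMap.id

theorem preLeft_tmul (K : Rep A) (T : Module.End ℂ E) (x : E) (k : K.carrier) :
    preLeft K T (PreTensor.tmul K x k) = PreTensor.tmul K (T x) k := rfl

/-- `I ⊗ T` on the algebraic tensor product. -/
def preRight {K L : Rep A} (T : K.carrier →ₗ[ℂ] L.carrier) :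
    PreTensor E K →ₗ[ℂ] PreTensor E L :=
  TensorProduct.map LinearMap.id T

theorem preRight_tmul {K L : Rep A} (T : K.carrier →ₗ[ℂ] L.carrier) (x : E) (k : K.carrier) :
    preRight T (PreTensor.tmul K x k) = PreTensor.tmul L x (T k) := rfl

theorem preLeft_bound (K : Rep A) (a : A) (v : PreTensor E K) :
    ‖preLeft K (lact a) v‖ ≤ ‖a‖ * ‖v‖ := by
  obtain ⟨b, hb⟩ : ∃ b : A, algebraMap ℝ A (‖a‖ ^ 2) = star a * a + star b * b := by
    let _ := CStarAlgebra.spectralOrder A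
    have _ := CStarAlgebra.spectralOrderedRing A
    have h := CStarAlgebra.star_mul_le_algebraMap_norm_sq (a := a)
    obtain ⟨b, hb⟩ := CStarAlgebra.nonneg_iff_eq_star_mul_self.mp (sub_nonneg.mpr h)
    exact ⟨b, by rw [← hb]; abel⟩
  have hb' : ((‖a‖ ^ 2 : ℝ) : ℂ) • (1 : A) = star a * a + star b * b := by
    rw [← hb, Algebra.algebraMap_eq_smul_one]
    exact Complex.coe_smul _ _
  have key : ∀ v w, PreTensor.form E K (preLeft K (lact a) v) (preLeft K (lact a) w)
      + ((‖a‖ ^ 2 : ℝ) : ℂ) * PreTensor.form E K (preLeft K (1 - lact (1 : A)) v)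
          (preLeft K (1 - lact (1 : A)) w)
      + PreTensor.form E K (preLeft K (lact b) v) (preLeft K (lact b) w)
      = ((‖a‖ ^ 2 : ℝ) : ℂ) * PreTensor.form E K v w := by
    intro v w
    induction v using PreTensor.induction with
    | h0 => simp
    | ha v v' h h' =>
      simp only [map_add, LinearMap.add_apply, mul_add]
      rw [← h, ← h']; ring
    | ht x k =>
      induction w using PreTensor.induction with
      | h0 => simp
      | ha w w' h h' =>
        simp only [map_add, mul_add]
        rw [← h, ← h']; ring
      | ht y l =>
        simp only [preLeft_tmul, PreTensor.form_tmul]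
        have e1 : ∀ c : A, inn (A := A) (lact c x) (lact c y) = inn x (lact (star c * c) y) := by
          intro c; rw [inn_lact, map_mul]; rfl
        have e2 : inn (A := A) ((1 - lact (1 : A) : Module.End ℂ E) x)
            ((1 - lact (1 : A) : Module.End ℂ E) y) = inn x y - inn x (lact (1 : A) y) := by
          have n1 : ∀ u w : E, inn (A := A) u (-w) = - inn u w := fun u w => by
            have := inn_smul (A := A) (-1) u w
            simpa using this
          have n2 : ∀ u w : E, inn (A := A) (-u) w = - inn u w := fun u w => by
            rw [← star_inn, n1, star_neg, star_inn]
          have s1 : ∀ u : E, (1 - lact (1 : A) : Module.End ℂ E) u = u + -(lact (1 : A) u) :=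
            fun u => sub_eq_add_neg _ _
          simp only [s1, inn_add, add_inn, n1, n2, e1, inn_lact (A := A) (1 : A) x y, star_one,
            mul_one]
          abel
        rw [e1, e1, e2]
        have e3 : ((‖a‖ ^ 2 : ℝ) : ℂ) • inn (A := A) x (lact (1 : A) y)
            = inn x (lact (star a * a) y) + inn x (lact (star b * b) y) := by
          rw [← inn_add, ← LinearMap.add_apply, ← map_add, ← hb', map_smul, LinearMap.smul_apply,
            inn_smul]
        have e4 := congrArg (fun z => inner ℂ k (K.rep z l)) e3
        simp only [map_smul, map_add, smul_apply, add_apply, inner_smul_right, inner_add_right] at e4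
        simp only [map_sub, sub_apply, inner_sub_right, mul_sub]
        rw [e4]; ring
  have h := congrArg Complex.re (key v v)
  simp only [Complex.add_re, Complex.re_ofReal_mul, ← norm_sq_pre] at h
  refine (sq_le_sq₀ (norm_nonneg _) (by positivity)).mp ?_
  have : 0 ≤ ‖a‖ ^ 2 * ‖preLeft K (1 - lact (1 : A)) v‖ ^ 2 := by positivity
  nlinarith [sq_nonneg ‖preLeft K (lact b) v‖]

theorem sqrt_commute {K : Rep A} {X : K.carrier →L[ℂ] K.carrier} (hX : X ∈ K.Hom K) :
    CFC.sqrt X ∈ K.Hom K := fun a => by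
  have : Commute X (K.rep a) := hX a
  exact (this.cfcₙ_nnreal NNReal.sqrt)

theorem adjoint_mem {K L : Rep A} {T : K.carrier →L[ℂ] L.carrier} (hT : T ∈ K.Hom L) :
    ContinuousLinearMap.adjoint T ∈ L.Hom K := fun a => by
  have := congrArg ContinuousLinearMap.adjoint (hT (star a))
  rw [ContinuousLinearMap.adjoint_comp, ContinuousLinearMap.adjoint_comp, map_star K.rep,
    map_star L.rep, ContinuousLinearMap.star_eq_adjoint, ContinuousLinearMap.star_eq_adjoint,
    ContinuousLinearMap.adjoint_adjoint, ContinuousLinearMap.adjoint_adjoint] at this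
  exact this.symm

theorem comp_mem {K L N : Rep A} {S : L.carrier →L[ℂ] N.carrier} {T : K.carrier →L[ℂ] L.carrier}
    (hS : S ∈ L.Hom N) (hT : T ∈ K.Hom L) : S ∘L T ∈ K.Hom N := fun a => by
  rw [ContinuousLinearMap.comp_assoc, hT a, ← ContinuousLinearMap.comp_assoc, hS a,
    ContinuousLinearMap.comp_assoc]

theorem id_mem (K : Rep A) : ContinuousLinearMap.id ℂ K.carrier ∈ K.Hom K := fun a => by
  simp

theorem preRight_bound {K L : Rep A} (T : K.Hom L) (v : PreTensor E K) :
    ‖preRight T.1.toLinearMap v‖ ≤ ‖T.1‖ * ‖v‖ := by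
  have hpos : 0 ≤ ((‖T.1‖ ^ 2 : ℝ) : ℂ) • ContinuousLinearMap.id ℂ K.carrier
      - ContinuousLinearMap.adjoint T.1 ∘L T.1 := by
    rw [ContinuousLinearMap.nonneg_iff_isPositive, ContinuousLinearMap.isPositive_iff_complex]
    intro k
    have e : inner ℂ ((((‖T.1‖ ^ 2 : ℝ) : ℂ) • ContinuousLinearMap.id ℂ K.carrier
        - ContinuousLinearMap.adjoint T.1 ∘L T.1) k) k
        = ((‖T.1‖ ^ 2 * ‖k‖ ^ 2 - ‖T.1 k‖ ^ 2 : ℝ) : ℂ) := by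
      rw [sub_apply, inner_sub_left, ContinuousLinearMap.comp_apply,
        ContinuousLinearMap.adjoint_inner_left, smul_apply, inner_smul_left,
        ContinuousLinearMap.id_apply, inner_self_eq_norm_sq_to_K, inner_self_eq_norm_sq_to_K]
      simp
    rw [e]
    refine ⟨rfl, ?_⟩
    have := T.1.le_opNorm k
    have h2 : ‖T.1 k‖ ^ 2 ≤ (‖T.1‖ * ‖k‖) ^ 2 := by gcongr
    rw [mul_pow] at h2
    rw [RCLike.re_to_complex, Complex.ofReal_re]
    linarith
  set Y := ((‖T.1‖ ^ 2 : ℝ) : ℂ) • ContinuousLinearMap.id ℂ K.carrier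
      - ContinuousLinearMap.adjoint T.1 ∘L T.1 with hY
  have hYm : Y ∈ K.Hom K := Submodule.sub_mem _ (Submodule.smul_mem _ _ (id_mem K))
    (comp_mem (adjoint_mem T.2) T.2)
  set D := CFC.sqrt Y with hD
  have hDm : D ∈ K.Hom K := sqrt_commute hYm
  have hDD : D * D = Y := CFC.sqrt_mul_sqrt_self Y hpos
  have hDs : ContinuousLinearMap.adjoint D = D :=
    (IsSelfAdjoint.of_nonneg (CFC.sqrt_nonneg Y))
  have key : ∀ v w, PreTensor.form E L (preRight T.1.toLinearMap v) (preRight T.1.toLinearMap w)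
      + PreTensor.form E K (preRight D.toLinearMap v) (preRight D.toLinearMap w)
      = ((‖T.1‖ ^ 2 : ℝ) : ℂ) * PreTensor.form E K v w := by
    intro v w
    induction v using PreTensor.induction with
    | h0 => simp
    | ha v v' h h' =>
      simp only [map_add, LinearMap.add_apply, mul_add]
      rw [← h, ← h']; ring
    | ht x k =>
      induction w using PreTensor.induction with
      | h0 => simp
      | ha w w' h h' =>
        simp only [map_add, mul_add]
        rw [← h, ← h']; ring
      | ht y l =>
        simp only [preRight_tmul, PreTensor.form_tmul, ContinuousLinearMap.coe_coe]
        have f1 : L.rep (inn x y) (T.1 l) = T.1 (K.rep (inn x y) l) :=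
          (DFunLike.congr_fun (T.2 (inn x y)) l).symm
        have f2 : K.rep (inn x y) (D l) = D (K.rep (inn x y) l) :=
          (DFunLike.congr_fun (hDm (inn x y)) l).symm
        rw [f1, f2, ← ContinuousLinearMap.adjoint_inner_right,
          ← ContinuousLinearMap.adjoint_inner_right D, hDs, ← mul_apply_eq_comp D D, hDD, hY]
        simp [inner_sub_right, inner_smul_right]
  have h := congrArg Complex.re (key v v)
  simp only [Complex.add_re, Complex.re_ofReal_mul, ← norm_sq_pre] at h
  refine (sq_le_sq₀ (norm_nonneg _) (by positivity)).mp ?_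
  nlinarith [sq_nonneg ‖preRight (E := E) D.toLinearMap v‖]

/-- The operator `φ(a) ⊗ I`. -/
def left (K : Rep A) (a : A) : tensorSpace E K →L[ℂ] tensorSpace E K :=
  lift ((toTensor K).toLinearMap ∘ₗ preLeft K (lact a)) ‖a‖ fun v => by
    simpa [norm_toTensor] using preLeft_bound K a v

theorem left_tmul (K : Rep A) (a : A) (x : E) (k : K.carrier) :
    left K a (tmul K x k) = tmul K (lact a x) k :=
  lift_tmul _ _ _ _ _

/-- The operator `I ⊗ T`. -/
def right {K L : Rep A} (T : K.Hom L) : tensorSpace E K →L[ℂ] tensorSpace E L :=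
  lift ((toTensor L).toLinearMap ∘ₗ preRight T.1.toLinearMap) ‖T.1‖ fun v => by
    change ‖toTensor L (preRight T.1.toLinearMap v)‖ ≤ _
    rw [norm_toTensor]
    exact preRight_bound T v

theorem right_tmul {K L : Rep A} (T : K.Hom L) (x : E) (k : K.carrier) :
    right T (tmul K x k) = tmul L x (T.1 k) :=
  lift_tmul _ _ _ _ _

theorem tmul_add_left (K : Rep A) (x y : E) (k : K.carrier) :
    tmul K (x + y) k = tmul K x k + tmul K y k := by
  rw [tmul, tmul, tmul, ← map_add]
  exact congrArg _ (TensorProduct.add_tmul x y k)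

theorem tmul_smul_left (K : Rep A) (c : ℂ) (x : E) (k : K.carrier) :
    tmul K (c • x) k = c • tmul K x k := by
  rw [tmul, tmul, ← map_smul]
  exact congrArg _ (TensorProduct.smul_tmul' c x k).symm

theorem tmul_add_right (K : Rep A) (x : E) (k l : K.carrier) :
    tmul K x (k + l) = tmul K x k + tmul K x l := by
  rw [tmul, tmul, tmul, ← map_add]
  exact congrArg _ (TensorProduct.tmul_add x k l)

theorem tmul_smul_right (K : Rep A) (c : ℂ) (x : E) (k : K.carrier) :
    tmul K x (c • k) = c • tmul K x k := by
  rw [tmul, tmul, ← map_smul]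
  exact congrArg _ (TensorProduct.tmul_smul c x k)

end Tensor
open Tensor

variable (E) in
/-- The induced representation `a ↦ φ(a) ⊗ I` on `E ⊗ K`. -/
def Rep.tensor (K : Rep A) : Rep A where
  carrier := tensorSpace E K
  rep :=
    { toFun := left K
      map_smul' := fun c a => ext_clm fun x k => by
        simp [left_tmul, tmul_smul_left]
      map_zero' := ext_clm fun x k => by
        have := tmul_smul_left K 0 (0 : E) k
        simp only [zero_smul] at this
        simp [left_tmul, this]
      map_add' := fun a b => ext_clm fun x k => by
        simp [left_tmul, tmul_add_left]
      map_mul' := fun a b => ext_clm fun x k => by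
        simp [left_tmul]
      map_star' := fun a => by
        rw [ContinuousLinearMap.star_eq_adjoint]
        refine eq_adjoint _ _ fun x k y l => ?_
        rw [left_tmul, left_tmul, inner_tmul, inner_tmul, inn_lact, star_star] }

variable (E) in
/-- The operator `I_E ⊗ T`, for an intertwining operator `T`. -/
def idTensor {K L : Rep A} (T : K.Hom L) : (K.tensor E).Hom (L.tensor E) :=
  ⟨right T, fun a => ext_clm fun x k => by
      change right T (left K a (tmul K x k)) = left L a (right T (tmul K x k))
      rw [left_tmul, right_tmul, right_tmul, left_tmul]⟩

theorem idTensor_tmul {K L : Rep A} (T : K.Hom L) (x : E) (k : K.carrier) :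
    (idTensor E T).1 (tmul K x k) = tmul L x (T.1 k) :=
  right_tmul T x k

theorem norm_idTensor_le {K L : Rep A} (T : K.Hom L) : ‖(idTensor E T).1‖ ≤ ‖T.1‖ :=
  ContinuousLinearMap.opNorm_le_bound _ (norm_nonneg _) (norm_lift_apply_le _ _ _)

/-- The operator `k ↦ ξ ⊗ k` from `K` to `E ⊗ K`. -/
def creationAt (K : Rep A) (ξ : E) : K.carrier →L[ℂ] (K.tensor E).carrier :=
  LinearMap.mkContinuous
    { toFun := fun k => tmul K ξ k
      map_add' := tmul_add_right K ξ
      map_smul' := fun c k => tmul_smul_right K c ξ k } ‖ξ‖ fun k => by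
    refine (sq_le_sq₀ (norm_nonneg _) (by positivity)).mp ?_
    change ‖tmul K ξ k‖ ^ 2 ≤ _
    rw [norm_sq_eq_re_inner (𝕜 := ℂ), inner_tmul, mul_pow, norm_sq (A := A) ξ]
    calc _ ≤ ‖inner ℂ k (K.rep (inn ξ ξ) k)‖ := RCLike.re_le_norm _
      _ ≤ ‖k‖ * ‖K.rep (inn ξ ξ) k‖ := norm_inner_le_norm _ _
      _ ≤ ‖k‖ * (‖inn (A := A) ξ ξ‖ * ‖k‖) := by
        gcongr
        refine (ContinuousLinearMap.le_opNorm _ _).trans ?_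
        gcongr
        exact NonUnitalStarAlgHom.norm_apply_le _ _
      _ = _ := by ring

theorem norm_creationAt_le (K : Rep A) (ξ : E) : ‖creationAt K ξ‖ ≤ ‖ξ‖ :=
  LinearMap.mkContinuous_norm_le _ (norm_nonneg _) _

variable (E) in
/-- The representation `φ_n(·) ⊗ I` on `E^{⊗ n} ⊗ K`, where the space is built as
`E ⊗ (E ⊗ (⋯ ⊗ (E ⊗ K)))`. -/
def Rep.tower (K : Rep A) : ℕ → Rep A
  | 0 => K
  | n + 1 => (K.tower n).tensor E

end Balanced

section HilbertSum
variable {G G' : ℕ → Type u} [∀ n, NormedAddCommGroup (G n)] [∀ n, InnerProductSpace ℂ (G n)]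
  [∀ n, NormedAddCommGroup (G' n)] [∀ n, InnerProductSpace ℂ (G' n)]

theorem lp_of_sum {w : ∀ n, G n} {B : ℝ} (hB : 0 ≤ B) (hs : Summable fun n => ‖w n‖ ^ 2)
    (hle : ∑' n, ‖w n‖ ^ 2 ≤ B ^ 2) :
    ∃ hw : Memℓp w 2, ‖(⟨w, hw⟩ : lp G 2)‖ ≤ B := by
  refine ⟨memℓp_gen (by simpa using hs), ?_⟩
  refine (sq_le_sq₀ (norm_nonneg _) hB).mp ?_
  have e1 := lp.norm_rpow_eq_tsum (p := 2) (by simp)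
    (⟨w, memℓp_gen (by simpa using hs)⟩ : lp G 2)
  simp only [ENNReal.toReal_ofNat, Real.rpow_ofNat] at e1
  rw [e1]
  exact hle

theorem lp_norm_sq (v : lp G 2) :
    (Summable fun n => ‖v n‖ ^ 2) ∧ ∑' n, ‖v n‖ ^ 2 = ‖v‖ ^ 2 := by
  refine ⟨by simpa using (lp.memℓp v).summable (by simp), ?_⟩
  have e1 := lp.norm_rpow_eq_tsum (p := 2) (by simp) v
  simp only [ENNReal.toReal_ofNat, Real.rpow_ofNat] at e1
  exact e1.symm

theorem diag_aux (T : ∀ n, G n →L[ℂ] G' n) (C : ℝ) (hT : ∀ n, ‖T n‖ ≤ C) (v : lp G 2) :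
    ∃ hw : Memℓp (fun n => T n (v n)) 2, ‖(⟨_, hw⟩ : lp G' 2)‖ ≤ C * ‖v‖ := by
  have hC : 0 ≤ C := (norm_nonneg _).trans (hT 0)
  obtain ⟨hv, hv'⟩ := lp_norm_sq v
  have hle : ∀ n, ‖T n (v n)‖ ^ 2 ≤ C ^ 2 * ‖v n‖ ^ 2 := fun n => by
    rw [← mul_pow]
    exact pow_le_pow_left₀ (norm_nonneg _) ((T n).le_of_opNorm_le (hT n) _) 2
  have hs : Summable fun n => ‖T n (v n)‖ ^ 2 :=
    .of_nonneg_of_le (fun n => by positivity) hle (hv.mul_left _)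
  refine lp_of_sum (by positivity) hs ?_
  rw [mul_pow, ← hv', ← tsum_mul_left]
  exact hs.tsum_le_tsum hle (hv.mul_left _)

/-- The block diagonal operator `diag(T_0, T_1, …)` between Hilbert space direct sums. -/
def diagOp (T : ∀ n, G n →L[ℂ] G' n) (C : ℝ) (hT : ∀ n, ‖T n‖ ≤ C) : lp G 2 →L[ℂ] lp G' 2 :=
  LinearMap.mkContinuous
    { toFun := fun v => ⟨fun n => T n (v n), (diag_aux T C hT v).choose⟩
      map_add' := fun v w => by ext n; exact map_add (T n) _ _
      map_smul' := fun c v => by ext n; exact map_smul (T n) c _ } C fun v =>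
    (diag_aux T C hT v).choose_spec

theorem diagOp_apply (T : ∀ n, G n →L[ℂ] G' n) (C : ℝ) (hT : ∀ n, ‖T n‖ ≤ C) (v : lp G 2)
    (n : ℕ) : diagOp T C hT v n = T n (v n) := rfl

/-- The entries of the image of `v` under a weighted shift. -/
def shiftFun (T : ∀ n, G n →L[ℂ] G (n + 1)) (v : ∀ n, G n) : ∀ n, G n
  | 0 => 0
  | n + 1 => T n (v n)

theorem shift_aux (T : ∀ n, G n →L[ℂ] G (n + 1)) (C : ℝ) (hT : ∀ n, ‖T n‖ ≤ C) (v : lp G 2) :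
    ∃ hw : Memℓp (shiftFun T v) 2, ‖(⟨_, hw⟩ : lp G 2)‖ ≤ C * ‖v‖ := by
  have hC : 0 ≤ C := (norm_nonneg _).trans (hT 0)
  obtain ⟨hv, hv'⟩ := lp_norm_sq v
  have hle : ∀ n, ‖T n (v n)‖ ^ 2 ≤ C ^ 2 * ‖v n‖ ^ 2 := fun n => by
    rw [← mul_pow]
    exact pow_le_pow_left₀ (norm_nonneg _) ((T n).le_of_opNorm_le (hT n) _) 2
  have hs : Summable fun n => ‖T n (v n)‖ ^ 2 :=
    .of_nonneg_of_le (fun n => by positivity) hle (hv.mul_left _)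
  have hs' : Summable fun n => ‖shiftFun T v n‖ ^ 2 := (summable_nat_add_iff 1).mp hs
  refine lp_of_sum (by positivity) hs' ?_
  rw [hs'.tsum_eq_zero_add, mul_pow, ← hv', ← tsum_mul_left]
  simpa [shiftFun] using hs.tsum_le_tsum hle (hv.mul_left _)

/-- The weighted shift `(v_0, v_1, …) ↦ (0, T_0 v_0, T_1 v_1, …)`. -/
def shiftOp (T : ∀ n, G n →L[ℂ] G (n + 1)) (C : ℝ) (hT : ∀ n, ‖T n‖ ≤ C) : lp G 2 →L[ℂ] lp G 2 :=
  LinearMap.mkContinuous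
    { toFun := fun v => ⟨shiftFun T v, (shift_aux T C hT v).choose⟩
      map_add' := fun v w => by
        ext n
        cases n with
        | zero => exact (add_zero (0 : G 0)).symm
        | succ n => exact map_add (T n) _ _
      map_smul' := fun c v => by
        ext n
        cases n with
        | zero => exact (smul_zero c).symm
        | succ n => exact map_smul (T n) c _ } C fun v =>
    (shift_aux T C hT v).choose_spec

theorem column_aux {H : Type u} [NormedAddCommGroup H] [InnerProductSpace ℂ H]
    (T : ∀ n, H →L[ℂ] G n) (r : ℝ) (hr : r < 1) (hT : ∀ n, ‖T n‖ ≤ r ^ n) (h : H) :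
    ∃ hw : Memℓp (fun n => T n h) 2, ‖(⟨_, hw⟩ : lp G 2)‖ ≤ √((1 - r ^ 2)⁻¹) * ‖h‖ := by
  have hr0 : 0 ≤ r := by simpa using (norm_nonneg _).trans (hT 1)
  have hr2 : r ^ 2 < 1 := by nlinarith
  have hle : ∀ n, ‖T n h‖ ^ 2 ≤ (r ^ 2) ^ n * ‖h‖ ^ 2 := fun n => by
    rw [← pow_mul, mul_comm 2 n, pow_mul, ← mul_pow]
    exact pow_le_pow_left₀ (norm_nonneg _) ((T n).le_of_opNorm_le (hT n) _) 2
  have hg : HasSum (fun n => (r ^ 2) ^ n * ‖h‖ ^ 2) ((1 - r ^ 2)⁻¹ * ‖h‖ ^ 2) :=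
    (hasSum_geometric_of_lt_one (by positivity) hr2).mul_right _
  have hs : Summable fun n => ‖T n h‖ ^ 2 :=
    .of_nonneg_of_le (fun n => by positivity) hle hg.summable
  refine lp_of_sum (by positivity) hs ?_
  rw [mul_pow, Real.sq_sqrt (inv_nonneg.mpr (by linarith)), ← hg.tsum_eq]
  exact hs.tsum_le_tsum hle hg.summable

/-- The column operator `[T_0, T_1, T_2, …]ᵀ`. -/
def columnOp {H : Type u} [NormedAddCommGroup H] [InnerProductSpace ℂ H]
    (T : ∀ n, H →L[ℂ] G n) (r : ℝ) (hr : r < 1) (hT : ∀ n, ‖T n‖ ≤ r ^ n) : H →L[ℂ] lp G 2 :=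
  LinearMap.mkContinuous
    { toFun := fun h => ⟨fun n => T n h, (column_aux T r hr hT h).choose⟩
      map_add' := fun v w => by ext n; exact map_add (T n) _ _
      map_smul' := fun c v => by ext n; exact map_smul (T n) c _ } √((1 - r ^ 2)⁻¹) fun h =>
    (column_aux T r hr hT h).choose_spec

end HilbertSum

section Fock
open Tensor
variable {E : Type u} [NormedAddCommGroup E] [NormedSpace ℂ E] [Correspondence A E]

variable (E) in
/-- The Hilbert space `F(E) ⊗ K`, the direct sum of all `E^{⊗ n} ⊗ K`, where `F(E)` is the full
Fock space of `E`. -/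
abbrev Rep.fock (K : Rep A) : Type u := lp (fun n => (K.tower E n).carrier) 2

variable (E) in
/-- The operator `φ_∞(a) ⊗ I` on `F(E) ⊗ K`. -/
def fockAct (K : Rep A) (a : A) : K.fock E →L[ℂ] K.fock E :=
  diagOp (fun n => (K.tower E n).rep a) ‖a‖ fun _ => NonUnitalStarAlgHom.norm_apply_le _ _

/-- The operator `T_ξ ⊗ I` on `F(E) ⊗ K`, where `T_ξ` is the creation operator of `ξ`. -/
def creation (K : Rep A) (ξ : E) : K.fock E →L[ℂ] K.fock E :=
  shiftOp (G := fun n => (K.tower E n).carrier) (fun n => creationAt (K.tower E n) ξ) ‖ξ‖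
    fun _ => norm_creationAt_le _ _

variable (E) in
/-- The embedding of `K` into `F(E) ⊗ K` as the zeroth summand. Its adjoint is the projection. -/
def vacuum (K : Rep A) : K.carrier →L[ℂ] K.fock E :=
  lp.singleContinuousLinearMap ℂ (fun n => (K.tower E n).carrier) 2 0

variable (E) in
/-- `I_{E^{⊗ n}} ⊗ T`. -/
def idTensorPow {K L : Rep A} (T : K.Hom L) : ∀ n, (K.tower E n).Hom (L.tower E n)
  | 0 => T
  | n + 1 => idTensor E (idTensorPow T n)

theorem norm_idTensorPow_le {K L : Rep A} (T : K.Hom L) (n : ℕ) :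
    ‖(idTensorPow E T n).1‖ ≤ ‖T.1‖ := by
  induction n with
  | zero => exact le_rfl
  | succ n ih => exact (norm_idTensor_le _).trans ih

variable (E) in
/-- `I_{F(E)} ⊗ T`. -/
def idTensorFock {K L : Rep A} (T : K.Hom L) : K.fock E →L[ℂ] L.fock E :=
  diagOp (fun n => (idTensorPow E T n).1) ‖T.1‖ (norm_idTensorPow_le T)

variable (E) in
/-- The dual correspondence `E^σ`: the operators `η : H → E ⊗ H` with
`η σ(a) = (φ(a) ⊗ I) η` for all `a`, with the operator norm. -/
def Dual (K : Rep A) : Type u := K.Hom (K.tensor E)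

variable (E) in
instance (K : Rep A) : NormedAddCommGroup (Dual E K) :=
  inferInstanceAs (NormedAddCommGroup (K.Hom (K.tensor E)))

variable (E) in
instance (K : Rep A) : NormedSpace ℂ (Dual E K) :=
  inferInstanceAs (NormedSpace ℂ (K.Hom (K.tensor E)))

/-- An element of the dual correspondence from an intertwining operator. -/
def Dual.mk {K : Rep A} (T : K.carrier →L[ℂ] (K.tensor E).carrier) (hT : T ∈ K.Hom (K.tensor E)) :
    Dual E K := ⟨T, hT⟩

/-- `I_{E^{⊗ n}} ⊗ η`, as an operator `E^{⊗ n} ⊗ H → E^{⊗ (n + 1)} ⊗ H`. -/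
def dualPow {K : Rep A} (η : Dual E K) : ∀ n, (K.tower E n).Hom (K.tower E (n + 1))
  | 0 => η
  | n + 1 => idTensor E (dualPow η n)

theorem norm_dualPow_le {K : Rep A} (η : Dual E K) (n : ℕ) : ‖(dualPow η n).1‖ ≤ ‖η‖ := by
  induction n with
  | zero => exact le_rfl
  | succ n ih => exact (norm_idTensor_le _).trans ih

/-- The generalized powers `η^{(0)} = I`, `η^{(n + 1)} = (I_{E^{⊗ n}} ⊗ η) η^{(n)}`. -/
def cauchyCoeff {K : Rep A} (η : Dual E K) : ∀ n, K.carrier →L[ℂ] (K.tower E n).carrier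
  | 0 => ContinuousLinearMap.id ℂ K.carrier
  | n + 1 => (dualPow η n).1 ∘L cauchyCoeff η n

theorem norm_cauchyCoeff_le {K : Rep A} (η : Dual E K) (n : ℕ) :
    ‖cauchyCoeff η n‖ ≤ ‖η‖ ^ n := by
  induction n with
  | zero =>
    rw [pow_zero]
    exact ContinuousLinearMap.norm_id_le
  | succ n ih =>
    rw [pow_succ']
    refine (ContinuousLinearMap.opNorm_comp_le _ _).trans ?_
    gcongr
    exact norm_dualPow_le η n

/-- The Cauchy kernel `C(η) = [η^{(0)}, η^{(1)}, η^{(2)}, …]ᵀ`. -/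
def cauchyKernel {K : Rep A} (η : Dual E K) (hη : ‖η‖ < 1) : K.carrier →L[ℂ] K.fock E :=
  columnOp (G := fun n => (K.tower E n).carrier) (cauchyCoeff η) ‖η‖ hη (norm_cauchyCoeff_le η)

/-- `η̂*(ξ) h = η* (ξ ⊗ h)`. -/
def dualHat {K : Rep A} (η : Dual E K) (ξ : E) : K.carrier →L[ℂ] K.carrier :=
  ContinuousLinearMap.adjoint η.1 ∘L creationAt K ξ

end Fock

end Tensors

section VN

/-- The ultraweak topology on `B(K)`, generated by the functionals `T ↦ ∑ ⟨x_n, T y_n⟩` with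
`∑ ‖x_n‖² < ∞` and `∑ ‖y_n‖² < ∞`. -/
@[reducible]
def ultraweak (K : Type u) [NormedAddCommGroup K] [InnerProductSpace ℂ K] :
    TopologicalSpace (K →L[ℂ] K) :=
  ⨅ p : lp (fun _ : ℕ => K) 2 × lp (fun _ : ℕ => K) 2,
    TopologicalSpace.induced (fun T => ∑' n, inner ℂ (p.1 n) (T (p.2 n))) inferInstance

variable {H₀ : Type u} [NormedAddCommGroup H₀] [InnerProductSpace ℂ H₀] [CompleteSpace H₀]

/-- The identity representation of the von Neumann algebra `M` on `H₀`. -/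
def idRep (M : VonNeumannAlgebra H₀) : Rep (VNA M) where
  carrier := H₀
  rep := (VNA.val M).toNonUnitalStarAlgHom

theorem ultraweak_summable {K : Type u} [NormedAddCommGroup K] [InnerProductSpace ℂ K]
    (x y : lp (fun _ : ℕ => K) 2) (T : K →L[ℂ] K) :
    Summable fun n => inner ℂ (x n) (T (y n)) :=
  lp.summable_inner x (diagOp (fun _ => T) ‖T‖ (fun _ => le_rfl) y)

theorem ultraweak_continuous_functional {K : Type u} [NormedAddCommGroup K]
    [InnerProductSpace ℂ K] (x y : lp (fun _ : ℕ => K) 2) :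
    Continuous[ultraweak K, inferInstance] fun T : K →L[ℂ] K =>
      ∑' n, inner ℂ (x n) (T (y n)) :=
  continuous_iInf_dom (i := (x, y)) continuous_induced_dom

theorem ultraweak_continuous_rng {K X : Type u} [NormedAddCommGroup K]
    [InnerProductSpace ℂ K] (t : TopologicalSpace X) (f : X → (K →L[ℂ] K))
    (h : ∀ x y : lp (fun _ : ℕ => K) 2,
      Continuous[t, inferInstance] fun a => ∑' n, inner ℂ (x n) (f a (y n))) :
    Continuous[t, ultraweak K] f :=
  continuous_iInf_rng.mpr fun p => continuous_induced_rng.mpr (h p.1 p.2)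

section
variable {K : Type u} [NormedAddCommGroup K] [InnerProductSpace ℂ K]

theorem ultraweak_add_left (S : K →L[ℂ] K) :
    Continuous[ultraweak K, ultraweak K] fun T => S + T :=
  ultraweak_continuous_rng (ultraweak K) _ fun x y => by
    have : (fun T : K →L[ℂ] K => ∑' n, inner ℂ (x n) ((S + T) (y n))) = fun T =>
        (∑' n, inner ℂ (x n) (S (y n))) + ∑' n, inner ℂ (x n) (T (y n)) := by
      funext T
      rw [← (ultraweak_summable x y S).tsum_add (ultraweak_summable x y T)]
      simp
    rw [this]
    let _ := ultraweak K
    exact continuous_const.add (ultraweak_continuous_functional x y)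

theorem ultraweak_smul (c : ℂ) :
    Continuous[ultraweak K, ultraweak K] fun T => c • T :=
  ultraweak_continuous_rng (ultraweak K) _ fun x y => by
    have : (fun T : K →L[ℂ] K => ∑' n, inner ℂ (x n) ((c • T) (y n))) = fun T =>
        c * ∑' n, inner ℂ (x n) (T (y n)) := by
      funext T
      rw [← tsum_mul_left]
      simp
    rw [this]
    let _ := ultraweak K
    exact continuous_const.mul (ultraweak_continuous_functional x y)

theorem ultraweak_mul_right (S : K →L[ℂ] K) :
    Continuous[ultraweak K, ultraweak K] fun T => T * S :=
  ultraweak_continuous_rng (ultraweak K) _ fun x y =>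
    ultraweak_continuous_functional x (diagOp (fun _ => S) ‖S‖ (fun _ => le_rfl) y)

theorem ultraweak_mul_left [CompleteSpace K] (S : K →L[ℂ] K) :
    Continuous[ultraweak K, ultraweak K] fun T => S * T :=
  ultraweak_continuous_rng (ultraweak K) _ fun x y => by
    have := ultraweak_continuous_functional
      (diagOp (fun _ => ContinuousLinearMap.adjoint S) ‖ContinuousLinearMap.adjoint S‖
        (fun _ => le_rfl) x) y
    simp only [diagOp_apply, ContinuousLinearMap.adjoint_inner_left] at this
    exact this

/-- The ultraweak closure of a (not necessarily unital) subalgebra of `B(K)`. -/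
def ultraweakClosure [CompleteSpace K] (S : NonUnitalSubalgebra ℂ (K →L[ℂ] K)) :
    NonUnitalSubalgebra ℂ (K →L[ℂ] K) where
  carrier := closure[ultraweak K] S
  zero_mem' := by
    let _ := ultraweak K
    exact subset_closure S.zero_mem
  add_mem' := by
    let _ := ultraweak K
    intro a b ha hb
    have h1 : ∀ s ∈ S, s + b ∈ closure (S : Set (K →L[ℂ] K)) := fun s hs =>
      map_mem_closure (ultraweak_add_left s) hb fun t ht => S.add_mem hs ht
    have h2 := map_mem_closure (ultraweak_add_left b) ha
      (t := closure (S : Set (K →L[ℂ] K))) fun t ht => by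
        rw [add_comm]; exact h1 t ht
    rwa [closure_closure, add_comm] at h2
  smul_mem' := by
    let _ := ultraweak K
    intro c a ha
    exact map_mem_closure (ultraweak_smul c) ha fun t ht => SMulMemClass.smul_mem c ht
  mul_mem' := by
    let _ := ultraweak K
    intro a b ha hb
    have h1 : ∀ s ∈ S, s * b ∈ closure (S : Set (K →L[ℂ] K)) := fun s hs =>
      map_mem_closure (ultraweak_mul_left s) hb fun t ht => S.mul_mem hs ht
    have h2 := map_mem_closure (ultraweak_mul_right b) ha
      (t := closure (S : Set (K →L[ℂ] K))) fun t ht => h1 t ht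
    rwa [closure_closure] at h2

theorem subset_ultraweakClosure [CompleteSpace K] (S : NonUnitalSubalgebra ℂ (K →L[ℂ] K)) :
    S ≤ ultraweakClosure S := by
  let _ := ultraweak K
  exact fun s hs => subset_closure hs

end

/-- The ultraweak topology on a von Neumann algebra. -/
@[reducible]
def ultraweakVNA (M : VonNeumannAlgebra H₀) : TopologicalSpace (VNA M) :=
  TopologicalSpace.induced (VNA.val M) (ultraweak H₀)

open Correspondence in
/-- `E` is a W*-correspondence over `M`: every bounded module map `E → M` is of the form `⟨y, ·⟩`,
and the left action is normal. The ultraweak topology on bounded sets of adjointable operators `T`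
is that of the maps `T ↦ ⟨x, T y⟩`. -/
structure IsWStarCorrespondence (M : VonNeumannAlgebra H₀) (E : Type u) [NormedAddCommGroup E]
    [NormedSpace ℂ E] [Correspondence (VNA M) E] : Prop where
  self_dual : ∀ f : E →L[ℂ] VNA M, (∀ x a, f (rmul x a) = f x * a) → ∃ y, ∀ x, f x = inn y x
  normal : ∀ x y : E, Continuous[ultraweakVNA M, ultraweakVNA M] fun a => inn x (lact a y)

/-- The representation `σ` is normal, that is, ultraweakly continuous. -/
def IsNormal (M : VonNeumannAlgebra H₀) {H : Type u} [NormedAddCommGroup H]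
    [InnerProductSpace ℂ H] [CompleteSpace H] (σ : VNA M →⋆ₐ[ℂ] (H →L[ℂ] H)) : Prop :=
  Continuous[ultraweakVNA M, ultraweak H] σ

/-- The representation `σ` as a bundled representation. -/
def repOf {M : VonNeumannAlgebra H₀} {H : Type u} [NormedAddCommGroup H]
    [InnerProductSpace ℂ H] [CompleteSpace H] (σ : VNA M →⋆ₐ[ℂ] (H →L[ℂ] H)) : Rep (VNA M) where
  carrier := H
  rep := σ.toNonUnitalStarAlgHom

section Hardy
variable (M : VonNeumannAlgebra H₀) (E : Type u) [NormedAddCommGroup E]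
    [NormedSpace ℂ E] [Correspondence (VNA M) E]

/-- The Hardy algebra `H^∞(E)`, the ultraweakly closed algebra generated by the operators
`φ_∞(a)`, `a ∈ M`, and `T_ξ`, `ξ ∈ E`, on `F(E)`. Adjointable operators `X` on `F(E)` are identified
with the operators `X ⊗ I` on the Hilbert space `F(E) ⊗ H₀` (tensored over the identity
representation of `M`); this is a normal faithful representation, so it preserves ultraweak
closures. -/
def hardy : NonUnitalSubalgebra ℂ ((idRep M).fock E →L[ℂ] (idRep M).fock E) :=
  ultraweakClosure <| NonUnitalAlgebra.adjoin ℂ <|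
    Set.range (fockAct E (idRep M)) ∪ Set.range (creation (idRep M))

/-- The element `φ_∞(a)` of `H^∞(E)`. -/
def hardyAct (a : VNA M) : hardy M E :=
  ⟨fockAct E (idRep M) a, subset_ultraweakClosure _ <|
    NonUnitalAlgebra.subset_adjoin ℂ (Or.inl ⟨a, rfl⟩)⟩

variable {E} in
/-- The element `T_ξ` of `H^∞(E)`. -/
def hardyCreation (ξ : E) : hardy M E :=
  ⟨creation (idRep M) ξ, subset_ultraweakClosure _ <|
    NonUnitalAlgebra.subset_adjoin ℂ (Or.inr ⟨ξ, rfl⟩)⟩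

/-- `π` is the integrated form `τ × T` on `H^∞(E)` of a covariant pair `(τ, T)`: the ultraweakly
continuous algebra homomorphism with `π(φ_∞(a)) = τ(a)` and `π(T_ξ) = T(ξ)`. There is at most one,
since the generators generate an ultraweakly dense algebra. -/
structure IsIntegratedForm {K : Type u} [NormedAddCommGroup K] [InnerProductSpace ℂ K]
    [CompleteSpace K] (τ : VNA M → K →L[ℂ] K) (T : E → K →L[ℂ] K)
    (π : hardy M E →ₙₐ[ℂ] (K →L[ℂ] K)) : Prop where
  continuous : Continuous[TopologicalSpace.induced Subtype.val (ultraweak _), ultraweak K] π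
  map_act : ∀ a, π (hardyAct M E a) = τ a
  map_creation : ∀ ξ, π (hardyCreation M ξ) = T ξ

/-- The integrated form `τ × T`, meaningful when it exists. -/
def integratedForm {K : Type u} [NormedAddCommGroup K] [InnerProductSpace ℂ K]
    [CompleteSpace K] (τ : VNA M → K →L[ℂ] K) (T : E → K →L[ℂ] K) :
    hardy M E →ₙₐ[ℂ] (K →L[ℂ] K) :=
  Classical.epsilon (IsIntegratedForm M E τ T)

end Hardy

end VN

section Commutant
open Tensor Correspondence
variable {A : Type u} [CStarAlgebra A] {E : Type u} [NormedAddCommGroup E] [NormedSpace ℂ E] [Correspondence A E]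

/-- The commutant `σ(A)'`, a von Neumann algebra. -/
def Rep.commutant (K : Rep A) : VonNeumannAlgebra K.carrier where
  toStarSubalgebra := StarSubalgebra.centralizer ℂ (Set.range K.rep)
  centralizer_centralizer' := Set.centralizer_centralizer_centralizer _

theorem mem_commutant_iff {K : Rep A} {T : K.carrier →L[ℂ] K.carrier} :
    T ∈ K.commutant.toStarSubalgebra ↔ T ∈ K.Hom K := by
  change T ∈ Set.centralizer (Set.range K.rep ∪ star (Set.range K.rep)) ↔ _
  constructor
  · intro h a
    exact (h _ (Or.inl ⟨a, rfl⟩)).symm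
  · rintro h _ (⟨a, rfl⟩ | ⟨a, ha⟩)
    · exact (h a).symm
    · have := h (star a)
      rw [map_star, ha, star_star] at this
      exact this.symm

/-- An element of the commutant as a self-intertwiner. -/
def commHom {K : Rep A} (c : VNA K.commutant) : K.Hom K :=
  ⟨VNA.val _ c, mem_commutant_iff.mp c.val_mem⟩

theorem idTensor_comp {K L N : Rep A} (S : L.Hom N) (T : K.Hom L) :
    (idTensor E ⟨S.1 ∘L T.1, comp_mem S.2 T.2⟩).1 = (idTensor E S).1 ∘L (idTensor E T).1 :=
  ext_clm fun x k => by
    refine (idTensor_tmul _ x k).trans ?_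
    exact ((congrArg _ (idTensor_tmul T x k)).trans (idTensor_tmul S x (T.1 k))).symm

theorem idTensor_adjoint {K L : Rep A} (T : K.Hom L) :
    (idTensor E ⟨ContinuousLinearMap.adjoint T.1, adjoint_mem T.2⟩).1 =
      ContinuousLinearMap.adjoint (idTensor E T).1 :=
  eq_adjoint _ _ fun x k y l => by
    have e1 := idTensor_tmul (E := E) ⟨ContinuousLinearMap.adjoint T.1, adjoint_mem T.2⟩ x k
    have e2 := idTensor_tmul (E := E) T y l
    refine (congrArg (fun z => inner ℂ z (tmul K y l)) e1).trans ?_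
    refine Eq.trans ?_ (congrArg (fun z => inner ℂ (tmul L x k) z) e2).symm
    rw [inner_tmul, inner_tmul, ContinuousLinearMap.adjoint_inner_left]
    exact congrArg (fun z => inner ℂ k z) (DFunLike.congr_fun (T.2 (inn x y)) l)

theorem idTensor_add {K L : Rep A} (S T : K.Hom L) :
    idTensor E (S + T) = idTensor E S + idTensor E T :=
  Subtype.ext <| ext_clm fun x k => by
    have e1 := idTensor_tmul (E := E) (S + T) x k
    have e2 := idTensor_tmul (E := E) S x k
    have e3 := idTensor_tmul (E := E) T x k
    refine e1.trans ?_
    refine Eq.trans ?_ (congrArg₂ (· + ·) e2 e3).symm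
    exact tmul_add_right L x _ _

theorem idTensor_smul {K L : Rep A} (c : ℂ) (T : K.Hom L) :
    idTensor E (c • T) = c • idTensor E T :=
  Subtype.ext <| ext_clm fun x k => by
    refine (idTensor_tmul (E := E) (c • T) x k).trans ?_
    refine Eq.trans ?_ (congrArg (c • ·) (idTensor_tmul (E := E) T x k)).symm
    exact tmul_smul_right L c x _

/-- The dual `E^σ` as a correspondence over the commutant: `⟨η, ζ⟩ = η* ζ`, `η · c = η c` and
`c · η = (I_E ⊗ c) η`. -/
instance (K : Rep A) : Correspondence (VNA K.commutant) (Dual E K) where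
  inn η ζ := .mk (ContinuousLinearMap.adjoint η.1 ∘L ζ.1)
    (mem_commutant_iff.mpr (comp_mem (adjoint_mem η.2) ζ.2))
  rmul η c := .mk (η.1 ∘L VNA.val _ c) (comp_mem η.2 (commHom c).2)
  lact :=
    { toFun := fun c =>
        { toFun := fun η =>
            .mk ((idTensor E (commHom c)).1 ∘L η.1) (comp_mem (idTensor E (commHom c)).2 η.2)
          map_add' := fun η ζ => Subtype.ext (ContinuousLinearMap.comp_add _ _ _)
          map_smul' := fun z η => Subtype.ext (ContinuousLinearMap.comp_smul _ _ _) }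
      map_smul' := fun z c => by
        ext1 η
        refine Subtype.ext ?_
        change (idTensor E (z • commHom c)).1 ∘L η.1 = z • ((idTensor E (commHom c)).1 ∘L η.1)
        rw [idTensor_smul]; rfl
      map_zero' := by
        ext1 η
        refine Subtype.ext ?_
        have h0 : commHom (0 : VNA K.commutant) = (0 : ℂ) • (0 : K.Hom K) := (zero_smul ℂ _).symm
        change (idTensor E (commHom 0)).1 ∘L η.1 = 0
        rw [h0, idTensor_smul, zero_smul]
        exact ContinuousLinearMap.zero_comp _
      map_add' := fun c d => by
        ext1 η
        refine Subtype.ext ?_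
        change (idTensor E (commHom c + commHom d)).1 ∘L η.1 = _
        rw [idTensor_add]; rfl
      map_mul' := fun c d => by
        ext1 η
        refine Subtype.ext ?_
        exact congrArg (fun z => z ∘L η.1) (idTensor_comp (commHom c) (commHom d)) }
  inn_add η ζ θ := VNA.ext (ContinuousLinearMap.comp_add _ _ _)
  inn_smul c η ζ := VNA.ext (ContinuousLinearMap.comp_smul _ _ _)
  inn_rmul η ζ c := VNA.ext (ContinuousLinearMap.comp_assoc _ _ _).symm
  star_inn η ζ := VNA.ext <| by
    change ContinuousLinearMap.adjoint (ContinuousLinearMap.adjoint η.1 ∘L ζ.1) =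
      ContinuousLinearMap.adjoint ζ.1 ∘L η.1
    rw [ContinuousLinearMap.adjoint_comp, ContinuousLinearMap.adjoint_adjoint]
  inn_self_pos η := by
    have hpos : 0 ≤ ContinuousLinearMap.adjoint η.1 ∘L η.1 := by
      rw [ContinuousLinearMap.nonneg_iff_isPositive]
      exact ContinuousLinearMap.isPositive_adjoint_comp_self η.1
    refine ⟨.mk (CFC.sqrt (ContinuousLinearMap.adjoint η.1 ∘L η.1)) (mem_commutant_iff.mpr
      (sqrt_commute (comp_mem (adjoint_mem η.2) η.2))), VNA.ext ?_⟩
    change _ = star (CFC.sqrt (ContinuousLinearMap.adjoint η.1 ∘L η.1)) *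
      CFC.sqrt (ContinuousLinearMap.adjoint η.1 ∘L η.1)
    rw [(IsSelfAdjoint.of_nonneg (CFC.sqrt_nonneg _)).star_eq]
    exact (CFC.sqrt_mul_sqrt_self _ hpos).symm
  norm_sq η := by
    change ‖η.1‖ ^ 2 = ‖ContinuousLinearMap.adjoint η.1 ∘L η.1‖
    rw [ContinuousLinearMap.norm_adjoint_comp_self, sq]
  inn_lact c η ζ := VNA.ext <| by
    change ContinuousLinearMap.adjoint ((idTensor E (commHom c)).1 ∘L η.1) ∘L ζ.1 =
      ContinuousLinearMap.adjoint η.1 ∘L ((idTensor E (commHom (star c))).1 ∘L ζ.1)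
    rw [ContinuousLinearMap.adjoint_comp, ← idTensor_adjoint, ContinuousLinearMap.comp_assoc]
    rfl

end Commutant

section Fourier
open Tensor Correspondence
variable {A : Type u} [CStarAlgebra A] {E : Type u} [NormedAddCommGroup E] [NormedSpace ℂ E]
  [Correspondence A E]

theorem dualPow_add {K : Rep A} (η ζ : Dual E K) (n : ℕ) :
    dualPow (η + ζ) n = dualPow η n + dualPow ζ n := by
  induction n with
  | zero => rfl
  | succ n ih => exact (congrArg _ ih).trans (idTensor_add _ _)

theorem dualPow_smul {K : Rep A} (c : ℂ) (η : Dual E K) (n : ℕ) :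
    dualPow (c • η) n = c • dualPow η n := by
  induction n with
  | zero => rfl
  | succ n ih => exact (congrArg _ ih).trans (idTensor_smul _ _)

theorem dualPow_lact {K : Rep A} (c : VNA K.commutant) (η : Dual E K) (n : ℕ) :
    (dualPow (lact c η : Dual E K) n).1 =
      (idTensorPow E (commHom c) (n + 1)).1 ∘L (dualPow η n).1 := by
  induction n with
  | zero => rfl
  | succ n ih =>
    have h : dualPow (lact c η : Dual E K) n = ⟨(idTensorPow E (commHom c) (n + 1)).1 ∘L
      (dualPow η n).1, comp_mem (idTensorPow E (commHom c) (n + 1)).2 (dualPow η n).2⟩ :=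
      Subtype.ext ih
    exact (congrArg (fun z => (idTensor E z).1) h).trans (idTensor_comp _ _)

theorem adjoint_dualPow {K : Rep A} (η ζ : Dual E K) (n : ℕ) :
    ContinuousLinearMap.adjoint (dualPow η n).1 ∘L (dualPow ζ n).1 =
      (idTensorPow E (commHom (inn η ζ : VNA K.commutant)) n).1 := by
  induction n with
  | zero => rfl
  | succ n ih =>
    have h : idTensorPow E (commHom (inn η ζ : VNA K.commutant)) n =
        ⟨ContinuousLinearMap.adjoint (dualPow η n).1 ∘L (dualPow ζ n).1,
          comp_mem (adjoint_mem (dualPow η n).2) (dualPow ζ n).2⟩ := Subtype.ext ih.symm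
    refine Eq.trans ?_ (congrArg (fun z => (idTensor E z).1) h).symm
    refine Eq.trans ?_ (idTensor_comp ⟨_, adjoint_mem (dualPow η n).2⟩ (dualPow ζ n)).symm
    exact congrArg (· ∘L (idTensor E (dualPow ζ n)).1) (idTensor_adjoint (dualPow η n)).symm

/-- The map `η ⊗ v ↦ (I_{E^{⊗ n}} ⊗ η) (V v)` on the algebraic tensor product. -/
def fourierPre {K : Rep A} (n : ℕ) (L : Rep (VNA K.commutant))
    (V : L.carrier →L[ℂ] (K.tower E n).carrier) :
    PreTensor (Dual E K) L →ₗ[ℂ] (K.tower E (n + 1)).carrier :=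
  TensorProduct.lift <| LinearMap.mk₂ ℂ (fun (η : Dual E K) v => (dualPow η n).1 (V v))
    (fun η ζ v => by rw [dualPow_add]; rfl)
    (fun c η v => by rw [dualPow_smul]; rfl)
    (fun η v w => by rw [map_add, map_add])
    (fun c η v => by rw [map_smul, map_smul])

theorem fourierPre_tmul {K : Rep A} (n : ℕ) (L : Rep (VNA K.commutant))
    (V : L.carrier →L[ℂ] (K.tower E n).carrier) (η : Dual E K) (v : L.carrier) :
    fourierPre n L V (PreTensor.tmul L η v) = (dualPow η n).1 (V v) := rfl

theorem inner_fourierPre {K : Rep A} (n : ℕ) (L : Rep (VNA K.commutant))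
    (V : L.carrier →L[ℂ] (K.tower E n).carrier)
    (hi : ∀ v w, inner ℂ (V v) (V w) = inner ℂ v w)
    (hV : ∀ c v, V (L.rep c v) = (idTensorPow E (commHom c) n).1 (V v))
    (v w : PreTensor (Dual E K) L) :
    inner ℂ (fourierPre n L V v) (fourierPre n L V w) = PreTensor.form (Dual E K) L v w := by
  induction v using PreTensor.induction with
  | h0 => simp
  | ha v v' h h' => rw [map_add, inner_add_left, h, h', map_add]; rfl
  | ht η k =>
    induction w using PreTensor.induction with
    | h0 => simp
    | ha w w' h h' => rw [map_add, inner_add_right, h, h', map_add]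
    | ht ζ l =>
      rw [fourierPre_tmul, fourierPre_tmul, PreTensor.form_tmul, ← hi, hV, ← adjoint_dualPow,
        ContinuousLinearMap.comp_apply, ContinuousLinearMap.adjoint_inner_right]

theorem norm_fourierPre {K : Rep A} (n : ℕ) (L : Rep (VNA K.commutant))
    (V : L.carrier →L[ℂ] (K.tower E n).carrier)
    (hi : ∀ v w, inner ℂ (V v) (V w) = inner ℂ v w)
    (hV : ∀ c v, V (L.rep c v) = (idTensorPow E (commHom c) n).1 (V v))
    (v : PreTensor (Dual E K) L) : ‖fourierPre n L V v‖ = ‖v‖ := by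
  refine (sq_eq_sq₀ (norm_nonneg _) (norm_nonneg _)).mp ?_
  rw [norm_sq_eq_re_inner (𝕜 := ℂ), norm_sq_pre, inner_fourierPre n L V hi hV]
  rfl

theorem inner_lift {K : Rep A} {F : Type*} [NormedAddCommGroup F] [InnerProductSpace ℂ F]
    [CompleteSpace F] (f : PreTensor E K →ₗ[ℂ] F) (C : ℝ) (hf : ∀ v, ‖f v‖ ≤ C * ‖v‖)
    (hi : ∀ v w, inner ℂ (f v) (f w) = PreTensor.form E K v w) (v w : tensorSpace E K) :
    inner ℂ (lift f C hf v) (lift f C hf w) = inner ℂ v w := by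
  induction v using (denseRange_toTensor K).induction_on with
  | hp =>
    exact isClosed_eq ((lift f C hf).continuous.inner continuous_const)
      (continuous_id.inner continuous_const)
  | ih v =>
    induction w using (denseRange_toTensor K).induction_on with
    | hp =>
      exact isClosed_eq (continuous_const.inner (lift f C hf).continuous)
        (continuous_const.inner continuous_id)
    | ih w => rw [lift_toTensor, lift_toTensor, hi, inner_toTensor]

variable (E) in
/-- The restriction of the Fourier transform to `(E^σ)^{⊗ n} ⊗ H`, bundled with its two
properties: it is isometric and it intertwines `φ(c) ⊗ I` with `I ⊗ c` for `c` in the commutant. -/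
def fourierLevel (K : Rep A) : ∀ n,
    {V : ((idRep K.commutant).tower (Dual E K) n).carrier →L[ℂ] (K.tower E n).carrier //
      (∀ v w, inner ℂ (V v) (V w) = inner ℂ v w) ∧
      ∀ c v, V (((idRep K.commutant).tower (Dual E K) n).rep c v) =
        (idTensorPow E (commHom c) n).1 (V v)}
  | 0 => ⟨ContinuousLinearMap.id ℂ K.carrier, fun _ _ => rfl, fun _ _ => rfl⟩
  | n + 1 =>
    ⟨lift (fourierPre n _ (fourierLevel K n).1) 1 fun v => by
      rw [one_mul, norm_fourierPre n _ _ (fourierLevel K n).2.1 (fourierLevel K n).2.2],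
      inner_lift _ _ _ (inner_fourierPre n _ _ (fourierLevel K n).2.1 (fourierLevel K n).2.2),
      fun c => DFunLike.congr_fun <| ext_clm
        (S := lift (fourierPre n _ (fourierLevel K n).1) 1 _ ∘L left _ c)
        (T := (idTensorPow E (commHom c) (n + 1)).1 ∘L lift (fourierPre n _ (fourierLevel K n).1) 1 _)
        fun η v => by
          rw [ContinuousLinearMap.comp_apply, ContinuousLinearMap.comp_apply, left_tmul, lift_tmul,
            lift_tmul, fourierPre_tmul, fourierPre_tmul, dualPow_lact]
          rfl⟩

theorem norm_fourierLevel_le (K : Rep A) (n : ℕ) : ‖(fourierLevel E K n).1‖ ≤ 1 := by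
  refine ContinuousLinearMap.opNorm_le_bound _ zero_le_one fun v => ?_
  refine (sq_le_sq₀ (norm_nonneg _) (by positivity)).mp ?_
  rw [one_mul, norm_sq_eq_re_inner (𝕜 := ℂ), (fourierLevel E K n).2.1,
    ← norm_sq_eq_re_inner (𝕜 := ℂ)]

theorem fourierLevel_zero (K : Rep A) (k : K.carrier) : (fourierLevel E K 0).1 k = k := rfl

theorem fourierLevel_succ_tmul (K : Rep A) (n : ℕ) (η : Dual E K)
    (v : ((idRep K.commutant).tower (Dual E K) n).carrier) :
    (fourierLevel E K (n + 1)).1 (tmul _ η v) = (dualPow η n).1 ((fourierLevel E K n).1 v) :=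
  lift_tmul _ _ _ _ _

variable (E) in
/-- The (inverse) Fourier transform `U : F(E^σ) ⊗ H → F(E) ⊗ H`, where `H` carries the identity
representation of the commutant. It is given by
`U(η₁ ⊗ ⋯ ⊗ ηₙ ⊗ h) = (I_{E^{⊗ (n-1)}} ⊗ η₁) ⋯ (I_E ⊗ η_{n-1}) ηₙ h`. -/
def fourier (K : Rep A) : (idRep K.commutant).fock (Dual E K) →L[ℂ] K.fock E :=
  diagOp (fun n => (fourierLevel E K n).1) 1 (norm_fourierLevel_le K)

variable (E) in
/-- The representation `ρ(X) = U (X ⊗ I_H) U*` of `H^∞(E^σ)` on `F(E) ⊗ H`. As `H` carries the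
identity representation of the commutant, `X ⊗ I_H` is `X` itself in the realization used for
the Hardy algebra. -/
def rho (K : Rep A) (X : hardy K.commutant (Dual E K)) : K.fock E →L[ℂ] K.fock E :=
  fourier E K ∘L X.1 ∘L ContinuousLinearMap.adjoint (fourier E K)

/-- The operator `Δ_*(η) = (I - η* η)^{1/2}`, as an element of the commutant. -/
def defect {K : Rep A} (η : Dual E K) : VNA K.commutant :=
  .mk (CFC.sqrt (ContinuousLinearMap.id ℂ K.carrier - ContinuousLinearMap.adjoint η.1 ∘L η.1)) <|
    mem_commutant_iff.mpr <| sqrt_commute <| Submodule.sub_mem _ (id_mem K) <|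
      comp_mem (adjoint_mem η.2) η.2

/-- The Poisson kernel `K(η) = (I_{F(E)} ⊗ Δ_*(η)) C(η)`. -/
def poissonKernel {K : Rep A} (η : Dual E K) (hη : ‖η‖ < 1) : K.carrier →L[ℂ] K.fock E :=
  idTensorFock E (commHom (defect η)) ∘L cauchyKernel η hη

end Fourier

section Point
variable {H₀ : Type u} [NormedAddCommGroup H₀] [InnerProductSpace ℂ H₀] [CompleteSpace H₀]
  {M : VonNeumannAlgebra H₀} {H : Type u} [NormedAddCommGroup H]
  [InnerProductSpace ℂ H] [CompleteSpace H]
  {E : Type u} [NormedAddCommGroup E] [NormedSpace ℂ E] [Correspondence (VNA M) E]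

variable (E) in
/-- The induced representation `X ↦ X ⊗ I_H` of `H^∞(E)` on `F(E) ⊗_σ H`. -/
def inducedRep (σ : VNA M →⋆ₐ[ℂ] (H →L[ℂ] H)) :
    hardy M E →ₙₐ[ℂ] ((repOf σ).fock E →L[ℂ] (repOf σ).fock E) :=
  integratedForm M E (fockAct E (repOf σ)) (creation (repOf σ))

/-- The point evaluation `X ↦ X̂(η*) = (σ × η̂*)(X)`. -/
def pointEval (σ : VNA M →⋆ₐ[ℂ] (H →L[ℂ] H)) (η : Dual E (repOf σ)) :
    hardy M E →ₙₐ[ℂ] ((repOf σ).carrier →L[ℂ] (repOf σ).carrier) :=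
  integratedForm M E (repOf σ).rep (dualHat η)

end Point

end PoissonKernel

end

open PoissonKernel

/-! The Poisson kernel $K(\eta)$ is an isometry whose range is coinvariant for the induced
representation. Indeed $\Delta_*(\eta)^2=I-\eta^*\eta$ makes
$\|(I\otimes\Delta_*(\eta))\eta^{(n)}h\|^2$ equal to $\|\eta^{(n)}h\|^2-\|\eta^{(n+1)}h\|^2$, and
the sum telescopes to $\|h\|^2$ because $\|\eta^{(n)}\|\le\|\eta\|^n$ (`norm_poissonKernel`).
Moreover $(\varphi_\infty(a)\otimes I)K(\eta)=K(\eta)\sigma(a)$ and $(T_\xi\otimes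
I)^*K(\eta)=K(\eta)\widehat{\eta^*}(\xi)^*$. Compression by such an isometry is multiplicative and
sends generators to generators, so $X\mapsto K(\eta)^*(X\otimes I)K(\eta)$ is the point evaluation
as soon as $X\mapsto X\otimes I$ exists. Uniqueness of both maps is density of the generated algebra
together with the Hausdorff property of the ultraweak topology.

Existence of $X\mapsto X\otimes I_H$ rests on normality of $\sigma$. Every vector functional of
$\sigma$ is dominated by a vector of a multiple of the identity representation, so cyclic subspaces
of $H$ embed isometrically into such multiples. Zorn's lemma then gives intertwiners $W_i:H\to H_0$
with $\sum_i\|W_ih\|^2=\|h\|^2$ (`IsNormal.exists_hasSum_hom`). The operators $I\otimes W_i$ on the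
Fock spaces form an isometric column $C$. The operators whose multiple leaves the range of $C$
invariant form an ultraweakly closed algebra containing the generators, and $X\mapsto
C^*\,\mathrm{diag}(X,X,\dots)\,C$ is the desired homomorphism.

For the resolvent formulas, $I-T_\eta$ is inverted by a Neumann series with sum $R\in
H^\infty(E^\sigma)$. The vector $w=Rh$, for $h$ in the zeroth summand, solves $w=h+T_\eta w$, and
read level by level this says $Uw=C(\eta)h$. Since $U\varphi_\infty(c)=(I\otimes c)U$, this gives
$K(\eta)=\rho(\Delta_*(\eta)R)\iota_H$ (`poissonKernel_eq`).

The last equality is a commutation fact. The adjoint $U^*$ carries $\varphi_\infty(a)\otimes I$ to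
$I\otimes\sigma(a)$ and $T_\xi\otimes I$ to a creation operator acting at the right end of the
tensors. These commute with the left operators $\varphi_\infty(c)$ and $T_\eta$, hence with
$Y=\varphi_\infty(\Delta_*(\eta))R$. So the range of $U$ is coinvariant and $P=UYU^*$ satisfies
$P^*ZP=P^*PZ$ for $Z=X\otimes I$ (`adjoint_conj_comp_of_mem_coinvariantSubalgebra`). Only isometry
of $U$ is needed, not surjectivity. -/

noncomputable section
namespace PoissonKernel

/-! ### Amplifications and isometric columns -/

section Amplification
variable {J : Type*} {G G' : Type*} [NormedAddCommGroup G] [InnerProductSpace ℂ G]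
  [NormedAddCommGroup G'] [InnerProductSpace ℂ G']

theorem lp_two_hasSum {V : J → Type*} [∀ j, NormedAddCommGroup (V j)] (v : lp V 2) :
    HasSum (fun j => ‖v j‖ ^ 2) (‖v‖ ^ 2) := by
  have h := lp.hasSum_norm (p := 2) (by simp) v
  simpa using h

theorem memℓp_two_of_summable {V : J → Type*} [∀ j, NormedAddCommGroup (V j)] {w : ∀ j, V j}
    (hs : Summable fun j => ‖w j‖ ^ 2) : Memℓp w 2 :=
  memℓp_gen (by simpa using hs)

theorem memℓp_amplify (T : G →L[ℂ] G') (v : lp (fun _ : J => G) 2) :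
    Memℓp (fun j => T (v j)) 2 := by
  refine memℓp_two_of_summable (.of_nonneg_of_le (fun j => by positivity) (fun j => ?_)
    ((lp_two_hasSum v).summable.mul_left (‖T‖ ^ 2)))
  rw [← mul_pow]
  exact pow_le_pow_left₀ (norm_nonneg _) (T.le_opNorm _) 2

variable (J) in
/-- The amplification `diag(T, T, …)` of an operator `T`, indexed by `J`. -/
def amplify (T : G →L[ℂ] G') : lp (fun _ : J => G) 2 →L[ℂ] lp (fun _ : J => G') 2 :=
  LinearMap.mkContinuous
    { toFun := fun v => ⟨fun j => T (v j), memℓp_amplify T v⟩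
      map_add' := fun v w => by ext j; exact map_add T _ _
      map_smul' := fun c v => by ext j; exact map_smul T c _ } ‖T‖ fun v => by
    refine (sq_le_sq₀ (norm_nonneg _) (by positivity)).mp ?_
    rw [mul_pow]
    refine hasSum_le (fun j => ?_) (lp_two_hasSum (V := fun _ : J => G')
      ⟨fun j => T (v j), memℓp_amplify T v⟩) ((lp_two_hasSum v).mul_left (‖T‖ ^ 2))
    rw [← mul_pow]
    exact pow_le_pow_left₀ (norm_nonneg _) (T.le_opNorm _) 2

theorem amplify_apply (T : G →L[ℂ] G') (v : lp (fun _ : J => G) 2) (j : J) :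
    amplify J T v j = T (v j) := rfl

/-- The column of a family of operators whose squared norms sum up to the squared norm. -/
def isometricColumn (T : J → G →L[ℂ] G') (hT : ∀ v, HasSum (fun j => ‖T j v‖ ^ 2) (‖v‖ ^ 2)) :
    G →L[ℂ] lp (fun _ : J => G') 2 :=
  LinearMap.mkContinuous
    { toFun := fun v => ⟨fun j => T j v, memℓp_two_of_summable (hT v).summable⟩
      map_add' := fun v w => by ext j; exact map_add (T j) _ _
      map_smul' := fun c v => by ext j; exact map_smul (T j) c _ } 1 fun v => by
    rw [one_mul]
    refine (sq_le_sq₀ (norm_nonneg _) (by positivity)).mp ?_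
    exact ((lp_two_hasSum (V := fun _ : J => G')
      ⟨fun j => T j v, memℓp_two_of_summable (hT v).summable⟩).unique (hT v)).le

theorem norm_isometricColumn (T : J → G →L[ℂ] G')
    (hT : ∀ v, HasSum (fun j => ‖T j v‖ ^ 2) (‖v‖ ^ 2)) (v : G) :
    ‖isometricColumn T hT v‖ = ‖v‖ :=
  (sq_eq_sq₀ (norm_nonneg _) (norm_nonneg _)).mp ((lp_two_hasSum _).unique (hT v))

theorem adjoint_isometricColumn_comp [CompleteSpace G] [CompleteSpace G'] (T : J → G →L[ℂ] G')
    (hT : ∀ v, HasSum (fun j => ‖T j v‖ ^ 2) (‖v‖ ^ 2)) :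
    ContinuousLinearMap.adjoint (isometricColumn T hT) ∘L isometricColumn T hT = 1 :=
  (ContinuousLinearMap.norm_map_iff_adjoint_comp_self _).mp (norm_isometricColumn T hT)

/-- It suffices to check on a dense set that squared norms sum up to the squared norm. -/
theorem hasSum_norm_sq_of_dense (T : J → G →L[ℂ] G') {D : Type*} {d : D → G} (hd : DenseRange d)
    (hT : ∀ x, HasSum (fun j => ‖T j (d x)‖ ^ 2) (‖d x‖ ^ 2)) (v : G) :
    HasSum (fun j => ‖T j v‖ ^ 2) (‖v‖ ^ 2) := by
  -- Convergence of the full sum to $\|v\|^2$ is not visibly a closed condition, but bounds on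
  -- finite partial sums are. They make the column a bounded operator, and by its continuity the
  -- equality of norms then extends from the dense set.
  have hle : ∀ (v : G) (s : Finset J), ∑ j ∈ s, ‖T j v‖ ^ 2 ≤ ‖v‖ ^ 2 := fun v s => by
    induction v using hd.induction_on with
    | hp => exact isClosed_le (by fun_prop) (by fun_prop)
    | ih x => exact sum_le_hasSum s (fun _ _ => by positivity) (hT x)
  have hs : ∀ v, Summable fun j => ‖T j v‖ ^ 2 := fun v =>
    summable_of_sum_le (fun _ => by positivity) (hle v)
  let C : G →ₗ[ℂ] lp (fun _ : J => G') 2 :=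
    { toFun := fun v => ⟨fun j => T j v, memℓp_two_of_summable (hs v)⟩
      map_add' := fun v w => by ext j; exact map_add (T j) _ _
      map_smul' := fun c v => by ext j; exact map_smul (T j) c _ }
  have hC : ∀ v, HasSum (fun j => ‖T j v‖ ^ 2) (‖C v‖ ^ 2) := fun v => lp_two_hasSum (C v)
  let C' : G →L[ℂ] lp (fun _ : J => G') 2 := C.mkContinuous 1 fun v => by
    rw [one_mul]
    refine (sq_le_sq₀ (norm_nonneg _) (by positivity)).mp ?_
    rw [← (hC v).tsum_eq]
    exact (hs v).tsum_le_of_sum_le (hle v)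
  have hC' : ∀ v, HasSum (fun j => ‖T j v‖ ^ 2) (‖C' v‖ ^ 2) := hC
  have hn : ∀ v, ‖C' v‖ ^ 2 = ‖v‖ ^ 2 := fun v => by
    induction v using hd.induction_on with
    | hp => exact isClosed_eq (by fun_prop) (by fun_prop)
    | ih x => exact (hC' _).unique (hT x)
  rw [← hn]
  exact hC' v

end Amplification

/-! ### The ultraweak topology -/

section Ultraweak
variable {K : Type u} [NormedAddCommGroup K] [InnerProductSpace ℂ K]

theorem ultraweak_continuous_inner (x y : K) :
    Continuous[ultraweak K, inferInstance] fun T : K →L[ℂ] K => inner ℂ x (T y) := by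
  let δ : K → lp (fun _ : ℕ => K) 2 := fun z => lp.single 2 0 z
  have h0 : ∀ z, δ z 0 = z := fun z => lp.single_apply_self (E := fun _ : ℕ => K) 2 0 z
  have h1 : ∀ z n, n ≠ 0 → δ z n = 0 := fun z n hn =>
    lp.single_apply_ne (E := fun _ : ℕ => K) 2 0 z hn
  convert ultraweak_continuous_functional (δ x) (δ y) using 2 with T
  rw [tsum_eq_single 0 fun n hn => by rw [h1 x n hn, inner_zero_left], h0, h0]

theorem ultraweak_t2 : @T2Space (K →L[ℂ] K) (ultraweak K) := by
  let _ := ultraweak K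
  refine ⟨fun S T hST => ?_⟩
  obtain ⟨y, hy⟩ : ∃ y, S y ≠ T y := by
    by_contra! h
    exact hST (ContinuousLinearMap.ext h)
  obtain ⟨x, hx⟩ : ∃ x, inner ℂ x (S y) ≠ inner ℂ x (T y) := by
    by_contra! h
    exact hy (ext_inner_left ℂ h)
  exact separated_by_continuous (ultraweak_continuous_inner x y) hx

theorem summable_norm_sq_extend {V α β : Type*} [NormedAddCommGroup V] {e : α → β}
    (he : Function.Injective e) (z : α → V)
    (hz : Summable fun j => ‖z j‖ ^ 2) : Summable fun n => ‖Function.extend e z 0 n‖ ^ 2 := by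
  rw [← summable_extend_zero he] at hz
  convert hz using 1
  funext n
  by_cases hn : ∃ j, e j = n
  · obtain ⟨j, rfl⟩ := hn
    rw [he.extend_apply, he.extend_apply]
  · rw [Function.extend_apply' _ _ _ hn, Function.extend_apply' _ _ _ hn]
    simp

/-- The functionals that define the ultraweak topology may be indexed by any set. -/
theorem ultraweak_continuous_inner_lp {J : Type*} (x y : lp (fun _ : J => K) 2) :
    Continuous[ultraweak K, inferInstance] fun T : K →L[ℂ] K =>
      ∑' j, inner ℂ (x j) (T (y j)) := by
  classical
  set s : Set J := Function.support fun j => ‖x j‖ ^ 2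
  -- A square summable family has countable support, so the support of `x` can be renumbered inside
  -- `ℕ`. Both vectors are extended by zero; coordinates of `y` outside this support do not
  -- contribute.
  have hs : s.Countable := (lp_two_hasSum x).summable.countable_support
  have := hs.toEncodable
  have he : Function.Injective (Encodable.encode : s → ℕ) := Encodable.encode_injective
  have key : ∀ z : lp (fun _ : J => K) 2, ∃ w : lp (fun _ : ℕ => K) 2,
      ⇑w = Function.extend (Encodable.encode : s → ℕ) (fun j => z j) 0 := fun z => by
    refine ⟨⟨_, memℓp_two_of_summable ?_⟩, rfl⟩
    have h1 : Summable fun j : s => ‖z j‖ ^ 2 :=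
      (lp_two_hasSum z).summable.comp_injective Subtype.val_injective
    exact summable_norm_sq_extend he (fun j : s => z j) h1
  obtain ⟨x', hx'⟩ := key x
  obtain ⟨y', hy'⟩ := key y
  convert ultraweak_continuous_functional x' y' using 2 with T
  have e1 : ∑' j, inner ℂ (x j) (T (y j)) = ∑' j : s, inner ℂ (x j) (T (y j)) := by
    refine (tsum_subtype_eq_of_support_subset fun j hj => ?_).symm
    simp only [s, Function.mem_support] at hj ⊢
    intro h0
    have : x j = 0 := by simpa using h0
    exact hj (by rw [this, inner_zero_left])
  rw [e1, ← tsum_extend_zero he]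
  refine tsum_congr fun n => ?_
  rw [hx', hy']
  by_cases hn : ∃ j, (Encodable.encode : s → ℕ) j = n
  · obtain ⟨j, rfl⟩ := hn
    rw [he.extend_apply, he.extend_apply, he.extend_apply]
  · rw [Function.extend_apply' _ _ _ hn, Function.extend_apply' _ _ _ hn]
    simp

/-- Compressions of amplifications are ultraweakly continuous. -/
theorem ultraweak_continuous_amplify {F : Type u} [NormedAddCommGroup F] [InnerProductSpace ℂ F]
    [CompleteSpace F] [CompleteSpace K] {J : Type*} (S T : K →L[ℂ] lp (fun _ : J => F) 2) :
    Continuous[ultraweak F, ultraweak K] fun X : F →L[ℂ] F =>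
      ContinuousLinearMap.adjoint S ∘L amplify J X ∘L T := by
  refine ultraweak_continuous_rng (ultraweak F) _ fun x y => ?_
  -- A square summable sequence in `K` is sent by `R` to one square summable family over `ℕ × J`.
  -- This turns a functional of the compression of `diag(X, X, …)` into a functional of `X` of the
  -- previous type.
  have key : ∀ (R : K →L[ℂ] lp (fun _ : J => F) 2) (z : lp (fun _ : ℕ => K) 2),
      ∃ w : lp (fun _ : ℕ × J => F) 2, ∀ p, w p = R (z p.1) p.2 := fun R z => by
    refine ⟨⟨fun p => R (z p.1) p.2, memℓp_two_of_summable ?_⟩, fun _ => rfl⟩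
    refine (summable_prod_of_nonneg fun _ => by positivity).mpr
      ⟨fun n => (lp_two_hasSum (R (z n))).summable, ?_⟩
    have : ∀ n, ∑' j, ‖R (z n) j‖ ^ 2 = ‖R (z n)‖ ^ 2 := fun n =>
      (lp_two_hasSum (R (z n))).tsum_eq
    simp only [this]
    exact (lp_two_hasSum (amplify ℕ R z)).summable
  obtain ⟨x', hx'⟩ := key S x
  obtain ⟨y', hy'⟩ := key T y
  convert ultraweak_continuous_inner_lp x' y' using 2 with X
  have hs : Summable fun p => inner ℂ (x' p) (X (y' p)) := lp.summable_inner x' (amplify _ X y')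
  rw [hs.tsum_prod]
  refine tsum_congr fun n => ?_
  rw [ContinuousLinearMap.comp_apply, ContinuousLinearMap.adjoint_inner_right, lp.inner_eq_tsum]
  refine tsum_congr fun j => ?_
  rw [hx', hy']
  rfl

end Ultraweak

/-! ### Density of the generators and uniqueness of integrated forms -/

section Hardy
variable {H₀ : Type u} [NormedAddCommGroup H₀] [InnerProductSpace ℂ H₀] [CompleteSpace H₀]
  {M : VonNeumannAlgebra H₀} {E : Type u} [NormedAddCommGroup E] [NormedSpace ℂ E]
  [Correspondence (VNA M) E]

variable (M E) in
/-- The ultraweak topology on the Hardy algebra. -/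
@[reducible]
def ultraweakHardy : TopologicalSpace (hardy M E) :=
  TopologicalSpace.induced Subtype.val (ultraweak _)

theorem continuous_hardy_val : Continuous[ultraweakHardy M E, ultraweak _]
    (Subtype.val : hardy M E → ((idRep M).fock E →L[ℂ] (idRep M).fock E)) :=
  continuous_induced_dom

theorem hardy_le {C : NonUnitalSubalgebra ℂ ((idRep M).fock E →L[ℂ] (idRep M).fock E)}
    (hC : IsClosed[ultraweak _] (C : Set ((idRep M).fock E →L[ℂ] (idRep M).fock E)))
    (hact : ∀ a, fockAct E (idRep M) a ∈ C) (hcre : ∀ ξ, creation (idRep M) ξ ∈ C) :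
    hardy M E ≤ C := by
  let t := ultraweak ((idRep M).fock E)
  refine closure_minimal (SetLike.coe_subset_coe.mpr (NonUnitalAlgebra.adjoin_le ?_)) hC
  rintro _ (⟨a, rfl⟩ | ⟨ξ, rfl⟩)
  · exact hact a
  · exact hcre ξ

/-- An ultraweakly closed subalgebra of the Hardy algebra that contains the generators is the
whole Hardy algebra. -/
theorem hardy_eq_top (C : NonUnitalSubalgebra ℂ (hardy M E))
    (hC : IsClosed[ultraweakHardy M E] (C : Set (hardy M E)))
    (hact : ∀ a, hardyAct M E a ∈ C) (hcre : ∀ ξ, hardyCreation M ξ ∈ C) (X : hardy M E) :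
    X ∈ C := by
  let t := ultraweak ((idRep M).fock E)
  obtain ⟨D, hD, hDC⟩ := isClosed_induced_iff.mp hC
  -- The closure that defines the Hardy algebra is taken among all operators, whereas `C` lives in
  -- the subtype. The ambient closed set `D` cuts out `C`, so it is enough that the generated
  -- algebra lies in `D`.
  have h1 : ∀ g ∈ NonUnitalAlgebra.adjoin ℂ
      (Set.range (fockAct E (idRep M)) ∪ Set.range (creation (idRep M) (E := E))),
      ∃ Y ∈ C, Y.1 = g := fun g hg => by
    induction hg using NonUnitalAlgebra.adjoin_induction with
    | mem g hg =>
      rcases hg with ⟨a, rfl⟩ | ⟨ξ, rfl⟩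
      · exact ⟨_, hact a, rfl⟩
      · exact ⟨_, hcre ξ, rfl⟩
    | add f g _ _ hf hg =>
      obtain ⟨Y, hY, rfl⟩ := hf
      obtain ⟨Z, hZ, rfl⟩ := hg
      exact ⟨_, add_mem hY hZ, rfl⟩
    | zero => exact ⟨0, zero_mem _, rfl⟩
    | mul f g _ _ hf hg =>
      obtain ⟨Y, hY, rfl⟩ := hf
      obtain ⟨Z, hZ, rfl⟩ := hg
      exact ⟨_, mul_mem hY hZ, rfl⟩
    | smul c g _ hg =>
      obtain ⟨Y, hY, rfl⟩ := hg
      exact ⟨_, SMulMemClass.smul_mem c hY, rfl⟩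
  have h2 : X.1 ∈ D := by
    refine closure_minimal (fun g hg => ?_) hD X.2
    obtain ⟨Y, hY, rfl⟩ := h1 g hg
    rw [← SetLike.mem_coe, ← hDC] at hY
    exact hY
  rw [← SetLike.mem_coe, ← hDC]
  exact h2

variable {K : Type u} [NormedAddCommGroup K] [InnerProductSpace ℂ K] [CompleteSpace K]
  {τ : VNA M → K →L[ℂ] K} {T : E → K →L[ℂ] K} {π π' : hardy M E →ₙₐ[ℂ] (K →L[ℂ] K)}

/-- The ultraweak topology is Hausdorff, so the set where two integrated forms agree is a closed
subalgebra, and it contains the generators. -/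
theorem IsIntegratedForm.unique (h : IsIntegratedForm M E τ T π)
    (h' : IsIntegratedForm M E τ T π') : π = π' := by
  ext1 X
  let t := ultraweak K
  let t' := ultraweakHardy M E
  have := ultraweak_t2 (K := K)
  exact hardy_eq_top (NonUnitalAlgHom.equalizer π π') (isClosed_eq h.continuous h'.continuous)
    (fun a => (h.map_act a).trans (h'.map_act a).symm)
    (fun ξ => (h.map_creation ξ).trans (h'.map_creation ξ).symm) X

/-- Uniqueness identifies the chosen form with any form constructed explicitly; this is how the
formulas reach `inducedRep` and `pointEval`. -/
theorem IsIntegratedForm.eq_integratedForm (h : IsIntegratedForm M E τ T π) :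
    integratedForm M E τ T = π :=
  (Classical.epsilon_spec ⟨π, h⟩ : IsIntegratedForm M E τ T _).unique h

/-- A property of operators that defines an ultraweakly closed subalgebra and that holds for `τ a`
and `T ξ` holds for all values of the integrated form. -/
theorem IsIntegratedForm.mem_of_isClosed (h : IsIntegratedForm M E τ T π)
    (C : NonUnitalSubalgebra ℂ (K →L[ℂ] K)) (hC : IsClosed[ultraweak K] (C : Set (K →L[ℂ] K)))
    (hτ : ∀ a, τ a ∈ C) (hT : ∀ ξ, T ξ ∈ C) (X : hardy M E) : π X ∈ C := by
  let t := ultraweak K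
  let t' := ultraweakHardy M E
  refine hardy_eq_top (C.comap π) (hC.preimage h.continuous) (fun a => ?_) (fun ξ => ?_) X
  · rw [NonUnitalSubalgebra.mem_comap, h.map_act]; exact hτ a
  · rw [NonUnitalSubalgebra.mem_comap, h.map_creation]; exact hT ξ

end Hardy

/-! ### Intertwiners from cyclic vectors -/

section Cyclic
variable {A : Type u} [CStarAlgebra A] {K L : Rep A}

/-- The orbit map `a ↦ a h` of a vector `h`. -/
def Rep.orbit (K : Rep A) (h : K.carrier) : A →ₗ[ℂ] K.carrier where
  toFun a := K.rep a h
  map_add' a b := by rw [map_add]; rfl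
  map_smul' c a := by rw [map_smul]; rfl

theorem Rep.orbit_apply (K : Rep A) (h : K.carrier) (a : A) : K.orbit h a = K.rep a h := rfl

theorem Rep.inner_rep_left (K : Rep A) (a : A) (h k : K.carrier) :
    inner ℂ (K.rep a h) k = inner ℂ h (K.rep (star a) k) := by
  rw [map_star, ContinuousLinearMap.star_eq_adjoint, ContinuousLinearMap.adjoint_inner_right]

theorem Rep.mem_orbit_orthogonal {h k : K.carrier} :
    k ∈ (LinearMap.range (K.orbit h))ᗮ ↔ ∀ a, inner ℂ (K.rep a h) k = 0 := by
  rw [Submodule.mem_orthogonal]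
  exact ⟨fun H a => H _ ⟨a, rfl⟩, by rintro H _ ⟨a, rfl⟩; exact H a⟩

/-- If the orbit of `z` is dominated by the orbit of `h`, then `a h ↦ a z` extends to an
intertwining operator that vanishes on the orthogonal complement of the orbit of `h`. -/
theorem Rep.exists_hom_of_norm_le (h : K.carrier) (z : L.carrier)
    (hle : ∀ a, ‖L.rep a z‖ ≤ ‖K.rep a h‖) :
    ∃ W : K.Hom L, (∀ a, W.1 (K.rep a h) = L.rep a z) ∧
      ∀ k, (∀ a, inner ℂ (K.rep a h) k = 0) → W.1 k = 0 := by
  set N := LinearMap.range (K.orbit h) with hN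
  -- The range of `e` is $N+N^\perp$, dense because its orthogonal complement is $N^\perp\cap
  -- N^{\perp\perp}=0$. The desired operator is the extension of `f` along `e`; domination of the
  -- orbits and orthogonality of the two summands give $\|f\|\le\|e\|$ pointwise, which also takes
  -- care of well-definedness.
  let e : A × Nᗮ →ₗ[ℂ] K.carrier := (K.orbit h).coprod Nᗮ.subtype
  let f : A × Nᗮ →ₗ[ℂ] L.carrier := L.orbit z ∘ₗ LinearMap.fst ℂ A Nᗮ
  have he : ∀ p, e p = K.rep p.1 h + p.2 := fun p => rfl
  have hf : ∀ p, f p = L.rep p.1 z := fun p => rfl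
  have hd : DenseRange e := by
    have : (LinearMap.range e)ᗮ = ⊥ := by
      rw [LinearMap.range_coprod, Submodule.range_subtype, ← Submodule.inf_orthogonal,
        Submodule.orthogonal_orthogonal_eq_closure]
      refine eq_bot_iff.mpr fun x hx => ?_
      obtain ⟨hx1, hx2⟩ := hx
      rw [← Submodule.orthogonal_orthogonal_eq_closure] at hx2
      exact inner_self_eq_zero.mp (hx2 x hx1)
    rw [← Submodule.topologicalClosure_eq_top_iff] at this
    exact Submodule.dense_iff_topologicalClosure_eq_top.mpr this
  have hb : ∃ C, ∀ x, ‖f x‖ ≤ C * ‖e x‖ := ⟨1, fun p => by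
    rw [one_mul, hf, he]
    refine (hle p.1).trans ((sq_le_sq₀ (norm_nonneg _) (norm_nonneg _)).mp ?_)
    have := norm_add_sq_eq_norm_sq_add_norm_sq_of_inner_eq_zero (𝕜 := ℂ) (K.rep p.1 h) p.2
      (p.2.2 _ ⟨p.1, rfl⟩)
    rw [sq, sq, this]
    nlinarith [norm_nonneg (p.2 : K.carrier)]⟩
  let W := f.extendOfNorm e
  have hW : ∀ p, W (e p) = f p := LinearMap.extendOfNorm_eq hd hb
  -- The complement of an orbit is invariant because the algebra is closed under the star; without
  -- this the extension would not intertwine.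
  have hinv : ∀ b, ∀ k ∈ Nᗮ, K.rep b k ∈ Nᗮ := fun b k hk => by
    rw [Rep.mem_orbit_orthogonal] at hk ⊢
    intro a
    rw [← star_star b, ← K.inner_rep_left, ← mul_apply_eq_comp, ← map_mul]
    exact hk _
  refine ⟨⟨W, fun b => ?_⟩, fun a => ?_, fun k hk => ?_⟩
  · refine ContinuousLinearMap.ext fun k => ?_
    induction k using hd.induction_on with
    | hp => exact isClosed_eq (by fun_prop) (by fun_prop)
    | ih p =>
      have : K.rep b (e p) = e (b * p.1, ⟨K.rep b p.2, hinv b _ p.2.2⟩) := by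
        rw [he, he, map_add, map_mul]; rfl
      rw [ContinuousLinearMap.comp_apply, ContinuousLinearMap.comp_apply, this, hW, hW, hf, hf,
        map_mul]
      rfl
  · have : K.rep a h = e (a, 0) := by rw [he]; simp
    change W _ = _
    rw [this, hW, hf]
  · have : k = e (0, ⟨k, Rep.mem_orbit_orthogonal.mpr hk⟩) := by rw [he]; simp
    change W k = 0
    rw [this, hW, hf]; simp

/-- The modulus satisfies $|V|^2=V^*V$, hence $\||V|x\|=\|Vx\|$. It serves to sharpen domination of
orbits to equality. -/
theorem norm_sqrt_adjoint_comp_apply {G F : Type*} [NormedAddCommGroup G] [InnerProductSpace ℂ G]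
    [CompleteSpace G] [NormedAddCommGroup F] [InnerProductSpace ℂ F] [CompleteSpace F]
    (V : G →L[ℂ] F) (x : G) :
    ‖CFC.sqrt (ContinuousLinearMap.adjoint V ∘L V) x‖ = ‖V x‖ := by
  have hpos : 0 ≤ ContinuousLinearMap.adjoint V ∘L V := by
    rw [ContinuousLinearMap.nonneg_iff_isPositive]
    exact ContinuousLinearMap.isPositive_adjoint_comp_self V
  set D := CFC.sqrt (ContinuousLinearMap.adjoint V ∘L V)
  have hD : ContinuousLinearMap.adjoint D = D := IsSelfAdjoint.of_nonneg (CFC.sqrt_nonneg _)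
  have hDD : D * D = ContinuousLinearMap.adjoint V ∘L V := CFC.sqrt_mul_sqrt_self _ hpos
  refine (sq_eq_sq₀ (norm_nonneg _) (norm_nonneg _)).mp ?_
  rw [norm_sq_eq_re_inner (𝕜 := ℂ), norm_sq_eq_re_inner (𝕜 := ℂ),
    ← ContinuousLinearMap.adjoint_inner_right, hD, ← mul_apply_eq_comp D D, hDD,
    ContinuousLinearMap.comp_apply, ContinuousLinearMap.adjoint_inner_right]

/-- The polarized form of an equality of norms on orbits. -/
theorem Rep.inner_eq_of_norm_eq {h : K.carrier} {z : L.carrier}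
    (heq : ∀ a, ‖L.rep a z‖ = ‖K.rep a h‖) (a b : A) :
    inner ℂ (L.rep a z) (L.rep b z) = inner ℂ (K.rep a h) (K.rep b h) := by
  have h1 : ∀ x y, ‖L.orbit z (x + y)‖ = ‖K.orbit h (x + y)‖ := fun x y => heq _
  have h2 : ∀ (c : ℂ) x y, ‖L.orbit z (x - c • y)‖ = ‖K.orbit h (x - c • y)‖ := fun c x y => heq _
  have h3 : ∀ (c : ℂ) x y, ‖L.orbit z (x + c • y)‖ = ‖K.orbit h (x + c • y)‖ := fun c x y => heq _
  have h4 := h2 1 a b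
  have h5 := h2 Complex.I a b
  have h6 := h3 Complex.I a b
  have h7 := h1 a b
  simp only [map_add, map_sub, map_smul, Rep.orbit_apply, one_smul] at h4 h5 h6 h7
  rw [inner_eq_sum_norm_sq_div_four, inner_eq_sum_norm_sq_div_four]
  simp only [RCLike.I_to_complex, h4, h5, h6, h7]

/-- The amplification of a representation. -/
def Rep.ampl (K : Rep A) (J : Type) : Rep A where
  carrier := lp (fun _ : J => K.carrier) 2
  rep :=
    { toFun := fun a => amplify J (K.rep a)
      map_smul' := fun c a => by
        ext v j
        change K.rep (c • a) (v j) = c • K.rep a (v j)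
        rw [map_smul]; rfl
      map_zero' := by
        ext v j
        change K.rep 0 (v j) = 0
        rw [map_zero]; rfl
      map_add' := fun a b => by
        ext v j
        change K.rep (a + b) (v j) = K.rep a (v j) + K.rep b (v j)
        rw [map_add]; rfl
      map_mul' := fun a b => by
        ext v j
        change K.rep (a * b) (v j) = K.rep a (K.rep b (v j))
        rw [map_mul]; rfl
      map_star' := fun a => by
        rw [ContinuousLinearMap.star_eq_adjoint, ContinuousLinearMap.eq_adjoint_iff]
        intro v w
        rw [lp.inner_eq_tsum, lp.inner_eq_tsum]
        refine tsum_congr fun j => ?_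
        rw [amplify_apply, amplify_apply, K.inner_rep_left, star_star] }

/-- The coordinates of an amplification. -/
def Rep.amplCoord (K : Rep A) (J : Type) (j : J) : (K.ampl J).Hom K :=
  ⟨LinearMap.mkContinuous
    { toFun := fun v : lp (fun _ : J => K.carrier) 2 => v j
      map_add' := fun _ _ => rfl
      map_smul' := fun _ _ => rfl } 1 fun v => by
        rw [one_mul]; exact lp.norm_apply_le_norm (by simp) v j,
    fun a => rfl⟩

/-- A cyclic subrepresentation whose cyclic vector is dominated by a vector of an amplification of
`L` embeds isometrically into that amplification. -/
theorem Rep.exists_isometric_hom {J : Type}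
    (h : K.carrier) (z : (L.ampl J).carrier)
    (hle : ∀ a, ‖K.rep a h‖ ≤ ‖(L.ampl J).rep a z‖) :
    ∃ W : K.Hom (L.ampl J), (∀ a k, inner ℂ (W.1 (K.rep a h)) (W.1 k) = inner ℂ (K.rep a h) k) ∧
      ∀ k, (∀ a, inner ℂ (K.rep a h) k = 0) → W.1 k = 0 := by
  obtain ⟨V, hV, -⟩ := Rep.exists_hom_of_norm_le z h hle
  set D := CFC.sqrt (ContinuousLinearMap.adjoint V.1 ∘L V.1) with hD
  have hDm : D ∈ (L.ampl J).Hom (L.ampl J) :=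
    Tensor.sqrt_commute (Tensor.comp_mem (Tensor.adjoint_mem V.2) V.2)
  -- The operator `V` maps the orbit of `z` onto that of `h`, and $|V|$ commutes with the
  -- representation. Hence the orbit of $|V|z$ has exactly the norms of the orbit of `h`, while
  -- staying in the amplification of `L`.
  have heq : ∀ a, ‖(L.ampl J).rep a (D z)‖ = ‖K.rep a h‖ := fun a => by
    have : (L.ampl J).rep a (D z) = D ((L.ampl J).rep a z) :=
      (DFunLike.congr_fun (hDm a) z).symm
    rw [this, hD, norm_sqrt_adjoint_comp_apply, hV]
  obtain ⟨W, hW, hW0⟩ := Rep.exists_hom_of_norm_le h (D z) fun a => (heq a).le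
  refine ⟨W, fun a k => ?_, hW0⟩
  set N := LinearMap.range (K.orbit h)
  -- `W` is isometric on the closed orbit of `h` and zero on its complement, so the two parts of `k`
  -- are treated separately.
  obtain ⟨k₁, hk₁, k₂, hk₂, rfl⟩ :=
    (Submodule.exists_add_mem_mem_orthogonal (K := N.topologicalClosure) k)
  rw [Submodule.orthogonal_closure, Rep.mem_orbit_orthogonal] at hk₂
  rw [map_add, inner_add_right, inner_add_right, hW0 k₂ hk₂, hk₂, inner_zero_right, add_zero,
    add_zero]
  refine closure_minimal (s := (N : Set K.carrier))
    (t := {k | inner ℂ (W.1 (K.rep a h)) (W.1 k) = inner ℂ (K.rep a h) k}) ?_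
    (isClosed_eq (by fun_prop) (by fun_prop)) hk₁
  rintro _ ⟨b, rfl⟩
  change inner ℂ (W.1 (K.rep a h)) (W.1 (K.rep b h)) = inner ℂ (K.rep a h) (K.rep b h)
  rw [hW, hW, Rep.inner_eq_of_norm_eq heq]

/-- If every vector of `K` is dominated by a vector of an amplification of `L`, then `K` embeds
isometrically into an amplification of `L`. -/
theorem Rep.exists_hasSum_hom (hK : K.rep 1 = 1)
    (hdom : ∀ h : K.carrier, ∃ (J : Type) (z : (L.ampl J).carrier),
      ∀ a, ‖K.rep a h‖ ≤ ‖(L.ampl J).rep a z‖) :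
    ∃ (I : Type u) (W : I → K.Hom L), ∀ k, HasSum (fun i => ‖(W i).1 k‖ ^ 2) (‖k‖ ^ 2) := by
  -- `S` is a maximal set of vectors with pairwise orthogonal orbits.
  obtain ⟨S, hS⟩ := zorn_subset
    {S : Set K.carrier | S.Pairwise fun s t => ∀ a, inner ℂ (K.rep a s) t = 0}
    fun c hc hch => ⟨⋃₀ c, (Set.pairwise_sUnion hch.directedOn).mpr hc,
      fun s hs => Set.subset_sUnion_of_mem hs⟩
  -- A vector orthogonal to all these orbits may be added to `S`, so it belongs to `S` and is
  -- orthogonal to its own orbit. By unitality that orbit contains the vector itself.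
  have hmax : ∀ k, (∀ s ∈ S, ∀ a, inner ℂ (K.rep a s) k = 0) → k = 0 := fun k hk => by
    have hins : insert k S ∈
        {S : Set K.carrier | S.Pairwise fun s t => ∀ a, inner ℂ (K.rep a s) t = 0} := by
      refine hS.prop.insert fun s hs _ => ⟨fun a => ?_, hk s hs⟩
      rw [K.inner_rep_left, ← inner_conj_symm, hk s hs, map_zero]
    have hkS : k ∈ S := hS.le_of_ge hins (Set.subset_insert k S) (Set.mem_insert k S)
    have := hk k hkS 1
    rw [hK] at this
    exact inner_self_eq_zero.mp this
  choose J z hz using hdom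
  choose W hW hW0 using fun h => Rep.exists_isometric_hom h (z h) (hz h)
  let T : (Σ s : S, J s) → K.Hom L := fun p =>
    ⟨(L.amplCoord (J p.1) p.2).1 ∘L (W p.1).1,
      Tensor.comp_mem (L.amplCoord (J p.1) p.2).2 (W p.1).2⟩
  have hT : ∀ p k, (T p).1 k = (L.amplCoord (J p.1) p.2).1 ((W p.1).1 k) :=
    fun _ _ => rfl
  refine ⟨Σ s : S, J s, T, ?_⟩
  -- The polarized Parseval identity against all `k'` is a conjugate-linear condition on `k`, so it
  -- defines a subspace; the identity for norms would not visibly do so.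
  let N : Submodule ℂ K.carrier :=
    { carrier := {k | ∀ k', HasSum (fun p => inner ℂ ((T p).1 k) ((T p).1 k')) (inner ℂ k k')}
      zero_mem' := fun k' => by simp
      add_mem' := fun {k l} hk hl k' => by
        simpa only [map_add, inner_add_left] using (hk k').add (hl k')
      smul_mem' := fun c k hk k' => by
        simpa only [map_smul, inner_smul_left] using (hk k').mul_left _ }
  -- On the orbit of `s` only the indices over `s` contribute, since every other `W` vanishes on the
  -- complement of its own orbit.
  have hN : ∀ s ∈ S, ∀ a, K.rep a s ∈ N := fun s hs a k' => by
    have hi : Function.Injective fun j : J s => (⟨⟨s, hs⟩, j⟩ : Σ s : S, J s) :=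
      sigma_mk_injective (β := fun s : S => J s) (i := ⟨s, hs⟩)
    refine (hi.hasSum_iff fun p hp => ?_).mp ?_
    · have : (W p.1).1 (K.rep a s) = 0 := by
        refine hW0 _ _ fun b => ?_
        have hne : (p.1 : K.carrier) ≠ s := fun h => hp (by
          obtain ⟨⟨t, ht⟩, j⟩ := p
          subst h
          exact ⟨j, rfl⟩)
        rw [← star_star a, ← K.inner_rep_left, ← mul_apply_eq_comp, ← map_mul]
        exact hS.prop p.1.2 hs hne _
      rw [hT, this, map_zero, inner_zero_left]
    · rw [← hW s a k']
      exact lp.hasSum_inner (𝕜 := ℂ) (G := fun _ : J s => L.carrier) _ _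
  have hd : DenseRange N.subtype := by
    have : Nᗮ = ⊥ := eq_bot_iff.mpr fun k hk => hmax k fun s hs a => hk _ (hN s hs a)
    rw [← Submodule.topologicalClosure_eq_top_iff,
      ← Submodule.dense_iff_topologicalClosure_eq_top] at this
    exact this.denseRange_val
  refine hasSum_norm_sq_of_dense (fun p => (T p).1) hd fun k => ?_
  have := (Complex.hasSum_re (k.2 k.1))
  simpa [inner_self_eq_norm_sq_to_K, ← Complex.ofReal_pow] using this

end Cyclic

/-! ### Normal representations inside multiples of the identity representation -/

section Normal
variable {H₀ : Type u} [NormedAddCommGroup H₀] [InnerProductSpace ℂ H₀] [CompleteSpace H₀]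
  {M : VonNeumannAlgebra H₀}

/-- The functional `a ↦ ∑ ⟨x_n, a y_n⟩` on a von Neumann algebra. -/
def vectorFunctional (p : lp (fun _ : ℕ => H₀) 2 × lp (fun _ : ℕ => H₀) 2) : VNA M →ₗ[ℂ] ℂ where
  toFun a := ∑' n, inner ℂ (p.1 n) (VNA.val M a (p.2 n))
  map_add' a b := by
    rw [← (ultraweak_summable p.1 p.2 _).tsum_add (ultraweak_summable p.1 p.2 _)]
    simp
  map_smul' c a := by
    rw [RingHom.id_apply, smul_eq_mul, ← tsum_mul_left]
    simp

/-- Two vectors of amplifications, put together. -/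
theorem exists_lp_sum {G : Type*} [NormedAddCommGroup G] [InnerProductSpace ℂ G] {J J' : Type}
    (z : lp (fun _ : J => G) 2) (w : lp (fun _ : J' => G) 2) :
    ∃ v : lp (fun _ : J ⊕ J' => G) 2, ∀ T : G →L[ℂ] G,
      ‖amplify _ T v‖ ^ 2 = ‖amplify J T z‖ ^ 2 + ‖amplify J' T w‖ ^ 2 := by
  have key : ∀ (z : lp (fun _ : J => G) 2) (w : lp (fun _ : J' => G) 2),
      HasSum (fun p => ‖Sum.elim z w p‖ ^ 2) (‖z‖ ^ 2 + ‖w‖ ^ 2) := fun z w =>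
    HasSum.sum (lp_two_hasSum z) (lp_two_hasSum w)
  refine ⟨⟨Sum.elim z w, memℓp_two_of_summable (V := fun _ : J ⊕ J' => G) (key z w).summable⟩,
    fun T => ?_⟩
  refine (lp_two_hasSum _).unique ?_
  convert key (amplify J T z) (amplify J' T w) using 2 with p
  rcases p with j | j <;> rfl

/-- For one generator, $\sum\langle x_n,a^*a\,y_n\rangle=\langle ax,ay\rangle$ is at most
$\|ax\|^2+\|ay\|^2$, which is $\|av\|^2$ for the vector $v$ joining $x$ and $y$. Sums of functionals
are handled by joining vectors again, and a scalar $c$ by rescaling with $\sqrt{|c|}$. -/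
theorem exists_dominating_of_mem_span (f : VNA M →ₗ[ℂ] ℂ)
    (hf : f ∈ Submodule.span ℂ (Set.range (vectorFunctional (M := M)))) :
    ∃ (J : Type) (z : lp (fun _ : J => H₀) 2),
      ∀ a, ‖f (star a * a)‖ ≤ ‖amplify J (VNA.val M a) z‖ ^ 2 := by
  induction hf using Submodule.span_induction with
  | mem f hf =>
    obtain ⟨⟨x, y⟩, rfl⟩ := hf
    obtain ⟨v, hv⟩ := exists_lp_sum x y
    refine ⟨_, v, fun a => ?_⟩
    have : vectorFunctional (x, y) (star a * a) =
        inner ℂ (amplify ℕ (VNA.val M a) x) (amplify ℕ (VNA.val M a) y) := by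
      rw [lp.inner_eq_tsum]
      refine tsum_congr fun n => ?_
      rw [map_mul, map_star, mul_apply_eq_comp, ContinuousLinearMap.star_eq_adjoint,
        ContinuousLinearMap.adjoint_inner_right]
      rfl
    rw [this, hv]
    refine (norm_inner_le_norm _ _).trans ?_
    nlinarith [sq_nonneg (‖amplify ℕ (VNA.val M a) x‖ - ‖amplify ℕ (VNA.val M a) y‖),
      sq_nonneg ‖amplify ℕ (VNA.val M a) x‖, sq_nonneg ‖amplify ℕ (VNA.val M a) y‖]
  | zero => exact ⟨ℕ, 0, fun a => by simp⟩
  | add f g _ _ hf hg =>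
    obtain ⟨J, z, hz⟩ := hf
    obtain ⟨J', w, hw⟩ := hg
    obtain ⟨v, hv⟩ := exists_lp_sum z w
    refine ⟨_, v, fun a => ?_⟩
    rw [hv]
    exact (norm_add_le _ _).trans (add_le_add (hz a) (hw a))
  | smul c f _ hf =>
    obtain ⟨J, z, hz⟩ := hf
    refine ⟨J, ((√‖c‖ : ℝ) : ℂ) • z, fun a => ?_⟩
    rw [map_smul, norm_smul, mul_pow, Complex.norm_real, Real.norm_of_nonneg (Real.sqrt_nonneg _),
      Real.sq_sqrt (norm_nonneg _), LinearMap.smul_apply, norm_smul]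
    exact mul_le_mul_of_nonneg_left (hz a) (norm_nonneg _)

/-- A normal representation embeds isometrically into an amplification of the identity
representation. -/
theorem IsNormal.exists_hasSum_hom {H : Type u} [NormedAddCommGroup H] [InnerProductSpace ℂ H]
    [CompleteSpace H] {σ : VNA M →⋆ₐ[ℂ] (H →L[ℂ] H)} (hσ : IsNormal M σ) :
    ∃ (I : Type u) (W : I → (repOf σ).Hom (idRep M)),
      ∀ k, HasSum (fun i => ‖(W i).1 k‖ ^ 2) (‖k‖ ^ 2) := by
  refine Rep.exists_hasSum_hom (map_one σ) fun h => ?_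
  let φ : VNA M →ₗ[ℂ] ℂ := (innerSL ℂ (h : H)).toLinearMap ∘ₗ (repOf σ).orbit h
  have hφ : φ ∈ Submodule.span ℂ (Set.range (vectorFunctional (M := M))) := by
    -- A linear functional continuous for the topology induced by a family of functionals is a
    -- finite linear combination of them. Here the family is that of the ultraweak functionals, and
    -- $\varphi(a)=\langle h,\sigma(a)h\rangle$ is continuous by normality.
    rw [LinearMap.mem_span_iff_continuous]
    have h1 : Continuous[ultraweakVNA M, inferInstance] φ :=
      @Continuous.comp _ _ _ (ultraweakVNA M) (ultraweak H) _ _ _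
        (ultraweak_continuous_inner (h : H) h) hσ
    convert h1 using 1
    rw [ultraweakVNA, ultraweak, induced_iInf]
    refine iInf_congr fun p => ?_
    rw [induced_compose]
    rfl
  obtain ⟨J, z, hz⟩ := exists_dominating_of_mem_span φ hφ
  refine ⟨J, z, fun a => (sq_le_sq₀ (norm_nonneg _) (norm_nonneg _)).mp ?_⟩
  refine le_trans (le_of_eq ?_) (hz a)
  change _ = ‖inner ℂ h ((repOf σ).rep (star a * a) h)‖
  rw [map_mul, mul_apply_eq_comp, ← (repOf σ).inner_rep_left, inner_self_eq_norm_sq_to_K]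
  simp

end Normal

/-! ### Weighted shifts and adjoints of graded operators -/

section Shift
variable {G : ℕ → Type u} [∀ n, NormedAddCommGroup (G n)] [∀ n, InnerProductSpace ℂ (G n)]

theorem shiftOp_zero (T : ∀ n, G n →L[ℂ] G (n + 1)) (C : ℝ) (hT : ∀ n, ‖T n‖ ≤ C) (v : lp G 2) :
    shiftOp T C hT v 0 = 0 := rfl

theorem shiftOp_succ (T : ∀ n, G n →L[ℂ] G (n + 1)) (C : ℝ) (hT : ∀ n, ‖T n‖ ≤ C) (v : lp G 2)
    (n : ℕ) : shiftOp T C hT v (n + 1) = T n (v n) := rfl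

theorem norm_shiftOp_le (T : ∀ n, G n →L[ℂ] G (n + 1)) (C : ℝ) (hT : ∀ n, ‖T n‖ ≤ C) :
    ‖shiftOp T C hT‖ ≤ C :=
  LinearMap.mkContinuous_norm_le _ ((norm_nonneg _).trans (hT 0)) _

end Shift

section HilbertSum
variable {G G' : ℕ → Type u} [∀ n, NormedAddCommGroup (G n)] [∀ n, InnerProductSpace ℂ (G n)]
  [∀ n, CompleteSpace (G n)] [∀ n, NormedAddCommGroup (G' n)] [∀ n, InnerProductSpace ℂ (G' n)]
  [∀ n, CompleteSpace (G' n)]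

theorem adjoint_diagOp_apply (T : ∀ n, G n →L[ℂ] G' n) (C : ℝ) (hT : ∀ n, ‖T n‖ ≤ C)
    (v : lp G' 2) (n : ℕ) :
    ContinuousLinearMap.adjoint (diagOp T C hT) v n = ContinuousLinearMap.adjoint (T n) (v n) := by
  refine ext_inner_left ℂ fun x => ?_
  have e : diagOp T C hT (lp.single 2 n x) = lp.single 2 n (T n x) := by
    ext m
    rw [diagOp_apply]
    by_cases h : m = n
    · subst h
      rw [lp.single_apply_self, lp.single_apply_self]
    · rw [lp.single_apply_ne 2 n _ h, lp.single_apply_ne 2 n _ h, map_zero]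
  rw [← lp.inner_single_left (𝕜 := ℂ) n x, ContinuousLinearMap.adjoint_inner_right,
    ContinuousLinearMap.adjoint_inner_right, e, lp.inner_single_left]

theorem adjoint_shiftOp_apply (T : ∀ n, G n →L[ℂ] G (n + 1)) (C : ℝ) (hT : ∀ n, ‖T n‖ ≤ C)
    (v : lp G 2) (n : ℕ) :
    ContinuousLinearMap.adjoint (shiftOp T C hT) v n =
      ContinuousLinearMap.adjoint (T n) (v (n + 1)) := by
  refine ext_inner_left ℂ fun x => ?_
  have e : shiftOp T C hT (lp.single 2 n x) = lp.single 2 (n + 1) (T n x) := by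
    ext m
    cases m with
    | zero => rw [shiftOp_zero, lp.single_apply_ne 2 _ _ (by omega)]
    | succ m =>
      rw [shiftOp_succ]
      by_cases h : m = n
      · subst h
        rw [lp.single_apply_self, lp.single_apply_self]
      · rw [lp.single_apply_ne 2 n _ h, lp.single_apply_ne 2 (n + 1) _ (by omega), map_zero]
  rw [← lp.inner_single_left (𝕜 := ℂ) n x, ContinuousLinearMap.adjoint_inner_right,
    ContinuousLinearMap.adjoint_inner_right, e, lp.inner_single_left]

end HilbertSum

/-! ### Intertwiners on tensor powers and on Fock spaces -/

section Intertwiners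
open Tensor Correspondence
variable {A : Type u} [CStarAlgebra A] {E : Type u} [NormedAddCommGroup E] [NormedSpace ℂ E]
  [Correspondence A E] {K L N : Rep A}

theorem Rep.adjoint_rep (K : Rep A) (a : A) :
    ContinuousLinearMap.adjoint (K.rep a) = K.rep (star a) := by
  rw [map_star, ContinuousLinearMap.star_eq_adjoint]

theorem Rep.hom_apply (T : K.Hom L) (a : A) (k : K.carrier) :
    T.1 (K.rep a k) = L.rep a (T.1 k) := DFunLike.congr_fun (T.2 a) k

theorem idTensor_comp_creationAt (T : K.Hom L) (ξ : E) :
    (idTensor E T).1 ∘L creationAt K ξ = creationAt L ξ ∘L T.1 :=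
  ContinuousLinearMap.ext fun k => idTensor_tmul T ξ k

/-- Adjoint form of the relation for `T*`. It lets annihilation of the first tensor factor pass
through operators that act on the later factors. -/
theorem adjoint_creationAt_comp_idTensor (T : K.Hom L) (ξ : E) :
    ContinuousLinearMap.adjoint (creationAt L ξ) ∘L (idTensor E T).1 =
      T.1 ∘L ContinuousLinearMap.adjoint (creationAt K ξ) := by
  have h := congrArg ContinuousLinearMap.adjoint
    (idTensor_comp_creationAt ⟨ContinuousLinearMap.adjoint T.1, adjoint_mem T.2⟩ ξ)
  rw [idTensor_adjoint, ContinuousLinearMap.adjoint_comp, ContinuousLinearMap.adjoint_comp,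
    ContinuousLinearMap.adjoint_adjoint, ContinuousLinearMap.adjoint_adjoint] at h
  exact h

theorem idTensorPow_comp (S : L.Hom N) (T : K.Hom L) (n : ℕ) :
    idTensorPow E (⟨S.1 ∘L T.1, comp_mem S.2 T.2⟩ : K.Hom N) n =
      ⟨(idTensorPow E S n).1 ∘L (idTensorPow E T n).1,
        comp_mem (idTensorPow E S n).2 (idTensorPow E T n).2⟩ := by
  induction n with
  | zero => rfl
  | succ n ih =>
    refine Subtype.ext ((congrArg (fun z => (idTensor E z).1) ih).trans ?_)
    exact idTensor_comp _ _

theorem idTensorPow_adjoint (T : K.Hom L) (n : ℕ) :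
    idTensorPow E (⟨ContinuousLinearMap.adjoint T.1, adjoint_mem T.2⟩ : L.Hom K) n =
      ⟨ContinuousLinearMap.adjoint (idTensorPow E T n).1, adjoint_mem (idTensorPow E T n).2⟩ := by
  induction n with
  | zero => rfl
  | succ n ih =>
    refine Subtype.ext ((congrArg (fun z => (idTensor E z).1) ih).trans ?_)
    exact idTensor_adjoint _

theorem idTensorPow_add (S T : K.Hom L) (n : ℕ) :
    idTensorPow E (S + T) n = idTensorPow E S n + idTensorPow E T n := by
  induction n with
  | zero => rfl
  | succ n ih => exact (congrArg (idTensor E) ih).trans (idTensor_add _ _)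

theorem idTensor_id (K : Rep A) :
    (idTensor E ⟨ContinuousLinearMap.id ℂ K.carrier, id_mem K⟩).1 =
      ContinuousLinearMap.id ℂ (K.tensor E).carrier :=
  ext_clm fun x k => idTensor_tmul _ x k

theorem idTensorPow_id (K : Rep A) (n : ℕ) :
    idTensorPow E (⟨ContinuousLinearMap.id ℂ K.carrier, id_mem K⟩ : K.Hom K) n =
      ⟨ContinuousLinearMap.id ℂ _, id_mem _⟩ := by
  induction n with
  | zero => rfl
  | succ n ih =>
    refine Subtype.ext ((congrArg (fun z => (idTensor E z).1) ih).trans ?_)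
    exact idTensor_id _

theorem idTensorFock_apply (T : K.Hom L) (v : K.fock E) (n : ℕ) :
    idTensorFock E T v n = (idTensorPow E T n).1 (v n) := rfl

theorem norm_creation_le (K : Rep A) (ξ : E) : ‖creation K ξ‖ ≤ ‖ξ‖ := norm_shiftOp_le _ _ _

theorem fockAct_adjoint (K : Rep A) (a : A) :
    ContinuousLinearMap.adjoint (fockAct E K a) = fockAct E K (star a) := by
  ext v n
  exact (adjoint_diagOp_apply _ _ _ v n).trans
    (DFunLike.congr_fun ((K.tower E n).adjoint_rep a) (v n))

theorem adjoint_creation_apply (K : Rep A) (ξ : E) (v : K.fock E) (n : ℕ) :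
    ContinuousLinearMap.adjoint (creation K ξ) v n =
      ContinuousLinearMap.adjoint (creationAt (K.tower E n) ξ) (v (n + 1)) :=
  adjoint_shiftOp_apply (G := fun n => (K.tower E n).carrier) _ _ _ v n

theorem idTensorFock_adjoint (T : K.Hom L) :
    ContinuousLinearMap.adjoint (idTensorFock E T) =
      idTensorFock E ⟨ContinuousLinearMap.adjoint T.1, adjoint_mem T.2⟩ := by
  ext v n
  refine (adjoint_diagOp_apply (G := fun n => (K.tower E n).carrier)
    (G' := fun n => (L.tower E n).carrier) _ _ _ v n).trans ?_
  rw [idTensorFock_apply, idTensorPow_adjoint]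

theorem idTensorFock_comp (S : L.Hom N) (T : K.Hom L) :
    idTensorFock E (⟨S.1 ∘L T.1, comp_mem S.2 T.2⟩ : K.Hom N) =
      idTensorFock E S ∘L idTensorFock E T := by
  ext v n
  rw [idTensorFock_apply, idTensorPow_comp]
  rfl

theorem idTensorFock_comp_fockAct (T : K.Hom L) (a : A) :
    idTensorFock E T ∘L fockAct E K a = fockAct E L a ∘L idTensorFock E T := by
  ext v n
  exact Rep.hom_apply (idTensorPow E T n) a (v n)

theorem idTensorFock_comp_creation (T : K.Hom L) (ξ : E) :
    idTensorFock E T ∘L creation K ξ = creation L ξ ∘L idTensorFock E T := by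
  ext v n
  cases n with
  | zero => exact map_zero T.1
  | succ n => exact idTensor_tmul (idTensorPow E T n) ξ (v n)

theorem hasSum_inner_of_hasSum_norm_sq {I : Type*} {G G' : Type*} [NormedAddCommGroup G]
    [InnerProductSpace ℂ G] [CompleteSpace G] [NormedAddCommGroup G'] [InnerProductSpace ℂ G']
    [CompleteSpace G'] {W : I → G →L[ℂ] G'}
    (hW : ∀ k, HasSum (fun i => ‖W i k‖ ^ 2) (‖k‖ ^ 2)) (k l : G) :
    HasSum (fun i => inner ℂ (W i k) (W i l)) (inner ℂ k l) := by
  have h := lp.hasSum_inner (𝕜 := ℂ) (isometricColumn W hW k) (isometricColumn W hW l)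
  rwa [← ContinuousLinearMap.adjoint_inner_right, ← ContinuousLinearMap.comp_apply,
    adjoint_isometricColumn_comp] at h

/-- Formally, $\sum W_i^*W_i=I$ implies $\sum(I\otimes W_i)^*(I\otimes W_i)=I$. On elementary
tensors the inner products reduce to $\langle W_ik,W_i\langle x,y\rangle l\rangle$, because each
$W_i$ intertwines. The sesquilinear version passes to sums of tensors, and density does the rest. -/
theorem hasSum_idTensor {I : Type*} {W : I → K.Hom L}
    (hW : ∀ k, HasSum (fun i => ‖(W i).1 k‖ ^ 2) (‖k‖ ^ 2)) (v : (K.tensor E).carrier) :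
    HasSum (fun i => ‖(idTensor E (W i)).1 v‖ ^ 2) (‖v‖ ^ 2) := by
  let R : I → tensorSpace E K →L[ℂ] tensorSpace E L := fun i => (idTensor E (W i)).1
  have hR : ∀ i x k, R i (toTensor K (PreTensor.tmul K x k)) = tmul L x ((W i).1 k) :=
    fun i x k => idTensor_tmul (W i) x k
  have key : ∀ v w : PreTensor E K, HasSum (fun i => inner ℂ (R i (toTensor K v))
      (R i (toTensor K w))) (PreTensor.form E K v w) := fun v w => by
    induction v using PreTensor.induction with
    | h0 => simp
    | ha v v' h h' => simpa only [map_add, inner_add_left, LinearMap.add_apply] using h.add h'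
    | ht x k =>
      induction w using PreTensor.induction with
      | h0 => simp
      | ha w w' h h' => simpa only [map_add, inner_add_right] using h.add h'
      | ht y l =>
        rw [PreTensor.form_tmul]
        convert hasSum_inner_of_hasSum_norm_sq hW k (K.rep (inn x y) l) using 2 with i
        rw [Rep.hom_apply, ← inner_tmul, hR, hR]
  refine hasSum_norm_sq_of_dense R (denseRange_toTensor K) (fun v => ?_) v
  rw [norm_toTensor, norm_sq_pre]
  have h := Complex.hasSum_re (key v v)
  convert h using 2 with i
  exact norm_sq_eq_re_inner (𝕜 := ℂ) _

theorem hasSum_idTensorPow {I : Type*} {W : I → K.Hom L}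
    (hW : ∀ k, HasSum (fun i => ‖(W i).1 k‖ ^ 2) (‖k‖ ^ 2)) (n : ℕ) (v : (K.tower E n).carrier) :
    HasSum (fun i => ‖(idTensorPow E (W i) n).1 v‖ ^ 2) (‖v‖ ^ 2) := by
  induction n with
  | zero => exact hW v
  | succ n ih => exact hasSum_idTensor ih v

theorem hasSum_idTensorFock {I : Type*} {W : I → K.Hom L}
    (hW : ∀ k, HasSum (fun i => ‖(W i).1 k‖ ^ 2) (‖k‖ ^ 2)) (v : K.fock E) :
    HasSum (fun i => ‖idTensorFock E (W i) v‖ ^ 2) (‖v‖ ^ 2) := by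
  have h1 : ∀ n, HasSum (fun i => ‖(idTensorPow E (W i) n).1 (v n)‖ ^ 2) (‖v n‖ ^ 2) :=
    fun n => hasSum_idTensorPow hW n (v n)
  have hs : Summable fun p : ℕ × I => ‖(idTensorPow E (W p.2) p.1).1 (v p.1)‖ ^ 2 := by
    refine (summable_prod_of_nonneg fun _ => by positivity).mpr ⟨fun n => (h1 n).summable, ?_⟩
    simp only [(h1 _).tsum_eq]
    exact (lp_two_hasSum v).summable
  have h2 : HasSum (fun p : ℕ × I => ‖(idTensorPow E (W p.2) p.1).1 (v p.1)‖ ^ 2) (‖v‖ ^ 2) := by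
    rw [← (hs.hasSum.prod_fiberwise h1).unique (lp_two_hasSum v)]
    exact hs.hasSum
  -- A double series of nonnegative terms: the sum over levels and the sum over `i` are
  -- interchanged.
  exact ((Equiv.prodComm I ℕ).hasSum_iff.mpr h2).prod_fiberwise fun i =>
    lp_two_hasSum (idTensorFock E (W i) v)

end Intertwiners

/-! ### Coinvariant ranges of isometries -/

section Coinvariant
variable {F G : Type u} [NormedAddCommGroup F] [InnerProductSpace ℂ F] [CompleteSpace F]
  [NormedAddCommGroup G] [InnerProductSpace ℂ G] [CompleteSpace G]

/-- The operators `Z` for which the range of the isometry `V` is coinvariant and whose compression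
`V* Z V` commutes with `Y`. -/
def coinvariantSubalgebra (V : G →L[ℂ] F) (Y : G →L[ℂ] G) : NonUnitalSubalgebra ℂ (F →L[ℂ] F) where
  carrier := {Z | ContinuousLinearMap.adjoint V ∘L Z =
      (ContinuousLinearMap.adjoint V ∘L Z ∘L V) ∘L ContinuousLinearMap.adjoint V ∧
    (ContinuousLinearMap.adjoint V ∘L Z ∘L V) ∘L Y = Y ∘L ContinuousLinearMap.adjoint V ∘L Z ∘L V}
  zero_mem' := by simp
  add_mem' := by
    rintro Z Z' ⟨h1, h2⟩ ⟨h3, h4⟩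
    simp only [Set.mem_ofPred_eq, ContinuousLinearMap.add_comp, ContinuousLinearMap.comp_add] at *
    exact ⟨by rw [← h1, ← h3], by rw [h2, h4]⟩
  smul_mem' := by
    rintro c Z ⟨h1, h2⟩
    simp only [Set.mem_ofPred_eq, ContinuousLinearMap.smul_comp, ContinuousLinearMap.comp_smul] at *
    exact ⟨by rw [← h1], by rw [h2]⟩
  mul_mem' := by
    rintro Z Z' ⟨h1, h2⟩ ⟨h3, h4⟩
    -- Coinvariance $V^*Z=(V^*ZV)V^*$ makes compression multiplicative, and both defining conditions
    -- then pass to products.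
    have e : ContinuousLinearMap.adjoint V ∘L (Z * Z') ∘L V =
        (ContinuousLinearMap.adjoint V ∘L Z ∘L V) ∘L ContinuousLinearMap.adjoint V ∘L Z' ∘L V := by
      change (ContinuousLinearMap.adjoint V ∘L Z) ∘L Z' ∘L V = _
      rw [h1]; rfl
    refine ⟨?_, ?_⟩
    · rw [e]
      change (ContinuousLinearMap.adjoint V ∘L Z) ∘L Z' = (ContinuousLinearMap.adjoint V ∘L Z ∘L V) ∘L
        (ContinuousLinearMap.adjoint V ∘L Z' ∘L V) ∘L ContinuousLinearMap.adjoint V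
      rw [← h3, h1]; rfl
    · rw [e, ContinuousLinearMap.comp_assoc, h4, ← ContinuousLinearMap.comp_assoc, h2]
      rfl

/-- Since $V^*V=I$, the relation $V^*Z=Z'V^*$ forces $Z'$ to be the compression of $Z$. The
generators are checked in this form. -/
theorem mem_coinvariantSubalgebra {V : G →L[ℂ] F} {Y : G →L[ℂ] G}
    (hV : ContinuousLinearMap.adjoint V ∘L V = 1) {Z : F →L[ℂ] F} {Z' : G →L[ℂ] G}
    (hZ : ContinuousLinearMap.adjoint V ∘L Z = Z' ∘L ContinuousLinearMap.adjoint V)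
    (hY : Z' ∘L Y = Y ∘L Z') : Z ∈ coinvariantSubalgebra V Y := by
  have e : ContinuousLinearMap.adjoint V ∘L Z ∘L V = Z' := by
    rw [← ContinuousLinearMap.comp_assoc, hZ, ContinuousLinearMap.comp_assoc, hV]; rfl
  exact ⟨by rw [e, hZ], by rw [e, hY]⟩

/-- Tested against vectors, with $V^*$ and $Y$ on the left moved to the other side of the inner
product, both conditions become equalities between functionals $Z\mapsto\langle u,Zv\rangle$. -/
theorem isClosed_coinvariantSubalgebra (V : G →L[ℂ] F) (Y : G →L[ℂ] G) :
    IsClosed[ultraweak F] (coinvariantSubalgebra V Y : Set (F →L[ℂ] F)) := by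
  let t := ultraweak F
  have e : (coinvariantSubalgebra V Y : Set (F →L[ℂ] F)) =
      (⋂ (x : G) (y : F), {Z | inner ℂ (V x) (Z y) =
        inner ℂ (V x) (Z (V (ContinuousLinearMap.adjoint V y)))}) ∩
      ⋂ (x : G) (y : G), {Z | inner ℂ (V x) (Z (V (Y y))) =
        inner ℂ (V (ContinuousLinearMap.adjoint Y x)) (Z (V y))} := by
    ext Z
    simp only [Set.mem_inter_iff, Set.mem_iInter, Set.mem_ofPred_eq]
    refine and_congr ⟨fun h x y => ?_, fun h => ?_⟩ ⟨fun h x y => ?_, fun h => ?_⟩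
    · rw [← ContinuousLinearMap.adjoint_inner_right, ← ContinuousLinearMap.adjoint_inner_right]
      exact congrArg (inner ℂ x) (DFunLike.congr_fun h y)
    · refine ContinuousLinearMap.ext fun y => ext_inner_left ℂ fun x => ?_
      simpa only [ContinuousLinearMap.comp_apply, ContinuousLinearMap.adjoint_inner_right]
        using h x y
    · rw [← ContinuousLinearMap.adjoint_inner_right, ← ContinuousLinearMap.adjoint_inner_right V,
        ContinuousLinearMap.adjoint_inner_left]
      exact congrArg (inner ℂ x) (DFunLike.congr_fun h y)
    · refine ContinuousLinearMap.ext fun y => ext_inner_left ℂ fun x => ?_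
      have := h x y
      rw [← ContinuousLinearMap.adjoint_inner_right, ← ContinuousLinearMap.adjoint_inner_right V,
        ContinuousLinearMap.adjoint_inner_left] at this
      exact this
  rw [e]
  refine IsClosed.inter ?_ ?_
  · exact isClosed_iInter fun x => isClosed_iInter fun y =>
      isClosed_eq (ultraweak_continuous_inner _ _) (ultraweak_continuous_inner _ _)
  · exact isClosed_iInter fun x => isClosed_iInter fun y =>
      isClosed_eq (ultraweak_continuous_inner _ _) (ultraweak_continuous_inner _ _)

end Coinvariant

/-! ### Existence of integrated forms -/

section Existence

theorem ultraweak_continuous_compression {F G : Type u} [NormedAddCommGroup F]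
    [InnerProductSpace ℂ F] [CompleteSpace F] [NormedAddCommGroup G] [InnerProductSpace ℂ G]
    [CompleteSpace G] (V : G →L[ℂ] F) :
    Continuous[ultraweak F, ultraweak G] fun Z : F →L[ℂ] F =>
      ContinuousLinearMap.adjoint V ∘L Z ∘L V := by
  refine ultraweak_continuous_rng (ultraweak F) _ fun x y => ?_
  convert ultraweak_continuous_functional (diagOp (fun _ => V) ‖V‖ (fun _ => le_rfl) x)
    (diagOp (fun _ => V) ‖V‖ (fun _ => le_rfl) y) using 2 with Z
  refine tsum_congr fun n => ?_
  rw [ContinuousLinearMap.comp_apply, ContinuousLinearMap.adjoint_inner_right]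
  rfl

variable {H₀ : Type u} [NormedAddCommGroup H₀] [InnerProductSpace ℂ H₀] [CompleteSpace H₀]
  {M : VonNeumannAlgebra H₀} {E : Type u} [NormedAddCommGroup E] [NormedSpace ℂ E]
  [Correspondence (VNA M) E] {F G : Type u} [NormedAddCommGroup F] [InnerProductSpace ℂ F]
  [CompleteSpace F] [NormedAddCommGroup G] [InnerProductSpace ℂ G] [CompleteSpace G]

/-- The compression of an integrated form to a coinvariant subspace. -/
theorem IsIntegratedForm.exists_compression {τ₀ : VNA M → F →L[ℂ] F} {T₀ : E → F →L[ℂ] F}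
    {π : hardy M E →ₙₐ[ℂ] (F →L[ℂ] F)} (hπ : IsIntegratedForm M E τ₀ T₀ π)
    {τ : VNA M → G →L[ℂ] G} {T : E → G →L[ℂ] G} (V : G →L[ℂ] F)
    (hV : ContinuousLinearMap.adjoint V ∘L V = 1)
    (hτ : ∀ a, ContinuousLinearMap.adjoint V ∘L τ₀ a = τ a ∘L ContinuousLinearMap.adjoint V)
    (hT : ∀ ξ, ContinuousLinearMap.adjoint V ∘L T₀ ξ = T ξ ∘L ContinuousLinearMap.adjoint V) :
    ∃ π' : hardy M E →ₙₐ[ℂ] (G →L[ℂ] G), IsIntegratedForm M E τ T π' ∧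
      ∀ X, π' X = ContinuousLinearMap.adjoint V ∘L π X ∘L V := by
  -- For $Y=0$ the commutation condition is empty, which leaves coinvariance alone; that is what
  -- multiplicativity of the compression requires.
  have hmem : ∀ X, π X ∈ coinvariantSubalgebra V 0 :=
    hπ.mem_of_isClosed _ (isClosed_coinvariantSubalgebra V 0)
      (fun a => mem_coinvariantSubalgebra hV (hτ a) (by simp))
      (fun ξ => mem_coinvariantSubalgebra hV (hT ξ) (by simp))
  have hgen : ∀ (Z : F →L[ℂ] F) (Z' : G →L[ℂ] G),
      ContinuousLinearMap.adjoint V ∘L Z = Z' ∘L ContinuousLinearMap.adjoint V →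
      ContinuousLinearMap.adjoint V ∘L Z ∘L V = Z' := fun Z Z' h => by
    rw [← ContinuousLinearMap.comp_assoc, h, ContinuousLinearMap.comp_assoc, hV]; rfl
  have hmul : ∀ X Y, ContinuousLinearMap.adjoint V ∘L (π X * π Y) ∘L V =
      (ContinuousLinearMap.adjoint V ∘L π X ∘L V) * (ContinuousLinearMap.adjoint V ∘L π Y ∘L V) :=
    fun X Y => congrArg (· ∘L π Y ∘L V) (hmem X).1
  let π' : hardy M E →ₙₐ[ℂ] (G →L[ℂ] G) :=
    { toFun := fun X => ContinuousLinearMap.adjoint V ∘L π X ∘L V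
      map_smul' := fun c X => by
        rw [map_smul, ContinuousLinearMap.smul_comp, ContinuousLinearMap.comp_smul]; rfl
      map_zero' := by rw [map_zero]; simp
      map_add' := fun X Y => by
        rw [map_add, ContinuousLinearMap.add_comp, ContinuousLinearMap.comp_add]
      map_mul' := fun X Y => by
        rw [map_mul, hmul] }
  refine ⟨π', ⟨?_, fun a => ?_, fun ξ => ?_⟩, fun _ => rfl⟩
  · let _ := ultraweakHardy M E
    let _ := ultraweak F
    let _ := ultraweak G
    exact (ultraweak_continuous_compression V).comp hπ.continuous
  · exact (congrArg (fun Z => ContinuousLinearMap.adjoint V ∘L Z ∘L V) (hπ.map_act a)).trans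
      (hgen _ _ (hτ a))
  · exact (congrArg (fun Z => ContinuousLinearMap.adjoint V ∘L Z ∘L V) (hπ.map_creation ξ)).trans
      (hgen _ _ (hT ξ))

section
variable {I V : Type*} [NormedAddCommGroup V] [InnerProductSpace ℂ V]

theorem amplify_add (X Y : V →L[ℂ] V) : amplify I (X + Y) = amplify I X + amplify I Y := by
  ext v i : 3; rfl

theorem amplify_smul (c : ℂ) (X : V →L[ℂ] V) : amplify I (c • X) = c • amplify I X := by
  ext v i : 3; rfl

theorem amplify_mul (X Y : V →L[ℂ] V) : amplify I (X * Y) = amplify I X ∘L amplify I Y := by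
  ext v i : 3; rfl

theorem amplify_zero : amplify I (0 : V →L[ℂ] V) = 0 := by
  ext v i : 3; rfl

variable {G : Type*} [NormedAddCommGroup G] [InnerProductSpace ℂ G]

theorem amplify_comp_isometricColumn {W : I → G →L[ℂ] V}
    (hW : ∀ v, HasSum (fun i => ‖W i v‖ ^ 2) (‖v‖ ^ 2)) {X : V →L[ℂ] V} {Z : G →L[ℂ] G}
    (h : ∀ i, W i ∘L Z = X ∘L W i) :
    amplify I X ∘L isometricColumn W hW = isometricColumn W hW ∘L Z := by
  ext v i : 3
  exact (DFunLike.congr_fun (h i) v).symm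

theorem adjoint_comp_amplify_comp_isometricColumn [CompleteSpace G] [CompleteSpace V] {W : I → G →L[ℂ] V}
    (hW : ∀ v, HasSum (fun i => ‖W i v‖ ^ 2) (‖v‖ ^ 2)) {X : V →L[ℂ] V} {Z : G →L[ℂ] G}
    (h : ∀ i, W i ∘L Z = X ∘L W i) :
    ContinuousLinearMap.adjoint (isometricColumn W hW) ∘L amplify I X ∘L isometricColumn W hW =
      Z := by
  rw [amplify_comp_isometricColumn hW h, ← ContinuousLinearMap.comp_assoc,
    adjoint_isometricColumn_comp]
  rfl

end

/-- The operators whose amplification leaves the range of the isometry `C` invariant. -/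
def amplifyInvariant {I : Type*} {V G : Type u} [NormedAddCommGroup V] [InnerProductSpace ℂ V]
    [CompleteSpace V] [NormedAddCommGroup G] [InnerProductSpace ℂ G] [CompleteSpace G]
    (C : G →L[ℂ] lp (fun _ : I => V) 2) : NonUnitalSubalgebra ℂ (V →L[ℂ] V) where
  carrier := {X | amplify I X ∘L C = C ∘L ContinuousLinearMap.adjoint C ∘L amplify I X ∘L C}
  zero_mem' := by
    rw [Set.mem_ofPred_eq, amplify_zero]; simp
  add_mem' {X Y} hX hY := by
    rw [Set.mem_ofPred_eq] at hX hY ⊢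
    rw [amplify_add]
    simp only [ContinuousLinearMap.add_comp, ContinuousLinearMap.comp_add]
    rw [← hX, ← hY]
  smul_mem' c X hX := by
    rw [Set.mem_ofPred_eq] at hX ⊢
    rw [amplify_smul]
    simp only [ContinuousLinearMap.smul_comp, ContinuousLinearMap.comp_smul]
    rw [← hX]
  mul_mem' {X Y} hX hY := by
    rw [Set.mem_ofPred_eq] at hX hY ⊢
    have e : amplify I (X * Y) ∘L C =
        (amplify I X ∘L C) ∘L ContinuousLinearMap.adjoint C ∘L amplify I Y ∘L C := by
      rw [amplify_mul, ContinuousLinearMap.comp_assoc]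
      conv_lhs => rw [hY]
      simp only [ContinuousLinearMap.comp_assoc]
    rw [e]
    conv_lhs => rw [hX]
    simp only [ContinuousLinearMap.comp_assoc]

section
variable {I : Type*} {V G : Type u} [NormedAddCommGroup V] [InnerProductSpace ℂ V]
  [CompleteSpace V] [NormedAddCommGroup G] [InnerProductSpace ℂ G] [CompleteSpace G]

/-- Matrix coefficients of $\mathrm{diag}(X,X,\dots)$ are ultraweakly continuous in $X$ for any
index set, by `ultraweak_continuous_inner_lp`. -/
theorem isClosed_amplifyInvariant (C : G →L[ℂ] lp (fun _ : I => V) 2) :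
    IsClosed[ultraweak V] (amplifyInvariant C : Set (V →L[ℂ] V)) := by
  let _ := ultraweak V
  have e : (amplifyInvariant C : Set (V →L[ℂ] V)) = ⋂ (w : lp (fun _ : I => V) 2) (v : G),
      {X | inner ℂ w (amplify I X (C v)) =
        inner ℂ (C (ContinuousLinearMap.adjoint C w)) (amplify I X (C v))} := by
    ext X
    simp only [Set.mem_iInter, Set.mem_ofPred_eq]
    constructor
    · intro h w v
      rw [← ContinuousLinearMap.adjoint_inner_right, ContinuousLinearMap.adjoint_inner_left]
      exact congrArg (inner ℂ w) (DFunLike.congr_fun h v)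
    · intro h
      refine ContinuousLinearMap.ext fun v => ext_inner_left ℂ fun w => ?_
      have := h w v
      rw [← ContinuousLinearMap.adjoint_inner_right, ContinuousLinearMap.adjoint_inner_left] at this
      exact this
  rw [e]
  exact isClosed_iInter fun w => isClosed_iInter fun v => isClosed_eq
    (ultraweak_continuous_inner_lp w (C v)) (ultraweak_continuous_inner_lp _ (C v))

/-- The compression `X ↦ C* diag(X, X, …) C` is multiplicative on `amplifyInvariant C`. -/
def amplifyCompression (C : G →L[ℂ] lp (fun _ : I => V) 2) :
    amplifyInvariant C →ₙₐ[ℂ] (G →L[ℂ] G) where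
  toFun X := ContinuousLinearMap.adjoint C ∘L amplify I X.1 ∘L C
  map_smul' c X := by
    rw [NonUnitalSubalgebra.coe_smul, amplify_smul, ContinuousLinearMap.smul_comp,
      ContinuousLinearMap.comp_smul]
    rfl
  map_zero' := by
    rw [NonUnitalSubalgebra.coe_zero, amplify_zero]; simp
  map_add' X Y := by
    rw [NonUnitalSubalgebra.coe_add, amplify_add, ContinuousLinearMap.add_comp,
      ContinuousLinearMap.comp_add]
  map_mul' X Y := by
    have hY : amplify I Y.1 ∘L C =
        C ∘L ContinuousLinearMap.adjoint C ∘L amplify I Y.1 ∘L C := Y.2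
    rw [NonUnitalSubalgebra.coe_mul, amplify_mul, ContinuousLinearMap.mul_def,
      ContinuousLinearMap.comp_assoc]
    conv_lhs => rw [hY]
    simp only [ContinuousLinearMap.comp_assoc]

/-- The relations $W_iZ=XW_i$ combine to $\mathrm{diag}(X,X,\dots)C=CZ$ for the column $C$, so the
range of $C$ is invariant and the compression is $Z$. -/
theorem mem_amplifyInvariant {W : I → G →L[ℂ] V} (hW : ∀ v, HasSum (fun i => ‖W i v‖ ^ 2) (‖v‖ ^ 2))
    {X : V →L[ℂ] V} {Z : G →L[ℂ] G} (h : ∀ i, W i ∘L Z = X ∘L W i) :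
    X ∈ amplifyInvariant (isometricColumn W hW) := by
  change amplify I X ∘L isometricColumn W hW = isometricColumn W hW ∘L
    ContinuousLinearMap.adjoint (isometricColumn W hW) ∘L amplify I X ∘L isometricColumn W hW
  rw [adjoint_comp_amplify_comp_isometricColumn hW h, amplify_comp_isometricColumn hW h]

end

/-- An integrated form exists for every pair that embeds isometrically into an amplification of
the identity pair. -/
theorem exists_isIntegratedForm_of_hasSum {τ : VNA M → G →L[ℂ] G} {T : E → G →L[ℂ] G}
    {I : Type*} (W : I → G →L[ℂ] (idRep M).fock E)
    (hW : ∀ v, HasSum (fun i => ‖W i v‖ ^ 2) (‖v‖ ^ 2))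
    (hτ : ∀ i a, W i ∘L τ a = fockAct E (idRep M) a ∘L W i)
    (hT : ∀ i ξ, W i ∘L T ξ = creation (idRep M) ξ ∘L W i) :
    ∃ π, IsIntegratedForm M E τ T π := by
  set C := isometricColumn W hW with hC
  -- Invariance extends from the generators to the whole Hardy algebra, and there
  -- `amplifyCompression` is a homomorphism.
  have hle : hardy M E ≤ amplifyInvariant C := hardy_le (isClosed_amplifyInvariant C)
    (fun a => mem_amplifyInvariant hW fun i => hτ i a)
    (fun ξ => mem_amplifyInvariant hW fun i => hT i ξ)
  refine ⟨(amplifyCompression C).comp (NonUnitalSubalgebra.inclusion hle), ?_, fun a => ?_,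
    fun ξ => ?_⟩
  · let _ := ultraweakHardy M E
    let _ := ultraweak ((idRep M).fock E)
    let _ := ultraweak G
    exact (ultraweak_continuous_amplify C C).comp continuous_hardy_val
  · exact adjoint_comp_amplify_comp_isometricColumn hW fun i => hτ i a
  · exact adjoint_comp_amplify_comp_isometricColumn hW fun i => hT i ξ

/-- The induced representation `X ↦ X ⊗ I_H` exists for every normal representation. -/
theorem IsNormal.exists_inducedRep {H : Type u} [NormedAddCommGroup H] [InnerProductSpace ℂ H]
    [CompleteSpace H] {σ : VNA M →⋆ₐ[ℂ] (H →L[ℂ] H)} (hσ : IsNormal M σ) :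
    ∃ π, IsIntegratedForm M E (fockAct E (repOf σ)) (creation (repOf σ)) π := by
  obtain ⟨I, W, hW⟩ := hσ.exists_hasSum_hom
  exact exists_isIntegratedForm_of_hasSum (fun i => idTensorFock E (W i)) (hasSum_idTensorFock hW)
    (fun i a => idTensorFock_comp_fockAct (W i) a) fun i ξ => idTensorFock_comp_creation (W i) ξ

end Existence

/-! ### The Poisson kernel as an isometry with coinvariant range -/

section Poisson
open Tensor Correspondence
variable {A : Type u} [CStarAlgebra A] {E : Type u} [NormedAddCommGroup E] [NormedSpace ℂ E]
  [Correspondence A E] {K : Rep A}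

theorem cauchyCoeff_mem (η : Dual E K) (n : ℕ) : cauchyCoeff η n ∈ K.Hom (K.tower E n) := by
  induction n with
  | zero => exact id_mem K
  | succ n ih => exact comp_mem (dualPow η n).2 ih

/-- The leftmost factor of $\eta^{(n+1)}h$ is produced by the first application of $\eta$; later
applications act to its right. Annihilation by $\xi$ therefore passes through them and meets only
that first $\eta$. -/
theorem adjoint_creationAt_comp_cauchyCoeff (η : Dual E K) (ξ : E) (n : ℕ) :
    ContinuousLinearMap.adjoint (creationAt (K.tower E n) ξ) ∘L cauchyCoeff η (n + 1) =
      cauchyCoeff η n ∘L ContinuousLinearMap.adjoint (creationAt K ξ) ∘L η.1 := by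
  induction n with
  | zero => rfl
  | succ n ih =>
    change (ContinuousLinearMap.adjoint (creationAt (K.tower E (n + 1)) ξ) ∘L
      (idTensor E (dualPow η n)).1) ∘L cauchyCoeff η (n + 1) = _
    refine (congrArg (· ∘L cauchyCoeff η (n + 1))
      (adjoint_creationAt_comp_idTensor (dualPow η n) ξ)).trans ?_
    exact congrArg ((dualPow η n).1 ∘L ·) ih

theorem adjoint_dualHat (η : Dual E K) (ξ : E) :
    ContinuousLinearMap.adjoint (dualHat η ξ) =
      ContinuousLinearMap.adjoint (creationAt K ξ) ∘L η.1 := by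
  refine (ContinuousLinearMap.adjoint_comp _ _).trans ?_
  exact congrArg _ (ContinuousLinearMap.adjoint_adjoint _)

theorem adjoint_commHom_defect (η : Dual E K) :
    ContinuousLinearMap.adjoint (commHom (defect η)).1 = (commHom (defect η)).1 :=
  IsSelfAdjoint.of_nonneg (CFC.sqrt_nonneg
    (ContinuousLinearMap.id ℂ K.carrier - ContinuousLinearMap.adjoint η.1 ∘L η.1))

/-- `CFC.sqrt` is a genuine square root only on positive operators, and $\|\eta\|<1$ ensures
$\eta^*\eta\le I$. -/
theorem commHom_defect_comp_self (η : Dual E K) (hη : ‖η‖ < 1) :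
    (commHom (defect η)).1 ∘L (commHom (defect η)).1 =
      ContinuousLinearMap.id ℂ K.carrier - ContinuousLinearMap.adjoint η.1 ∘L η.1 := by
  refine CFC.sqrt_mul_sqrt_self _ (sub_nonneg.mpr ?_)
  have hpos : 0 ≤ ContinuousLinearMap.adjoint η.1 ∘L η.1 := by
    rw [ContinuousLinearMap.nonneg_iff_isPositive]
    exact ContinuousLinearMap.isPositive_adjoint_comp_self η.1
  refine (CStarAlgebra.norm_le_one_iff_of_nonneg _ hpos).mp ?_
  rw [ContinuousLinearMap.norm_adjoint_comp_self]
  have : ‖η.1‖ < 1 := hη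
  nlinarith [norm_nonneg η.1]

/-- The identity $\Delta_*(\eta)^2+\eta^*\eta=I$ is tensored with $I_{E^{\otimes n}}$, where
$I\otimes\eta^*\eta=(I\otimes\eta)^*(I\otimes\eta)$ by `adjoint_dualPow`. With $x=\eta^{(n)}h$ the
right side becomes a telescoping difference. -/
theorem norm_sq_idTensorPow_defect (η : Dual E K) (hη : ‖η‖ < 1) (n : ℕ)
    (x : (K.tower E n).carrier) :
    ‖(idTensorPow E (commHom (defect η)) n).1 x‖ ^ 2 = ‖x‖ ^ 2 - ‖(dualPow η n).1 x‖ ^ 2 := by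
  set D := commHom (defect η) with hD
  have h1 : (⟨ContinuousLinearMap.adjoint D.1 ∘L D.1, comp_mem (adjoint_mem D.2) D.2⟩ : K.Hom K) +
      commHom (inn η η : VNA K.commutant) = ⟨ContinuousLinearMap.id ℂ K.carrier, id_mem K⟩ :=
    Subtype.ext <| by
      change ContinuousLinearMap.adjoint D.1 ∘L D.1 + ContinuousLinearMap.adjoint η.1 ∘L η.1 =
        ContinuousLinearMap.id ℂ K.carrier
      rw [hD, adjoint_commHom_defect, commHom_defect_comp_self η hη, sub_add_cancel]
  have h2 := congrArg (fun T => (idTensorPow E T n).1) h1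
  simp only [idTensorPow_add, idTensorPow_id] at h2
  rw [idTensorPow_comp ⟨ContinuousLinearMap.adjoint D.1, adjoint_mem D.2⟩ D,
    idTensorPow_adjoint] at h2
  change ContinuousLinearMap.adjoint (idTensorPow E D n).1 ∘L (idTensorPow E D n).1 +
    (idTensorPow E (commHom (inn η η : VNA K.commutant)) n).1 = ContinuousLinearMap.id ℂ _ at h2
  rw [← adjoint_dualPow] at h2
  have h3 := congrArg (fun T => RCLike.re (inner ℂ x (T x))) h2
  simp only [add_apply, ContinuousLinearMap.comp_apply, inner_add_right,
    ContinuousLinearMap.adjoint_inner_right, ContinuousLinearMap.id_apply, map_add,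
    ← norm_sq_eq_re_inner] at h3
  linarith

/-- The partial sums telescope to $\|h\|^2-\|\eta^{(n)}h\|^2$, and
$\|\eta^{(n)}h\|\le\|\eta\|^n\|h\|$ tends to zero. -/
theorem norm_poissonKernel (η : Dual E K) (hη : ‖η‖ < 1) (h : K.carrier) :
    ‖poissonKernel η hη h‖ = ‖h‖ := by
  refine (sq_eq_sq₀ (norm_nonneg _) (norm_nonneg _)).mp ?_
  refine (lp_two_hasSum (poissonKernel η hη h)).unique ?_
  rw [hasSum_iff_tendsto_nat_of_nonneg fun _ => by positivity]
  have hstep : ∀ n, ‖poissonKernel η hη h n‖ ^ 2 =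
      ‖cauchyCoeff η n h‖ ^ 2 - ‖cauchyCoeff η (n + 1) h‖ ^ 2 := fun n =>
    norm_sq_idTensorPow_defect η hη n _
  simp only [hstep, Finset.sum_range_sub']
  have hlim : Filter.Tendsto (fun n => ‖cauchyCoeff η n h‖ ^ 2) Filter.atTop (𝓝 0) := by
    have h1 : Filter.Tendsto (fun n => (‖η‖ ^ n * ‖h‖) ^ 2) Filter.atTop (𝓝 ((0 * ‖h‖) ^ 2)) :=
      ((tendsto_pow_atTop_nhds_zero_of_lt_one (norm_nonneg _) hη).mul_const _).pow 2
    rw [zero_mul, zero_pow two_ne_zero] at h1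
    refine squeeze_zero (fun n => by positivity) (fun n => ?_) h1
    exact pow_le_pow_left₀ (norm_nonneg _)
      ((cauchyCoeff η n).le_of_opNorm_le (norm_cauchyCoeff_le η n) h) 2
  have h2 := (tendsto_const_nhds (x := ‖cauchyCoeff η 0 h‖ ^ 2)).sub hlim
  rw [sub_zero] at h2
  exact h2

theorem adjoint_poissonKernel_comp_self (η : Dual E K) (hη : ‖η‖ < 1) :
    ContinuousLinearMap.adjoint (poissonKernel η hη) ∘L poissonKernel η hη = 1 :=
  (ContinuousLinearMap.norm_map_iff_adjoint_comp_self _).mp (norm_poissonKernel η hη)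

theorem fockAct_comp_poissonKernel (η : Dual E K) (hη : ‖η‖ < 1) (a : A) :
    fockAct E K a ∘L poissonKernel η hη = poissonKernel η hη ∘L K.rep a := by
  ext h n
  exact (Rep.hom_apply ⟨_, comp_mem (idTensorPow E (commHom (defect η)) n).2
    (cauchyCoeff_mem η n)⟩ a h).symm

/-- At each level, annihilation by $\xi$ passes first through $I\otimes\Delta_*(\eta)$ and then
through $\eta^{(n+1)}$, leaving $\widehat{\eta^*}(\xi)^*$ next to $h$. Its adjoint is the
coinvariance relation for creation operators. -/
theorem adjoint_creation_comp_poissonKernel (η : Dual E K) (hη : ‖η‖ < 1) (ξ : E) :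
    ContinuousLinearMap.adjoint (creation K ξ) ∘L poissonKernel η hη =
      poissonKernel η hη ∘L ContinuousLinearMap.adjoint (dualHat η ξ) := by
  ext h n
  refine (adjoint_creation_apply K ξ _ n).trans ?_
  rw [adjoint_dualHat]
  have h1 := DFunLike.congr_fun
    (adjoint_creationAt_comp_idTensor (idTensorPow E (commHom (defect η)) n) ξ)
    (cauchyCoeff η (n + 1) h)
  refine h1.trans ?_
  exact congrArg (idTensorPow E (commHom (defect η)) n).1
    (DFunLike.congr_fun (adjoint_creationAt_comp_cauchyCoeff η ξ n) h)

theorem adjoint_poissonKernel_comp_fockAct (η : Dual E K) (hη : ‖η‖ < 1) (a : A) :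
    ContinuousLinearMap.adjoint (poissonKernel η hη) ∘L fockAct E K a =
      K.rep a ∘L ContinuousLinearMap.adjoint (poissonKernel η hη) := by
  have h := congrArg ContinuousLinearMap.adjoint (fockAct_comp_poissonKernel η hη (star a))
  rw [ContinuousLinearMap.adjoint_comp, ContinuousLinearMap.adjoint_comp, fockAct_adjoint,
    K.adjoint_rep, star_star] at h
  exact h

theorem adjoint_poissonKernel_comp_creation (η : Dual E K) (hη : ‖η‖ < 1) (ξ : E) :
    ContinuousLinearMap.adjoint (poissonKernel η hη) ∘L creation K ξ =
      dualHat η ξ ∘L ContinuousLinearMap.adjoint (poissonKernel η hη) := by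
  have h := congrArg ContinuousLinearMap.adjoint (adjoint_creation_comp_poissonKernel η hη ξ)
  rw [ContinuousLinearMap.adjoint_comp, ContinuousLinearMap.adjoint_comp,
    ContinuousLinearMap.adjoint_adjoint, ContinuousLinearMap.adjoint_adjoint] at h
  exact h

end Poisson

/-! ### The resolvent of a creation operator in the Hardy algebra -/

section Resolvent
variable {H₀ : Type u} [NormedAddCommGroup H₀] [InnerProductSpace ℂ H₀] [CompleteSpace H₀]
  {M : VonNeumannAlgebra H₀} {E : Type u} [NormedAddCommGroup E] [NormedSpace ℂ E]
  [Correspondence (VNA M) E]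

/-- Each defining functional is bounded by $\|x\|\,\|y\|\,\|T\|$. Thus ultraweakly closed algebras
are norm closed and contain the sums of their Neumann series. -/
theorem continuous_norm_ultraweak {K : Type u} [NormedAddCommGroup K] [InnerProductSpace ℂ K] :
    Continuous[inferInstance, ultraweak K] (id : (K →L[ℂ] K) → (K →L[ℂ] K)) := by
  refine ultraweak_continuous_rng _ _ fun x y => ?_
  let f : (K →L[ℂ] K) →ₗ[ℂ] ℂ :=
    { toFun := fun T => ∑' n, inner ℂ (x n) (T (y n))
      map_add' := fun S T => by
        rw [← (ultraweak_summable x y S).tsum_add (ultraweak_summable x y T)]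
        simp
      map_smul' := fun c T => by
        rw [RingHom.id_apply, smul_eq_mul, ← tsum_mul_left]
        simp }
  refine (f.mkContinuous (‖x‖ * ‖y‖) fun T => ?_).continuous
  have : f T = inner ℂ x (diagOp (fun _ => T) ‖T‖ (fun _ => le_rfl) y) := rfl
  rw [this]
  calc _ ≤ ‖x‖ * ‖diagOp (fun _ => T) ‖T‖ (fun _ => le_rfl) y‖ := norm_inner_le_norm _ _
    _ ≤ ‖x‖ * (‖T‖ * ‖y‖) := by
      gcongr
      exact ContinuousLinearMap.le_of_opNorm_le _
        (LinearMap.mkContinuous_norm_le _ (norm_nonneg _) _) y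
    _ = _ := by ring

theorem isClosed_hardy : IsClosed (hardy M E : Set ((idRep M).fock E →L[ℂ] (idRep M).fock E)) := by
  have h : IsClosed[ultraweak _] (hardy M E : Set ((idRep M).fock E →L[ℂ] (idRep M).fock E)) := by
    let _ := ultraweak ((idRep M).fock E)
    exact isClosed_closure
  exact @IsClosed.preimage _ _ _ (ultraweak _) _ continuous_norm_ultraweak _ h

/-- `hardy` is generated without adjoining a unit, so the identity is obtained as
$\varphi_\infty(1)$. On positive levels this operator acts on the first factor only, whence the
condition on the left action. -/
theorem fockAct_one (h1 : ∀ ξ : E, Correspondence.lact (1 : VNA M) ξ = ξ) :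
    fockAct E (idRep M) 1 = 1 := by
  ext v n
  cases n with
  | zero => exact DFunLike.congr_fun (map_one (VNA.val M)) (v 0)
  | succ n =>
    have : ((idRep M).tower E (n + 1)).rep 1 = ContinuousLinearMap.id ℂ _ :=
      Tensor.ext_clm fun x k => (Tensor.left_tmul _ _ x k).trans (by rw [h1]; rfl)
    exact DFunLike.congr_fun this (v (n + 1))

/-- If the left action is unital and `‖ξ‖ < 1`, then `I - T_ξ` is invertible in the Hardy algebra. -/
theorem exists_hardy_inverse (h1 : ∀ ξ : E, Correspondence.lact (1 : VNA M) ξ = ξ) {ξ : E}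
    (hξ : ‖ξ‖ < 1) : ∃ R : hardy M E, (1 - creation (idRep M) ξ) * R.1 = 1 ∧
      R.1 * (1 - creation (idRep M) ξ) = 1 := by
  set T := creation (idRep M) ξ with hT
  have hn : ‖T‖ < 1 := (norm_creation_le _ _).trans_lt hξ
  have hpow : ∀ n, T ^ n ∈ hardy M E := fun n => by
    induction n with
    | zero => rw [pow_zero, ← fockAct_one h1]; exact (hardyAct M E 1).2
    | succ n ih => rw [pow_succ]; exact mul_mem ih (hardyCreation M ξ).2
  have hs : Summable fun n => T ^ n := summable_geometric_of_norm_lt_one hn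
  have hmem : ∑' n, T ^ n ∈ hardy M E :=
    isClosed_hardy.mem_of_tendsto hs.hasSum.tendsto_sum_nat
      (Filter.Eventually.of_forall fun n => sum_mem fun i _ => hpow i)
  exact ⟨⟨_, hmem⟩, mul_neg_geom_series T hn, geom_series_mul_neg T hn⟩

end Resolvent

/-! ### The Fourier transform between the two Fock spaces -/

section Fourier
open Tensor Correspondence
variable {A : Type u} [CStarAlgebra A] {E : Type u} [NormedAddCommGroup E] [NormedSpace ℂ E]
  [Correspondence A E] {K : Rep A}

/-- The commutant acts through $I_E\otimes c$, so its action is unital whether or not $A$ acts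
unitally on $E$. -/
theorem Dual.lact_one (η : Dual E K) : lact (1 : VNA K.commutant) η = η :=
  Subtype.ext <| (congrArg (· ∘L η.1) (idTensor_id (E := E) K)).trans
    (ContinuousLinearMap.id_comp _)

theorem adjoint_fourier_comp_self :
    ContinuousLinearMap.adjoint (fourier E K) ∘L fourier E K = 1 := by
  refine (ContinuousLinearMap.norm_map_iff_adjoint_comp_self _).mp fun v => ?_
  refine (sq_eq_sq₀ (norm_nonneg _) (norm_nonneg _)).mp ?_
  rw [norm_sq_eq_re_inner (𝕜 := ℂ), norm_sq_eq_re_inner (𝕜 := ℂ), lp.inner_eq_tsum,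
    lp.inner_eq_tsum]
  exact congrArg _ (tsum_congr fun n => (fourierLevel E K n).2.1 _ _)

theorem fourier_comp_fockAct (c : VNA K.commutant) :
    fourier E K ∘L fockAct (Dual E K) (idRep K.commutant) c =
      idTensorFock E (commHom c) ∘L fourier E K := by
  ext v n
  exact (fourierLevel E K n).2.2 c (v n)

theorem vacuum_zero (K : Rep A) (h : K.carrier) : vacuum E K h 0 = h :=
  lp.single_apply_self (E := fun n => (K.tower E n).carrier) 2 0 h

theorem vacuum_succ (K : Rep A) (h : K.carrier) (n : ℕ) : vacuum E K h (n + 1) = 0 :=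
  lp.single_apply_ne (E := fun n => (K.tower E n).carrier) 2 0 h (Nat.succ_ne_zero n)

theorem fourier_comp_vacuum :
    fourier E K ∘L vacuum (Dual E K) (idRep K.commutant) = vacuum E K := by
  ext h n
  cases n with
  | zero => exact (vacuum_zero (E := Dual E K) (idRep K.commutant) h).trans (vacuum_zero K h).symm
  | succ n =>
    refine (congrArg (fourierLevel E K (n + 1)).1
      (vacuum_succ (E := Dual E K) (idRep K.commutant) h n)).trans ?_
    exact (map_zero _).trans (vacuum_succ K h n).symm

theorem adjoint_fourier_comp_vacuum :
    ContinuousLinearMap.adjoint (fourier E K) ∘L vacuum E K =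
      vacuum (Dual E K) (idRep K.commutant) := by
  refine (congrArg (fun T => ContinuousLinearMap.adjoint (fourier E K) ∘L T)
    fourier_comp_vacuum.symm).trans ?_
  exact congrArg (fun T => T ∘L vacuum (Dual E K) (idRep K.commutant)) adjoint_fourier_comp_self

/-- The Fourier transform of a fixed point of `v = h + T_η v` is the Cauchy kernel. -/
theorem fourierLevel_eq_cauchyCoeff (η : Dual E K) (h : K.carrier)
    (w : (idRep K.commutant).fock (Dual E K))
    (hw : w - creation (idRep K.commutant) η w = vacuum (Dual E K) (idRep K.commutant) h) (n : ℕ) :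
    (fourierLevel E K n).1 (w n) = cauchyCoeff η n h := by
  -- Read level by level, the equation says $w_0=h$ and $w_{n+1}=\eta\otimes w_n$, which $U$ turns
  -- into the recursion of the generalized powers $\eta^{(n)}h$.
  have hw' : w = vacuum (Dual E K) (idRep K.commutant) h + creation (idRep K.commutant) η w := by
    rw [← hw, sub_add_cancel]
  induction n with
  | zero =>
    have h0 := congrArg (fun z : (idRep K.commutant).fock (Dual E K) => z 0) hw'
    exact h0.trans ((congrArg (· + (0 : K.carrier))
      (vacuum_zero (E := Dual E K) (idRep K.commutant) h)).trans (add_zero _))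
  | succ n ih =>
    have h1 : w (n + 1) = tmul _ η (w n) := by
      have h0 := congrArg (fun z : (idRep K.commutant).fock (Dual E K) => z (n + 1)) hw'
      exact h0.trans ((congrArg (· + _)
        (vacuum_succ (E := Dual E K) (idRep K.commutant) h n)).trans (zero_add _))
    rw [h1, fourierLevel_succ_tmul, ih]
    rfl

/-- $U$ carries $\varphi_\infty(\Delta_*(\eta))$ to $I\otimes\Delta_*(\eta)$ and fixes the zeroth
summand. The vector $Rh$ satisfies $(I-T_\eta)Rh=h$, so its transform is $C(\eta)h$. Only a right
inverse is used. -/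
theorem poissonKernel_eq (η : Dual E K) (hη : ‖η‖ < 1)
    (R : hardy K.commutant (Dual E K)) (hR : (1 - creation (idRep K.commutant) η) * R.1 = 1) :
    poissonKernel η hη = rho E K (hardyAct _ _ (defect η) * R) ∘L vacuum E K := by
  have e : rho E K (hardyAct _ _ (defect η) * R) ∘L vacuum E K =
      idTensorFock E (commHom (defect η)) ∘L fourier E K ∘L R.1 ∘L
        vacuum (Dual E K) (idRep K.commutant) := by
    rw [← adjoint_fourier_comp_vacuum, ← ContinuousLinearMap.comp_assoc _ (fourier E K),
      ← fourier_comp_fockAct]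
    rfl
  rw [e]
  ext h n
  refine congrArg (idTensorPow E (commHom (defect η)) n).1 ?_
  refine (fourierLevel_eq_cauchyCoeff η h _ ?_ n).symm
  exact DFunLike.congr_fun hR (vacuum (Dual E K) (idRep K.commutant) h)

/-- The operator `σ(a)`, as an intertwiner of the identity representation of the commutant. -/
def bicommHom (K : Rep A) (a : A) : (idRep K.commutant).Hom (idRep K.commutant) :=
  ⟨K.rep a, fun c => (mem_commutant_iff.mp c.val_mem a).symm⟩

/-- Each $I\otimes\eta$ intertwines the actions of $A$ by the defining relation of $E^\sigma$. Hence
$a$, acting at the left end of $E^{\otimes n}\otimes H$, corresponds to $\sigma(a)$ acting at the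
right end of $(E^\sigma)^{\otimes n}\otimes H$. -/
theorem fourierLevel_bicommHom (a : A) (n : ℕ) :
    (fourierLevel E K n).1 ∘L (idTensorPow (Dual E K) (bicommHom K a) n).1 =
      (K.tower E n).rep a ∘L (fourierLevel E K n).1 := by
  induction n with
  | zero => rfl
  | succ n ih =>
    refine ext_clm fun η v => ?_
    have e1 := idTensor_tmul (E := Dual E K) (idTensorPow (Dual E K) (bicommHom K a) n) η v
    refine (congrArg (fourierLevel E K (n + 1)).1 e1).trans ?_
    rw [fourierLevel_succ_tmul]
    refine (congrArg (dualPow η n).1 (DFunLike.congr_fun ih v)).trans ?_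
    refine (Rep.hom_apply (dualPow η n) a _).trans ?_
    exact congrArg _ (fourierLevel_succ_tmul K n η v).symm

theorem fourier_comp_idTensorFock (a : A) :
    fourier E K ∘L idTensorFock (Dual E K) (bicommHom K a) = fockAct E K a ∘L fourier E K := by
  ext v n
  exact DFunLike.congr_fun (fourierLevel_bicommHom a n) (v n)

theorem adjoint_fourier_comp_fockAct (a : A) :
    ContinuousLinearMap.adjoint (fourier E K) ∘L fockAct E K a =
      idTensorFock (Dual E K) (bicommHom K a) ∘L ContinuousLinearMap.adjoint (fourier E K) := by
  have h := congrArg ContinuousLinearMap.adjoint (fourier_comp_idTensorFock (E := E) (K := K) (star a))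
  rw [ContinuousLinearMap.adjoint_comp, ContinuousLinearMap.adjoint_comp, fockAct_adjoint,
    idTensorFock_adjoint, star_star] at h
  rw [← h]
  congr 2
  refine Subtype.ext ?_
  change ContinuousLinearMap.adjoint (K.rep (star a)) = K.rep a
  rw [K.adjoint_rep, star_star]

/-- $U$ may fail to be onto, so its intertwining relation cannot simply be inverted; it is dualized,
using the relation for $c^*$. This is what makes `bidual` well defined. -/
theorem adjoint_fourierLevel_rep (c : VNA K.commutant) (n : ℕ) (v : (K.tower E n).carrier) :
    ContinuousLinearMap.adjoint (fourierLevel E K n).1 ((idTensorPow E (commHom c) n).1 v) =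
      ((idRep K.commutant).tower (Dual E K) n).rep c
        (ContinuousLinearMap.adjoint (fourierLevel E K n).1 v) := by
  refine ext_inner_right ℂ fun w => ?_
  rw [Rep.inner_rep_left, ContinuousLinearMap.adjoint_inner_left,
    ContinuousLinearMap.adjoint_inner_left, (fourierLevel E K n).2.2]
  have e : idTensorPow E (commHom (star c)) n =
      ⟨ContinuousLinearMap.adjoint (idTensorPow E (commHom c) n).1,
        adjoint_mem (idTensorPow E (commHom c) n).2⟩ := by
    rw [← idTensorPow_adjoint]
    congr 1
  rw [e, ContinuousLinearMap.adjoint_inner_right]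

theorem adjoint_fourierLevel_comp_creationAt_mem (ξ : E) :
    ContinuousLinearMap.adjoint (fourierLevel E K 1).1 ∘L creationAt K ξ ∈
      (idRep K.commutant).Hom ((idRep K.commutant).tensor (Dual E K)) := fun c =>
  ContinuousLinearMap.ext fun h => by
    have h1 : (idTensorPow E (commHom c) 1).1 (creationAt K ξ h) =
        creationAt K ξ (VNA.val _ c h) := idTensor_tmul (commHom c) ξ h
    have h2 := adjoint_fourierLevel_rep c 1 (creationAt K ξ h)
    exact (congrArg (ContinuousLinearMap.adjoint (fourierLevel E K 1).1) h1.symm).trans h2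

/-- The element of the second dual defined by `ξ ∈ E`. -/
def bidual (K : Rep A) (ξ : E) : Dual (Dual E K) (idRep K.commutant) :=
  .mk _ (adjoint_fourierLevel_comp_creationAt_mem ξ)

/-- $U$ reverses the order of the factors: the leftmost $E$-factor of
$U(\eta_1\otimes\cdots\otimes\eta_n\otimes h)$ comes from $\eta_n$, next to $h$. So annihilation at
the left end of $F(E)\otimes H$ becomes annihilation at the right end of $F(E^\sigma)\otimes H$.
Level zero is the definition of `bidual`, and the induction carries one more left factor $\eta$
along. -/
theorem adjoint_creationAt_comp_fourierLevel (ξ : E) (n : ℕ) :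
    ContinuousLinearMap.adjoint (creationAt (K.tower E n) ξ) ∘L (fourierLevel E K (n + 1)).1 =
      (fourierLevel E K n).1 ∘L ContinuousLinearMap.adjoint (dualPow (bidual K ξ) n).1 := by
  induction n with
  | zero =>
    change _ = ContinuousLinearMap.adjoint
      (ContinuousLinearMap.adjoint (fourierLevel E K 1).1 ∘L creationAt K ξ)
    refine Eq.trans ?_ (ContinuousLinearMap.adjoint_comp _ _).symm
    exact congrArg _ (ContinuousLinearMap.adjoint_adjoint _).symm
  | succ n ih =>
    refine ext_clm fun η v => ?_
    refine (congrArg (ContinuousLinearMap.adjoint (creationAt (K.tower E (n + 1)) ξ))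
      (fourierLevel_succ_tmul K (n + 1) η v)).trans ?_
    refine (DFunLike.congr_fun (adjoint_creationAt_comp_idTensor (dualPow η n) ξ)
      ((fourierLevel E K (n + 1)).1 v)).trans ?_
    refine (congrArg (dualPow η n).1 (DFunLike.congr_fun ih v)).trans ?_
    have e1 : ContinuousLinearMap.adjoint (dualPow (bidual K ξ) (n + 1)).1 (tmul _ η v) =
        tmul _ η (ContinuousLinearMap.adjoint (dualPow (bidual K ξ) n).1 v) := by
      refine (DFunLike.congr_fun (idTensor_adjoint (E := Dual E K) (dualPow (bidual K ξ) n))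
        (tmul _ η v)).symm.trans ?_
      exact idTensor_tmul _ η v
    refine Eq.trans ?_ (congrArg (fourierLevel E K (n + 1)).1 e1).symm
    exact (fourierLevel_succ_tmul K n η _).symm

/-- The operator `η₁ ⊗ ⋯ ⊗ ηₙ ⊗ h ↦ η₁ ⊗ ⋯ ⊗ ηₙ ⊗ ζ h`. -/
def rightCreation {K : Rep A} (ζ : Dual E K) : K.fock E →L[ℂ] K.fock E :=
  shiftOp (G := fun n => (K.tower E n).carrier) (fun n => (dualPow ζ n).1) ‖ζ‖ (norm_dualPow_le ζ)

/-- The two operators act at opposite ends of a tensor. This commutation is behind the last formula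
for the point evaluation. -/
theorem rightCreation_comp_creation (ζ : Dual E K) (ξ : E) :
    rightCreation ζ ∘L creation K ξ = creation K ξ ∘L rightCreation ζ := by
  ext v n
  rcases n with _ | _ | n
  · rfl
  · exact (map_zero _).trans (map_zero (creationAt (K.tower E 0) ξ)).symm
  · exact idTensor_tmul (dualPow ζ n) ξ (v n)

theorem rightCreation_comp_fockAct (ζ : Dual E K) (a : A) :
    rightCreation ζ ∘L fockAct E K a = fockAct E K a ∘L rightCreation ζ := by
  ext v n
  cases n with
  | zero => exact (map_zero (K.rep a)).symm
  | succ n => exact Rep.hom_apply (dualPow ζ n) a (v n)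

/-- Adjoint form of `adjoint_creationAt_comp_fourierLevel`, assembled over all levels; at level zero
both sides vanish. -/
theorem adjoint_fourier_comp_creation (ξ : E) :
    ContinuousLinearMap.adjoint (fourier E K) ∘L creation K ξ =
      rightCreation (bidual K ξ) ∘L ContinuousLinearMap.adjoint (fourier E K) := by
  have hU := adjoint_diagOp_apply (G := fun n => ((idRep K.commutant).tower (Dual E K) n).carrier)
    (G' := fun n => (K.tower E n).carrier) (fun n => (fourierLevel E K n).1) 1
    (norm_fourierLevel_le K)
  ext v n
  refine (hU (creation K ξ v) n).trans ?_
  cases n with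
  | zero => exact map_zero _
  | succ n =>
    have h : ContinuousLinearMap.adjoint (fourierLevel E K (n + 1)).1 ∘L
        creationAt (K.tower E n) ξ = (dualPow (bidual K ξ) n).1 ∘L
          ContinuousLinearMap.adjoint (fourierLevel E K n).1 :=
      ((ContinuousLinearMap.adjoint_comp _ _).trans
        (congrArg (ContinuousLinearMap.adjoint (fourierLevel E K (n + 1)).1 ∘L ·)
          (ContinuousLinearMap.adjoint_adjoint _))).symm.trans
      ((congrArg ContinuousLinearMap.adjoint (adjoint_creationAt_comp_fourierLevel ξ n)).trans
        ((ContinuousLinearMap.adjoint_comp _ _).trans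
          (congrArg (· ∘L ContinuousLinearMap.adjoint (fourierLevel E K n).1)
            (ContinuousLinearMap.adjoint_adjoint _))))
    refine (DFunLike.congr_fun h (v n)).trans ?_
    exact congrArg (dualPow (bidual K ξ) n).1 (hU v n).symm

theorem rho_hardyAct_mul (c : VNA K.commutant) (R : hardy K.commutant (Dual E K)) :
    rho E K (hardyAct _ _ c * R) = idTensorFock E (commHom c) ∘L rho E K R := by
  change (fourier E K ∘L fockAct (Dual E K) (idRep K.commutant) c) ∘L R.1 ∘L
    ContinuousLinearMap.adjoint (fourier E K) = _
  rw [fourier_comp_fockAct]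
  rfl

/-- $\rho(\Delta_*(\eta)R)=(I\otimes\Delta_*(\eta))\rho(R)$ and $\Delta_*(\eta)$ is self-adjoint, so
the two defect factors merge into $\Delta_*(\eta)^2$. -/
theorem adjoint_rho_comp_rho_defect (η : Dual E K) (R : hardy K.commutant (Dual E K)) :
    ContinuousLinearMap.adjoint (rho E K (hardyAct _ _ (defect η) * R)) ∘L
        rho E K (hardyAct _ _ (defect η) * R) =
      ContinuousLinearMap.adjoint (rho E K R) ∘L idTensorFock E (commHom (defect η ^ 2)) ∘L
        rho E K R := by
  have e : commHom (defect η ^ 2) =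
      ⟨ContinuousLinearMap.adjoint (commHom (defect η)).1 ∘L (commHom (defect η)).1,
        comp_mem (adjoint_mem (commHom (defect η)).2) (commHom (defect η)).2⟩ := by
    refine Subtype.ext ((map_pow (VNA.val K.commutant) (defect η) 2).trans ((sq _).trans ?_))
    exact congrArg (· ∘L (commHom (defect η)).1) (adjoint_commHom_defect η).symm
  rw [rho_hardyAct_mul, ContinuousLinearMap.adjoint_comp, e,
    idTensorFock_comp ⟨_, adjoint_mem (commHom (defect η)).2⟩ (commHom (defect η)),
    ← idTensorFock_adjoint]
  rfl

end Fourier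

/-! ### Conjugation by operators supported on a coinvariant range -/

section Coinvariant
variable {F G : Type u} [NormedAddCommGroup F] [InnerProductSpace ℂ F] [CompleteSpace F]
  [NormedAddCommGroup G] [InnerProductSpace ℂ G] [CompleteSpace G]

theorem adjoint_comp_conj {V P : G →L[ℂ] F} {Q : F →L[ℂ] F} (hP : P = Q ∘L V) (Z : F →L[ℂ] F) :
    ContinuousLinearMap.adjoint P ∘L Z ∘L P =
      ContinuousLinearMap.adjoint V ∘L ContinuousLinearMap.adjoint Q ∘L Z ∘L Q ∘L V := by
  rw [hP, ContinuousLinearMap.adjoint_comp]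
  simp only [ContinuousLinearMap.comp_assoc]

theorem adjoint_comp_conj_comp {V P : G →L[ℂ] F} {Q T Z : F →L[ℂ] F} (hP : P = Q ∘L V)
    (h : ContinuousLinearMap.adjoint Q ∘L Z ∘L Q = T ∘L Z) :
    ContinuousLinearMap.adjoint P ∘L Z ∘L P = ContinuousLinearMap.adjoint V ∘L T ∘L Z ∘L V := by
  rw [hP, ContinuousLinearMap.adjoint_comp]
  calc _ = ContinuousLinearMap.adjoint V ∘L (ContinuousLinearMap.adjoint Q ∘L Z ∘L Q) ∘L V := by
        simp only [ContinuousLinearMap.comp_assoc]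
    _ = _ := by rw [h]; simp only [ContinuousLinearMap.comp_assoc]

/-- With $Z_0=V^*ZV$, commutation $Z_0Y=YZ_0$ and coinvariance $Z_0V^*=V^*Z$ give
$P^*ZP=VY^*Z_0YV^*=VY^*YZ_0V^*=VY^*YV^*Z=P^*PZ$. -/
theorem adjoint_conj_comp_of_mem_coinvariantSubalgebra {V : G →L[ℂ] F} {Y : G →L[ℂ] G}
    (hV : ContinuousLinearMap.adjoint V ∘L V = 1) {Z : F →L[ℂ] F}
    (hZ : Z ∈ coinvariantSubalgebra V Y) {P : F →L[ℂ] F}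
    (hP : P = V ∘L Y ∘L ContinuousLinearMap.adjoint V) :
    ContinuousLinearMap.adjoint P ∘L Z ∘L P = (ContinuousLinearMap.adjoint P ∘L P) ∘L Z := by
  obtain ⟨h1, h2⟩ := hZ
  have hP' : ContinuousLinearMap.adjoint P =
      V ∘L ContinuousLinearMap.adjoint Y ∘L ContinuousLinearMap.adjoint V := by
    rw [hP, ContinuousLinearMap.adjoint_comp, ContinuousLinearMap.adjoint_comp,
      ContinuousLinearMap.adjoint_adjoint, ContinuousLinearMap.comp_assoc]
  rw [hP', hP]
  ext x
  have e1 : ∀ y, ContinuousLinearMap.adjoint V (V y) = y := DFunLike.congr_fun hV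
  have e2 := DFunLike.congr_fun h1 x
  have e3 := DFunLike.congr_fun h2 (ContinuousLinearMap.adjoint V x)
  simp only [ContinuousLinearMap.comp_apply] at e2 e3 ⊢
  rw [e1, e3, ← e2]

end Coinvariant

/-! ### The Poisson formula for the point evaluation -/

section Point
variable {H₀ : Type u} [NormedAddCommGroup H₀] [InnerProductSpace ℂ H₀] [CompleteSpace H₀]
  {M : VonNeumannAlgebra H₀} {E : Type u} [NormedAddCommGroup E] [NormedSpace ℂ E]
  [Correspondence (VNA M) E] {K : Rep (VNA M)}
  {π : hardy M E →ₙₐ[ℂ] (K.fock E →L[ℂ] K.fock E)}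

/-- Compression by the Poisson kernel is the point evaluation. -/
theorem IsIntegratedForm.exists_pointEval (hπ : IsIntegratedForm M E (fockAct E K) (creation K) π)
    (η : Dual E K) (hη : ‖η‖ < 1) :
    ∃ π' : hardy M E →ₙₐ[ℂ] (K.carrier →L[ℂ] K.carrier),
      IsIntegratedForm M E K.rep (dualHat η) π' ∧ ∀ X, π' X =
        ContinuousLinearMap.adjoint (poissonKernel η hη) ∘L π X ∘L poissonKernel η hη :=
  hπ.exists_compression _ (adjoint_poissonKernel_comp_self η hη)
    (adjoint_poissonKernel_comp_fockAct η hη) (adjoint_poissonKernel_comp_creation η hη)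

/-- The range of the Fourier transform is coinvariant under the induced representation, and the
compression commutes with the resolvents of creation operators. -/
theorem IsIntegratedForm.mem_coinvariantSubalgebra_fourier
    (hπ : IsIntegratedForm M E (fockAct E K) (creation K) π) (η : Dual E K) (c : VNA K.commutant)
    {R : (idRep K.commutant).fock (Dual E K) →L[ℂ] (idRep K.commutant).fock (Dual E K)}
    (hR : (1 - creation (idRep K.commutant) η) * R = 1)
    (hR' : R * (1 - creation (idRep K.commutant) η) = 1) (X : hardy M E) :
    π X ∈ coinvariantSubalgebra (fourier E K)
      (fockAct (Dual E K) (idRep K.commutant) c * R) := by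
  -- An operator commuting with $I-T_\eta$ commutes with its inverse; here the two-sided inverse is
  -- needed.
  have hcomm : ∀ Z : (idRep K.commutant).fock (Dual E K) →L[ℂ] (idRep K.commutant).fock (Dual E K),
      Commute Z (fockAct (Dual E K) (idRep K.commutant) c) →
      Commute Z (creation (idRep K.commutant) η) →
      Commute Z (fockAct (Dual E K) (idRep K.commutant) c * R) := fun Z h1 h2 => by
    have h3 : Commute Z (1 - creation (idRep K.commutant) η) := (Commute.one_right Z).sub_right h2
    refine h1.mul_right ?_
    change Z * R = R * Z
    calc Z * R = R * (1 - creation (idRep K.commutant) η) * (Z * R) := by rw [hR', one_mul]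
      _ = R * ((1 - creation (idRep K.commutant) η) * Z) * R := by simp only [mul_assoc]
      _ = R * Z * ((1 - creation (idRep K.commutant) η) * R) := by
        rw [← h3.eq]; simp only [mul_assoc]
      _ = R * Z := by rw [hR, mul_one]
  refine hπ.mem_of_isClosed _ (isClosed_coinvariantSubalgebra _ _) (fun a => ?_) (fun ξ => ?_) X
  -- The compressions of the generators are $I\otimes\sigma(a)$ and the right creation operators.
  -- Both commute with the left operators $\varphi_\infty(c)$ and $T_\eta$ on $F(E^\sigma)\otimes
  -- H$.
  · exact mem_coinvariantSubalgebra adjoint_fourier_comp_self (adjoint_fourier_comp_fockAct a)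
      (hcomm _ (idTensorFock_comp_fockAct _ _) (idTensorFock_comp_creation _ _))
  · exact mem_coinvariantSubalgebra adjoint_fourier_comp_self (adjoint_fourier_comp_creation ξ)
      (hcomm _ (rightCreation_comp_fockAct _ _) (rightCreation_comp_creation _ _))

/-- The Poisson formula for an induced representation, with the Poisson kernel expressed through
the resolvent of `T_η`. -/
theorem IsIntegratedForm.poisson_formula
    (hπ : IsIntegratedForm M E (fockAct E K) (creation K) π) (η : Dual E K) (hη : ‖η‖ < 1)
    (R : hardy K.commutant (Dual E K)) (hR : (1 - creation (idRep K.commutant) η) * R.1 = 1)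
    (hR' : R.1 * (1 - creation (idRep K.commutant) η) = 1) (X : hardy M E) :
    ContinuousLinearMap.adjoint (poissonKernel η hη) ∘L π X ∘L poissonKernel η hη =
        ContinuousLinearMap.adjoint (vacuum E K) ∘L
          ContinuousLinearMap.adjoint (rho E K (hardyAct _ _ (defect η) * R)) ∘L π X ∘L
            rho E K (hardyAct _ _ (defect η) * R) ∘L vacuum E K ∧
      ContinuousLinearMap.adjoint (poissonKernel η hη) ∘L π X ∘L poissonKernel η hη =
        ContinuousLinearMap.adjoint (vacuum E K) ∘L
          (ContinuousLinearMap.adjoint (rho E K R) ∘L idTensorFock E (commHom (defect η ^ 2)) ∘L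
            rho E K R) ∘L π X ∘L vacuum E K := by
  have hK := poissonKernel_eq η hη R hR
  have hρ : rho E K (hardyAct _ _ (defect η) * R) = fourier E K ∘L
      (fockAct (Dual E K) (idRep K.commutant) (defect η) * R.1) ∘L
        ContinuousLinearMap.adjoint (fourier E K) := rfl
  have hX := hπ.mem_coinvariantSubalgebra_fourier η (defect η) hR hR' X
  have h2 := adjoint_conj_comp_of_mem_coinvariantSubalgebra
    (adjoint_fourier_comp_self (E := E) (K := K)) hX hρ
  exact ⟨adjoint_comp_conj hK (π X), adjoint_comp_conj_comp hK
    (h2.trans (congrArg (· ∘L π X) (adjoint_rho_comp_rho_defect η R)))⟩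

/-- Formulated for any representation whose induced form exists, so that normality enters the
theorem only through that existence. -/
theorem IsIntegratedForm.existsUnique_and_poisson_formula
    (hπ : IsIntegratedForm M E (fockAct E K) (creation K) π) (η : Dual E K) (hη : ‖η‖ < 1) :
    (∃! π, IsIntegratedForm M E (fockAct E K) (creation K) π) ∧
    (∃! π, IsIntegratedForm M E K.rep (dualHat η) π) ∧
    ∃ R : hardy K.commutant (Dual E K),
      (1 - creation (idRep K.commutant) η) * R.1 = 1 ∧
      R.1 * (1 - creation (idRep K.commutant) η) = 1 ∧
      poissonKernel η hη = rho E K (hardyAct _ _ (defect η) * R) ∘L vacuum E K ∧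
      ∀ X : hardy M E,
        integratedForm M E K.rep (dualHat η) X =
          ContinuousLinearMap.adjoint (poissonKernel η hη) ∘L
            integratedForm M E (fockAct E K) (creation K) X ∘L poissonKernel η hη ∧
        integratedForm M E K.rep (dualHat η) X =
          ContinuousLinearMap.adjoint (vacuum E K) ∘L
            ContinuousLinearMap.adjoint (rho E K (hardyAct _ _ (defect η) * R)) ∘L
              integratedForm M E (fockAct E K) (creation K) X ∘L
                rho E K (hardyAct _ _ (defect η) * R) ∘L vacuum E K ∧
        integratedForm M E K.rep (dualHat η) X =
          ContinuousLinearMap.adjoint (vacuum E K) ∘L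
            (ContinuousLinearMap.adjoint (rho E K R) ∘L idTensorFock E (commHom (defect η ^ 2)) ∘L
              rho E K R) ∘L integratedForm M E (fockAct E K) (creation K) X ∘L vacuum E K := by
  have hπe := hπ.eq_integratedForm
  subst hπe
  obtain ⟨π', hπ', hπ'X⟩ := hπ.exists_pointEval η hη
  have hπe' := hπ'.eq_integratedForm
  subst hπe'
  have hinv := exists_hardy_inverse (M := K.commutant) (E := Dual E K) (ξ := η) Dual.lact_one hη
  obtain ⟨R, hR, hR'⟩ := hinv
  refine ⟨⟨_, hπ, fun _ h => h.unique hπ⟩, ⟨_, hπ', fun _ h => h.unique hπ'⟩, R, hR, hR',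
    poissonKernel_eq η hη R hR, fun X => ?_⟩
  have hX := hπ.poisson_formula η hη R hR hR' X
  exact ⟨hπ'X X, (hπ'X X).trans hX.1, (hπ'X X).trans hX.2⟩

end Point

end PoissonKernel

end

theorem theorem3p6 {H₀ H E : Type u}
    [NormedAddCommGroup H₀] [InnerProductSpace ℂ H₀] [CompleteSpace H₀]
    [NormedAddCommGroup H] [InnerProductSpace ℂ H] [CompleteSpace H]
    (M : VonNeumannAlgebra H₀)
    [NormedAddCommGroup E] [NormedSpace ℂ E] [Correspondence (VNA M) E]
    (hE : IsWStarCorrespondence M E)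
    (σ : VNA M →⋆ₐ[ℂ] (H →L[ℂ] H)) (hσ : IsNormal M σ)
    (η : Dual E (repOf σ)) (hη : ‖η‖ < 1) :
    (∃! π, IsIntegratedForm M E (fockAct E (repOf σ)) (creation (repOf σ)) π) ∧
    (∃! π, IsIntegratedForm M E (repOf σ).rep (dualHat η) π) ∧
    ∃ R : hardy (repOf σ).commutant (Dual E (repOf σ)),
      (1 - creation (idRep (repOf σ).commutant) η) * R.1 = 1 ∧
      R.1 * (1 - creation (idRep (repOf σ).commutant) η) = 1 ∧
      PoissonKernel.poissonKernel η hη =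
        rho E (repOf σ) (hardyAct _ _ (defect η) * R) ∘L vacuum E (repOf σ) ∧
      ∀ X : hardy M E,
        pointEval σ η X =
          ContinuousLinearMap.adjoint (PoissonKernel.poissonKernel η hη) ∘L inducedRep E σ X ∘L PoissonKernel.poissonKernel η hη ∧
        pointEval σ η X =
          ContinuousLinearMap.adjoint (vacuum E (repOf σ)) ∘L
            ContinuousLinearMap.adjoint (rho E (repOf σ) (hardyAct _ _ (defect η) * R)) ∘L
            inducedRep E σ X ∘L
            rho E (repOf σ) (hardyAct _ _ (defect η) * R) ∘L vacuum E (repOf σ) ∧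
        pointEval σ η X =
          ContinuousLinearMap.adjoint (vacuum E (repOf σ)) ∘L
            (ContinuousLinearMap.adjoint (rho E (repOf σ) R) ∘L idTensorFock E (commHom (defect η ^ 2)) ∘L
              rho E (repOf σ) R) ∘L
            inducedRep E σ X ∘L vacuum E (repOf σ) := by
  -- Normality provides the induced form; `inducedRep` and `pointEval` are by definition the
  -- integrated forms in the general statement.
  have hind := hσ.exists_inducedRep (E := E)
  obtain ⟨π, hπ⟩ := hind
  exact IsIntegratedForm.existsUnique_and_poisson_formula (K := repOf σ) hπ η hη
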